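/- **Proposition 2.1.** Let $(S,g)$ be a compact connected Sasaki manifold of dimension $2n+1$, i.e. a compact connected Riemannian manifold together with a complex structure $J$ on the cone $C(S)=\mathbb{R}_{>0}\times S$ for which the cone metric $dr^2+r^2g$ is Kähler. Let $\xi=J(r\partial_r)|_{\{r=1\}}$ be its Reeb field and let $\mathrm{orb}_\xi x$ denote the orbit of $x\in S$ under the flow of $\xi$. For $x,y\in S$ put $$d^T(x,y)=\inf\{\,\mathrm{dist}(a,b) : a\in \mathrm{orb}_\xi x,\ b\in \mathrm{orb}_\xi y\,\},\qquad T(x,r)=\{y\in S : d^T(x,y)\le r\}.$$ For a submanifold $P\subset S$ let $T_{geo}(P,r)$ be the set of all $m\in S$ for which there is a geodesic of length at most $r$ from $m$ to a point of $P$ which meets $P$ orthogonally there. Let $\mathrm{inj}(S)$ be the injectivity radius of $(S,g)$, let $p\in S$, and let $P=\overline{\mathrm{orb}_\xi p}$ be the closure of the Reeb orbit of $p$ (an embedded torus). Then for every real $r\le \mathrm{inj}(S)$, $$T(p,r)=T_{geo}(P,r)=\bigcup_{y\in P}\{\exp_y(v) : v\in (T_yP)^{\perp},\ \|v\|\le r\}.$$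 -/

import Mathlib

open Set Bundle
open scoped Manifold ContDiff ENNReal NNReal

noncomputable section

section Kahler

variable {E : Type*} [NormedAddCommGroup E] [NormedSpace ℝ E]
  {H : Type*} [TopologicalSpace H] (I : ModelWithCorners ℝ E H)
  {M : Type*} [TopologicalSpace M] [ChartedSpace H M]

/-- `D` is the Levi-Civita connection of the metric tensor `g`: it has no torsion, and
`Z (g(X, Y)) = g(D_Z X, Y) + g(X, D_Z Y)`. In Mathlib's notation `D X x v` is `(D_v X)(x)`. -/
def IsLeviCivita [FiniteDimensional ℝ E] [IsManifold I 2 M]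
    (g : ∀ x : M, TangentSpace I x → TangentSpace I x → ℝ)
    (D : CovariantDerivative I E (TangentSpace I : M → Type _)) : Prop :=
  D.torsion = 0 ∧
    ∀ (X Y : ∀ x : M, TangentSpace I x) (x : M),
      MDifferentiableAt I I.tangent (fun y ↦ (⟨y, X y⟩ : TangentBundle I M)) x →
      MDifferentiableAt I I.tangent (fun y ↦ (⟨y, Y y⟩ : TangentBundle I M)) x →
      ∀ v : TangentSpace I x,
        (mfderiv I 𝓘(ℝ, ℝ) (fun y ↦ g y (X y) (Y y)) x v : ℝ)
          = g x (D X x v) (Y x) + g x (X x) (D Y x v)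

/-- The metric tensor `g` is Kähler with complex structure `J`: `J` is a smooth field of
endomorphisms of the tangent spaces with `J² = -1`, it is orthogonal for `g`, and it is parallel
for the Levi-Civita connection of `g`. -/
structure IsKahler [FiniteDimensional ℝ E] [IsManifold I ∞ M]
    (g : ∀ x : M, TangentSpace I x → TangentSpace I x → ℝ)
    (J : ∀ x : M, TangentSpace I x →L[ℝ] TangentSpace I x) : Prop where
  smooth : ContMDiff I (I.prod 𝓘(ℝ, E →L[ℝ] E)) ∞
    (fun x ↦ (TotalSpace.mk' (E →L[ℝ] E) x (J x) :
      TotalSpace (E →L[ℝ] E) (fun x : M ↦ TangentSpace I x →L[ℝ] TangentSpace I x)))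
  sq : ∀ x v, J x (J x v) = -v
  hermitian : ∀ x v w, g x (J x v) (J x w) = g x v w
  parallel : ∃ D : CovariantDerivative I E (TangentSpace I : M → Type _),
    IsLeviCivita I g D ∧
      ∀ (X : ∀ x : M, TangentSpace I x) (x : M),
        MDifferentiableAt I I.tangent (fun y ↦ (⟨y, X y⟩ : TangentBundle I M)) x →
        ∀ v : TangentSpace I x, D (fun y ↦ J y (X y)) x v = J x (D X x v)

end Kahler

section Geodesics

variable {d : ℕ} {M : Type*} [TopologicalSpace M]
  [ChartedSpace (EuclideanSpace ℝ (Fin d)) M]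

/-- The velocity of a curve. -/
def velocity (γ : ℝ → M) (t : ℝ) : TangentSpace (𝓡 d) (γ t) :=
  mfderiv 𝓘(ℝ, ℝ) (𝓡 d) γ t (1 : ℝ)

/-- The curve `γ` starts at `x` with velocity `v`. -/
def HasInitialVelocity (γ : ℝ → M) (x : M) (v : TangentSpace (𝓡 d) x) : Prop :=
  (⟨γ 0, velocity γ 0⟩ : TangentBundle (𝓡 d) M) = ⟨x, v⟩

variable [RiemannianBundle (fun x : M ↦ TangentSpace (𝓡 d) x)]

/-- The Riemannian metric in the coordinates of the chart around `x₀`, at the coordinate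
point `e`: the numbers `g_{ij}(e) v^i w^j`. -/
def chartMetric (x₀ : M) (e v w : EuclideanSpace ℝ (Fin d)) : ℝ :=
  let y : M := (extChartAt (𝓡 d) x₀).symm e
  let T : EuclideanSpace ℝ (Fin d) →L[ℝ] TangentSpace (𝓡 d) y :=
    mfderiv 𝓘(ℝ, EuclideanSpace ℝ (Fin d)) (𝓡 d) (extChartAt (𝓡 d) x₀).symm e
  inner ℝ (T v) (T w)

/-- The Christoffel symbols of the first kind in the chart around `x₀`, contracted with vectors:
`½ (∂_i g_{jk} + ∂_j g_{ik} - ∂_k g_{ij}) v^i w^j z^k`. -/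
def chartChristoffel (x₀ : M) (e v w z : EuclideanSpace ℝ (Fin d)) : ℝ :=
  (1 / 2 : ℝ) * (fderiv ℝ (fun e' ↦ chartMetric x₀ e' w z) e v
    + fderiv ℝ (fun e' ↦ chartMetric x₀ e' v z) e w
    - fderiv ℝ (fun e' ↦ chartMetric x₀ e' v w) e z)

/-- A smooth curve `γ : ℝ → M` is a (complete, affinely parametrized) geodesic if in every chart
its coordinate expression `u` solves the geodesic equation
`g_{kl} (u'')^l + Γ_{ij,k} (u')^i (u')^j = 0`. -/
def IsGeodesic (γ : ℝ → M) : Prop :=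
  ContMDiff 𝓘(ℝ, ℝ) (𝓡 d) ∞ γ ∧
    ∀ (x₀ : M) (t : ℝ), γ t ∈ (extChartAt (𝓡 d) x₀).source →
      let u : ℝ → EuclideanSpace ℝ (Fin d) := fun s ↦ extChartAt (𝓡 d) x₀ (γ s)
      ∀ z, chartMetric x₀ (u t) (deriv (deriv u) t) z
        + chartChristoffel x₀ (u t) (deriv u t) (deriv u t) z = 0

open Classical in
/-- The exponential map: `expMap x v` is the time-one point of the geodesic which starts
at `x` with velocity `v`. (Where there is no such geodesic on `ℝ`, the value is `x`; on a
compact manifold there always is exactly one.) -/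
def expMap (x : M) (v : TangentSpace (𝓡 d) x) : M :=
  if h : ∃ γ : ℝ → M, IsGeodesic (d := d) γ ∧ HasInitialVelocity γ x v then h.choose 1 else x

/-- The injectivity radius at `x`: the supremum of the `ρ` such that `expMap x` is a smooth
diffeomorphism from the ball of radius `ρ` in the tangent space at `x` onto its image. -/
def injRadiusAt (d : ℕ) {M : Type*} [TopologicalSpace M]
    [ChartedSpace (EuclideanSpace ℝ (Fin d)) M]
    [RiemannianBundle (fun x : M ↦ TangentSpace (𝓡 d) x)] (x : M) : ℝ≥0∞ :=
  ⨆ (ρ : ℝ≥0) (_ : InjOn (expMap (d := d) x) (Metric.ball 0 ρ) ∧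
    IsLocalDiffeomorphOn 𝓘(ℝ, TangentSpace (𝓡 d) x) (𝓡 d) ∞ (expMap (d := d) x)
      (Metric.ball 0 ρ)), (ρ : ℝ≥0∞)

/-- The injectivity radius of a Riemannian manifold. -/
def injRadius (d : ℕ) (M : Type*) [TopologicalSpace M]
    [ChartedSpace (EuclideanSpace ℝ (Fin d)) M]
    [RiemannianBundle (fun x : M ↦ TangentSpace (𝓡 d) x)] : ℝ≥0∞ :=
  ⨅ x : M, injRadiusAt d x

/-- The tangent space `T_y P` of a submanifold `P`: it is spanned by (and for an embedded
submanifold it consists of) the velocities at `y` of the smooth curves that run in `P`. -/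
def tangentSpaceOf (P : Set M) (y : M) : Submodule ℝ (TangentSpace (𝓡 d) y) :=
  Submodule.span ℝ {w | ∃ c : ℝ → M, ContMDiff 𝓘(ℝ, ℝ) (𝓡 d) ∞ c ∧ (∀ t, c t ∈ P) ∧
    HasInitialVelocity c y w}

/-- The normal space `T_y P^⊥` of a submanifold `P`. -/
def normalSpaceOf (P : Set M) (y : M) : Submodule ℝ (TangentSpace (𝓡 d) y) :=
  (tangentSpaceOf P y)ᗮ

/-- The closed geodesic tube of radius `r` around `P`: the points that are joined to a point
of `P` by a geodesic of length at most `r` which meets `P` orthogonally at that point. -/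
def geodesicTube (d : ℕ) {M : Type*} [TopologicalSpace M]
    [ChartedSpace (EuclideanSpace ℝ (Fin d)) M]
    [RiemannianBundle (fun x : M ↦ TangentSpace (𝓡 d) x)] (P : Set M) (r : ℝ) : Set M :=
  {m | ∃ γ : ℝ → M, IsGeodesic (d := d) γ ∧ γ 1 = m ∧ γ 0 ∈ P ∧
    velocity (d := d) γ 0 ∈ normalSpaceOf (d := d) P (γ 0) ∧
    ((Manifold.pathELength (𝓡 d) γ 0 1 : ℝ≥0∞) : EReal) ≤ (r : EReal)}

end Geodesics

section Sasaki

/-- The underlying manifold `ℝ_{>0} × S` of the metric cone of `S`. -/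
abbrev Cone (S : Type*) : Type _ :=
  (⟨Ioi (0 : ℝ), isOpen_Ioi⟩ : TopologicalSpace.Opens ℝ) × S

/-- The model of the cone over a manifold of dimension `d`. -/
abbrev coneModel (d : ℕ) :
    ModelWithCorners ℝ (ℝ × EuclideanSpace ℝ (Fin d)) (ModelProd ℝ (EuclideanSpace ℝ (Fin d))) :=
  𝓘(ℝ, ℝ).prod (𝓡 d)

variable {d : ℕ} {S : Type*} [TopologicalSpace S] [ChartedSpace (EuclideanSpace ℝ (Fin d)) S]

/-- The component `dr(u)` of a tangent vector `u` of the cone. -/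
def coneRadial (c : Cone S) (u : TangentSpace (coneModel d) c) : ℝ :=
  mfderiv (coneModel d) 𝓘(ℝ, ℝ) (fun c' : Cone S ↦ (c'.1 : ℝ)) c u

/-- The component of a tangent vector of the cone that is tangent to `S`. -/
def coneTangential (c : Cone S) (u : TangentSpace (coneModel d) c) : TangentSpace (𝓡 d) c.2 :=
  mfderiv (coneModel d) (𝓡 d) (fun c' : Cone S ↦ c'.2) c u

/-- The cone metric `dr² + r² g`. -/
def coneMetric [RiemannianBundle (fun x : S ↦ TangentSpace (𝓡 d) x)] (c : Cone S)
    (u v : TangentSpace (coneModel d) c) : ℝ :=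
  coneRadial c u * coneRadial c v
    + (c.1 : ℝ) ^ 2 * inner ℝ (coneTangential c u) (coneTangential c v)

/-- The Euler vector field `r ∂_r` of the cone: the velocity at `s = 0` of `s ↦ (eˢ r, x)`. -/
def eulerField (c : Cone S) : TangentSpace (coneModel d) c :=
  ((c.1 : ℝ), (0 : EuclideanSpace ℝ (Fin d)))

/-- A Sasaki structure on a Riemannian manifold `S` of dimension `2n + 1`: a complex structure
`J` on the cone of `S` for which the cone metric is Kähler. -/
structure SasakiStructure (n : ℕ) (S : Type*) [TopologicalSpace S]
    [ChartedSpace (EuclideanSpace ℝ (Fin (2 * n + 1))) S]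
    [IsManifold (𝓡 (2 * n + 1)) ∞ S]
    [RiemannianBundle (fun x : S ↦ TangentSpace (𝓡 (2 * n + 1)) x)] where
  J : ∀ c : Cone S,
    TangentSpace (coneModel (2 * n + 1)) c →L[ℝ] TangentSpace (coneModel (2 * n + 1)) c
  isKahler : IsKahler (coneModel (2 * n + 1)) coneMetric J

namespace SasakiStructure

variable {n : ℕ} {S : Type*} [MetricSpace S]
    [ChartedSpace (EuclideanSpace ℝ (Fin (2 * n + 1))) S]
    [IsManifold (𝓡 (2 * n + 1)) ∞ S]
    [RiemannianBundle (fun x : S ↦ TangentSpace (𝓡 (2 * n + 1)) x)]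

/-- The Reeb field `ξ = J (r ∂_r)` along the slice `{r = 1} = S`. -/
def reeb (σ : SasakiStructure n S) (x : S) : TangentSpace (𝓡 (2 * n + 1)) x :=
  let c : Cone S := (⟨1, mem_Ioi.2 one_pos⟩, x)
  coneTangential c (σ.J c (eulerField c))

/-- The orbit of `x` under the flow of the Reeb field. -/
def orbit (σ : SasakiStructure n S) (x : S) : Set S :=
  {y | ∃ (γ : ℝ → S) (t : ℝ), IsMIntegralCurve (I := 𝓡 (2 * n + 1)) γ σ.reeb ∧
    γ 0 = x ∧ γ t = y}

/-- The transverse distance `d^T(x, y)`: the infimum of the Riemannian distances between points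
of the orbits of `x` and of `y`. -/
def transverseDist (σ : SasakiStructure n S) (x y : S) : ℝ :=
  sInf (image2 dist (σ.orbit x) (σ.orbit y))

/-- The closed transverse tube of radius `r` about `x`. -/
def transverseTube (σ : SasakiStructure n S) (x : S) (r : ℝ) : Set S :=
  {y | σ.transverseDist x y ≤ r}

end SasakiStructure

end Sasaki

end

/-! The Reeb field `ξ` is a Killing field, so its flow preserves distances. Any pair `a ∈ orb x`, `b
∈ orb y` can therefore be flowed until `b` arrives at `y`, and `d^T(x, y)` is the distance from `y`
to the orbit of `x`, that is, to the compact closure `P` of this orbit, where it is attained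
(`SasakiStructure.transverseDist_le_iff`).

If `q` is a point of `P` nearest to `y` and `dist y q ≤ inj(S)`, a shortest geodesic joins `q` to
`y`. By the first variation of distance it leaves `P` orthogonally
(`exists_geodesic_normal_of_isMin`), so `y` lies in the geodesic tube. Conversely, a geodesic of
length at most `r` from `P` bounds the distance to `P` by `r`. The second equality holds because a
geodesic on `[0, 1]` has constant speed, so that its length is the norm of its initial velocity
(`geodesicTube_eq_iUnion_expMap`).

Two bodies of Riemannian geometry support this. The first is the theory of normal balls: uniqueness
of geodesics, the Gauss lemma (`IsNormalBall.inner_mfderiv_radial`), and a Hopf-Rinow argument up to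
and including the injectivity radius (`exists_norm_eq_dist`).

The second is the isometry of the Reeb flow. On the cone, the Euler field `E = r ∂_r` satisfies `∇_u
E = u`, hence `∇_u (JE) = Ju` because `J` is parallel, and `⟨Ju, u⟩ = 0` is the Killing equation
(`fderiv_metricForm_reebRep`). The passage to distances avoids differentiating the flow in its
initial point. The Euler step `e ↦ e + s X(e)` of a Killing field changes the metric only to order
`s²` (`exists_pushed_form_le`), so the distance of two integral curves has growth rate at most `ε`
for every `ε > 0`. A continuity argument in time and a subdivision of paths then give
`HasKillingReps.dist_le`. -/

set_option linter.unusedSectionVars false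

noncomputable section

section

set_option maxSynthPendingDepth 3

/-! ### The metric in charts -/

section ChartMetric

open Filter Topology

variable {d : ℕ} {M : Type*} [TopologicalSpace M]
  [ChartedSpace (EuclideanSpace ℝ (Fin d)) M]
  [RiemannianBundle (fun x : M ↦ TangentSpace (𝓡 d) x)]

/-- The differential of the inverse of the chart around `x₀` at the coordinate point `e`. -/
def chartFrame (x₀ : M) (e : EuclideanSpace ℝ (Fin d)) :
    EuclideanSpace ℝ (Fin d) →L[ℝ] TangentSpace (𝓡 d) ((extChartAt (𝓡 d) x₀).symm e) :=
  mfderiv 𝓘(ℝ, EuclideanSpace ℝ (Fin d)) (𝓡 d) (extChartAt (𝓡 d) x₀).symm e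

lemma chartMetric_eq (x₀ : M) (e v w : EuclideanSpace ℝ (Fin d)) :
    chartMetric x₀ e v w = inner ℝ (chartFrame x₀ e v) (chartFrame x₀ e w) := rfl

/-- The metric in the chart around `x₀`, as a bilinear form. -/
def metricForm (x₀ : M) (e : EuclideanSpace ℝ (Fin d)) :
    EuclideanSpace ℝ (Fin d) →L[ℝ] EuclideanSpace ℝ (Fin d) →L[ℝ] ℝ :=
  (LinearMap.mk₂ ℝ (chartMetric x₀ e)
    (fun a b c ↦ by rw [chartMetric_eq, map_add, inner_add_left]; rfl)
    (fun a b c ↦ by rw [chartMetric_eq, map_smul, real_inner_smul_left]; rfl)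
    (fun a b c ↦ by rw [chartMetric_eq, map_add, inner_add_right]; rfl)
    (fun a b c ↦ by rw [chartMetric_eq, map_smul, real_inner_smul_right]; rfl)).toContinuousBilinearMap

lemma metricForm_apply (x₀ : M) (e v w : EuclideanSpace ℝ (Fin d)) :
    metricForm x₀ e v w = chartMetric x₀ e v w := by
  rfl

lemma metricForm_symm (x₀ : M) (e v w : EuclideanSpace ℝ (Fin d)) :
    metricForm x₀ e v w = metricForm x₀ e w v :=
  real_inner_comm (chartFrame x₀ e w) (chartFrame x₀ e v)

lemma metricForm_self_nonneg (x₀ : M) (e v : EuclideanSpace ℝ (Fin d)) :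
    0 ≤ metricForm x₀ e v v :=
  real_inner_self_nonneg (x := chartFrame x₀ e v)

variable [IsManifold (𝓡 d) ∞ M]

omit [RiemannianBundle (fun x : M ↦ TangentSpace (𝓡 d) x)] in
lemma mdifferentiableAt_extChartAt_symm {x₀ : M} {e : EuclideanSpace ℝ (Fin d)}
    (he : e ∈ (extChartAt (𝓡 d) x₀).target) :
    MDifferentiableAt 𝓘(ℝ, EuclideanSpace ℝ (Fin d)) (𝓡 d) (extChartAt (𝓡 d) x₀).symm e := by
  have := mdifferentiableWithinAt_extChartAt_symm (I := 𝓡 d) he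
  rwa [(𝓡 d).range_eq_univ, mdifferentiableWithinAt_univ] at this

omit [IsManifold (𝓡 d) ∞ M] in
-- All tangent spaces are the model space by definition, but their inner products depend on the base
-- point. This moves an inner product along an equality of base points without casts.
lemma inner_congr_base {y y' : M} (h : y = y') (a b : EuclideanSpace ℝ (Fin d)) :
    (inner ℝ (show TangentSpace (𝓡 d) y from a) (show TangentSpace (𝓡 d) y from b) : ℝ) =
    inner ℝ (show TangentSpace (𝓡 d) y' from a) (show TangentSpace (𝓡 d) y' from b) := by
  subst h; rfl

/-- The chain rule for `f = chart⁻¹ ∘ (chart ∘ f)`. It is stated in the model space, since the two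
sides belong to tangent spaces at points that are only propositionally equal. -/
lemma mfderiv_eq_chartFrame {F : Type*} [NormedAddCommGroup F] [NormedSpace ℝ F]
    {x₀ : M} {f : F → M} {a : F}
    (hf : MDifferentiableAt 𝓘(ℝ, F) (𝓡 d) f a) (ha : f a ∈ (extChartAt (𝓡 d) x₀).source) (h : F) :
    (mfderiv 𝓘(ℝ, F) (𝓡 d) f a h : EuclideanSpace ℝ (Fin d)) =
      chartFrame x₀ (extChartAt (𝓡 d) x₀ (f a))
        (fderiv ℝ (fun s ↦ extChartAt (𝓡 d) x₀ (f s)) a h) := by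
  have hu : MDifferentiableAt 𝓘(ℝ, F) 𝓘(ℝ, EuclideanSpace ℝ (Fin d))
      (fun s ↦ extChartAt (𝓡 d) x₀ (f s)) a :=
    (mdifferentiableAt_extChartAt (by rwa [extChartAt_source] at ha)).comp a hf
  have hev : f =ᶠ[𝓝 a] (extChartAt (𝓡 d) x₀).symm ∘ (fun s ↦ extChartAt (𝓡 d) x₀ (f s)) := by
    filter_upwards [hf.continuousAt.preimage_mem_nhds
      ((isOpen_extChartAt_source x₀).mem_nhds ha)] with s hs
    exact ((extChartAt (𝓡 d) x₀).left_inv hs).symm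
  have h1 := hev.mfderiv_eq (I := 𝓘(ℝ, F)) (I' := 𝓡 d)
  have h2 := mfderiv_comp a (mdifferentiableAt_extChartAt_symm
    ((extChartAt (𝓡 d) x₀).map_source ha)) hu
  rw [mfderiv_eq_fderiv] at h2
  exact (congrArg (fun L : F →L[ℝ] EuclideanSpace ℝ (Fin d) ↦ L h) h1).trans
    (congrArg (fun L : F →L[ℝ] EuclideanSpace ℝ (Fin d) ↦ L h) h2)

lemma inner_mfderiv {F : Type*} [NormedAddCommGroup F] [NormedSpace ℝ F]
    {x₀ : M} {f : F → M} {a : F}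
    (hf : MDifferentiableAt 𝓘(ℝ, F) (𝓡 d) f a) (ha : f a ∈ (extChartAt (𝓡 d) x₀).source)
    (h k : F) :
    (inner ℝ (mfderiv 𝓘(ℝ, F) (𝓡 d) f a h : TangentSpace (𝓡 d) (f a))
      (mfderiv 𝓘(ℝ, F) (𝓡 d) f a k : TangentSpace (𝓡 d) (f a)) : ℝ) =
    metricForm x₀ (extChartAt (𝓡 d) x₀ (f a))
      (fderiv ℝ (fun s ↦ extChartAt (𝓡 d) x₀ (f s)) a h)
      (fderiv ℝ (fun s ↦ extChartAt (𝓡 d) x₀ (f s)) a k) := by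
  rw [metricForm_apply, chartMetric_eq]
  have h1 := inner_congr_base ((extChartAt (𝓡 d) x₀).left_inv ha).symm
    (mfderiv 𝓘(ℝ, F) (𝓡 d) f a h) (mfderiv 𝓘(ℝ, F) (𝓡 d) f a k)
  refine h1.trans ?_
  rw [mfderiv_eq_chartFrame hf ha h, mfderiv_eq_chartFrame hf ha k]

omit [RiemannianBundle (fun x : M ↦ TangentSpace (𝓡 d) x)] in
lemma chartFrame_injective {x₀ : M} {e : EuclideanSpace ℝ (Fin d)}
    (he : e ∈ (extChartAt (𝓡 d) x₀).target) : Function.Injective (chartFrame x₀ e) := by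
  have := isInvertible_mfderivWithin_extChartAt_symm (I := 𝓡 d) he
  rw [(𝓡 d).range_eq_univ, mfderivWithin_univ] at this
  exact this.injective

lemma metricForm_self_pos {x₀ : M} {e v : EuclideanSpace ℝ (Fin d)}
    (he : e ∈ (extChartAt (𝓡 d) x₀).target) (hv : v ≠ 0) : 0 < metricForm x₀ e v v := by
  refine real_inner_self_pos (x := chartFrame x₀ e v).2 fun h ↦ hv (chartFrame_injective he (h.trans (map_zero _).symm))

variable [IsContMDiffRiemannianBundle (𝓡 d) ∞ (EuclideanSpace ℝ (Fin d))
      (fun x : M ↦ TangentSpace (𝓡 d) x)]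

omit [RiemannianBundle (fun x : M ↦ TangentSpace (𝓡 d) x)]
  [IsContMDiffRiemannianBundle (𝓡 d) ∞ (EuclideanSpace ℝ (Fin d))
      (fun x : M ↦ TangentSpace (𝓡 d) x)] in
lemma contMDiffOn_chartFrame (x₀ : M) (v : EuclideanSpace ℝ (Fin d)) :
    ContMDiffOn 𝓘(ℝ, EuclideanSpace ℝ (Fin d)) (𝓡 d).tangent ∞
      (fun e ↦ (⟨(extChartAt (𝓡 d) x₀).symm e, chartFrame x₀ e v⟩ : TangentBundle (𝓡 d) M))
      (extChartAt (𝓡 d) x₀).target := by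
  have hopen : IsOpen (extChartAt (𝓡 d) x₀).target := isOpen_extChartAt_target x₀
  have h1 := (contMDiffOn_extChartAt_symm (I := 𝓡 d) (n := ∞) x₀).contMDiffOn_tangentMapWithin
    (m := ∞) (by simp) hopen.uniqueMDiffOn
  have h2 : ContMDiff 𝓘(ℝ, EuclideanSpace ℝ (Fin d)) 𝓘(ℝ, EuclideanSpace ℝ (Fin d)).tangent ∞
      (fun e ↦ (⟨e, v⟩ : TangentBundle 𝓘(ℝ, EuclideanSpace ℝ (Fin d))
        (EuclideanSpace ℝ (Fin d)))) := by
    exact contMDiff_vectorSpace_iff_contDiff.2 contDiff_const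
  refine (h1.comp h2.contMDiffOn (fun e he ↦ he)).congr fun e he ↦ ?_
  simp only [Function.comp_apply, tangentMapWithin]
  rw [mfderivWithin_of_isOpen hopen he]
  rfl

lemma contDiffOn_metricForm (x₀ : M) :
    ContDiffOn ℝ ∞ (metricForm x₀) (extChartAt (𝓡 d) x₀).target := by
  rw [contDiffOn_clm_apply]
  intro v
  rw [contDiffOn_clm_apply]
  intro w
  have := (contMDiffOn_chartFrame x₀ v).inner_bundle (contMDiffOn_chartFrame x₀ w)
  exact this.contDiffOn

end ChartMetric

/-! ### The geodesic equation as a second order equation in a vector space -/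

section SecondOrder

open Filter Topology

variable {E : Type*} [NormedAddCommGroup E] [NormedSpace ℝ E]
  {F : Type*} [NormedAddCommGroup F] [NormedSpace ℝ F]

/-- The coordinate form of the identity `∂ₕ⟨∂ₕU, ∂ₖU⟩ = ½ ∂ₖ⟨∂ₕU, ∂ₕU⟩` for a map whose `h`-lines
are geodesics. -/
lemma fderiv_form_of_geodesic {G : E → E →L[ℝ] E →L[ℝ] ℝ} {U : F → E} {p h k : F}
    (hG : DifferentiableAt ℝ G (U p)) (hsymm : ∀ e v w, G e v w = G e w v)
    (hU : ContDiffAt ℝ 2 U p)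
    (hgeo : ∀ z, G (U p) (fderiv ℝ (fderiv ℝ U) p h h) z
      + (fderiv ℝ G (U p) (fderiv ℝ U p h) (fderiv ℝ U p h) z
        - (1 / 2 : ℝ) * fderiv ℝ G (U p) z (fderiv ℝ U p h) (fderiv ℝ U p h)) = 0) :
    fderiv ℝ (fun q ↦ G (U q) (fderiv ℝ U q h) (fderiv ℝ U q k)) p h
      = (1 / 2 : ℝ) * fderiv ℝ (fun q ↦ G (U q) (fderiv ℝ U q h) (fderiv ℝ U q h)) p k := by
  have h1 : HasFDerivAt U (fderiv ℝ U p) p := (hU.differentiableAt (by simp)).hasFDerivAt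
  have h2 : HasFDerivAt (fderiv ℝ U) (fderiv ℝ (fderiv ℝ U) p) p :=
    ((hU.fderiv_right (m := 1) (by norm_num)).differentiableAt (by simp)).hasFDerivAt
  have hs : IsSymmSndFDerivAt ℝ U p := hU.isSymmSndFDerivAt (by simp)
  have key : ∀ j l, fderiv ℝ (fun q ↦ G (U q) (fderiv ℝ U q h) (fderiv ℝ U q j)) p l
      = fderiv ℝ G (U p) (fderiv ℝ U p l) (fderiv ℝ U p h) (fderiv ℝ U p j)
        + G (U p) (fderiv ℝ (fderiv ℝ U) p l h) (fderiv ℝ U p j)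
        + G (U p) (fderiv ℝ U p h) (fderiv ℝ (fderiv ℝ U) p l j) := by
    intro j l
    have hGU : HasFDerivAt (fun q ↦ G (U q)) ((fderiv ℝ G (U p)).comp (fderiv ℝ U p)) p :=
      HasFDerivAt.comp (g := G) p hG.hasFDerivAt h1
    have ha : ∀ i, HasFDerivAt (fun q ↦ fderiv ℝ U q i)
        ((fderiv ℝ (fderiv ℝ U) p).flip i) p := fun i ↦ by
      simpa using! h2.clm_apply (hasFDerivAt_const i p)
    have := (hGU.clm_apply (ha h)).clm_apply (ha j)
    have h3 := this.fderiv
    rw [h3]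
    simp
    ring
  rw [key, key]
  -- The geodesic equation tested on `∂ₖU` removes the term with `∂ₕ∂ₕU`. The rest agrees by the
  -- symmetry of `G` and of the second derivative of `U`.
  have := hgeo (fderiv ℝ U p k)
  rw [hs h k, hsymm _ (fderiv ℝ U p h) (fderiv ℝ (fderiv ℝ U) p k h)]
  linarith

/-- A positive form has no kernel, and `E` and its dual have the same dimension. This allows the
geodesic equation to be solved for the second derivative. -/
lemma isInvertible_of_form_pos [FiniteDimensional ℝ E] {A : E →L[ℝ] E →L[ℝ] ℝ}
    (hA : ∀ v, v ≠ 0 → 0 < A v v) : A.IsInvertible := by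
  have hinj : Function.Injective (A : E →ₗ[ℝ] E →L[ℝ] ℝ) := by
    refine (injective_iff_map_eq_zero _).2 fun v hv ↦ ?_
    by_contra hne
    have := hA v hne
    rw [show A v = 0 from hv] at this
    simp at this
  have hdim : Module.finrank ℝ E = Module.finrank ℝ (E →L[ℝ] ℝ) := by
    rw [← (LinearMap.toContinuousLinearMap (𝕜 := ℝ) (E := E) (F' := ℝ)).finrank_eq]
    exact (Subspace.dual_finrank_eq (K := ℝ) (V := E)).symm
  exact ⟨(LinearEquiv.ofInjectiveOfFinrankEq _ hinj hdim).toContinuousLinearEquiv, rfl⟩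

/-- Solutions of the geodesic equation in coordinates are determined by their position and velocity
at one time. -/
lemma eventuallyEq_of_geodesic_equation [FiniteDimensional ℝ E] {s : Set E} (hs : IsOpen s)
    {G : E → E →L[ℝ] E →L[ℝ] ℝ} (hG : ContDiffOn ℝ ∞ G s)
    (hpos : ∀ e ∈ s, ∀ v, v ≠ 0 → 0 < G e v v) {u w : ℝ → E} {t₀ : ℝ}
    (hu : ContDiffAt ℝ 2 u t₀) (hw : ContDiffAt ℝ 2 w t₀) (hus : u t₀ ∈ s)
    (hgu : ∀ᶠ t in 𝓝 t₀, ∀ z, G (u t) (deriv (deriv u) t) z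
      + (fderiv ℝ G (u t) (deriv u t) (deriv u t) z
        - (1 / 2 : ℝ) * fderiv ℝ G (u t) z (deriv u t) (deriv u t)) = 0)
    (hgw : ∀ᶠ t in 𝓝 t₀, ∀ z, G (w t) (deriv (deriv w) t) z
      + (fderiv ℝ G (w t) (deriv w t) (deriv w t) z
        - (1 / 2 : ℝ) * fderiv ℝ G (w t) z (deriv w t) (deriv w t)) = 0)
    (h0 : u t₀ = w t₀) (h1 : deriv u t₀ = deriv w t₀) : u =ᶠ[𝓝 t₀] w := by
  -- `B` is the covector of Christoffel terms, and the equation becomes the first order system `(u,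
  -- u')' = X (u, u')`, to which uniqueness for locally Lipschitz fields applies.
  let B : E × E → E →L[ℝ] ℝ := fun q ↦
    (fderiv ℝ G q.1 q.2 q.2) - (1 / 2 : ℝ) • ((fderiv ℝ G q.1).flip q.2).flip q.2
  let X : E × E → E × E := fun q ↦ (q.2, - (G q.1).inverse (B q))
  have hBs : ContDiffOn ℝ 1 B (s ×ˢ univ) := by
    rw [contDiffOn_clm_apply]
    intro z
    have hD : ContDiffOn ℝ 1 (fun q : E × E ↦ fderiv ℝ G q.1) (s ×ˢ univ) :=
      (hG.fderiv_of_isOpen (m := 1) hs (by norm_cast)).comp contDiffOn_fst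
        (fun q hq ↦ hq.1)
    simp only [B, sub_apply, smul_apply,
      ContinuousLinearMap.flip_apply]
    refine ContDiffOn.sub (((hD.clm_apply contDiffOn_snd).clm_apply contDiffOn_snd).clm_apply
      contDiffOn_const) (ContDiffOn.const_smul _ ?_)
    exact ((hD.clm_apply contDiffOn_const).clm_apply contDiffOn_snd).clm_apply contDiffOn_snd
  have hX : ContDiffAt ℝ 1 X (u t₀, deriv u t₀) := by
    have hn : s ×ˢ univ ∈ 𝓝 (u t₀, deriv u t₀) := (hs.prod isOpen_univ).mem_nhds ⟨hus, mem_univ _⟩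
    have hGc : ContDiffAt ℝ 1 (fun q : E × E ↦ G q.1) (u t₀, deriv u t₀) :=
      ((hG.contDiffAt (hs.mem_nhds hus)).of_le (by exact_mod_cast le_top)).comp
        (u t₀, deriv u t₀) contDiffAt_fst
    have hinv : ContDiffAt ℝ 1 (fun q : E × E ↦ (G q.1).inverse) (u t₀, deriv u t₀) :=
      ContDiffAt.comp (g := ContinuousLinearMap.inverse) (u t₀, deriv u t₀)
        (isInvertible_of_form_pos (hpos _ hus)).contDiffAt_map_inverse hGc
    exact contDiffAt_snd.prodMk (hinv.clm_apply (hBs.contDiffAt hn)).neg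
  obtain ⟨K, S, hS, hlip⟩ := hX.exists_lipschitzOnWith
  have key : ∀ v : ℝ → E, ContDiffAt ℝ 2 v t₀ → v t₀ = u t₀ → deriv v t₀ = deriv u t₀ →
      (∀ᶠ t in 𝓝 t₀, ∀ z, G (v t) (deriv (deriv v) t) z
      + (fderiv ℝ G (v t) (deriv v t) (deriv v t) z
        - (1 / 2 : ℝ) * fderiv ℝ G (v t) z (deriv v t) (deriv v t)) = 0) →
      ∀ᶠ t in 𝓝 t₀, HasDerivAt (fun t ↦ (v t, deriv v t)) (X (v t, deriv v t)) t ∧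
        (v t, deriv v t) ∈ S := by
    intro v hv hv0 hv1 hgv
    have hd : ContDiffAt ℝ 1 (deriv v) t₀ := by
      have := (hv.fderiv_right (m := 1) (by norm_num)).clm_apply
        (contDiffAt_const (c := (1 : ℝ)))
      exact this
    have hmem : ∀ᶠ t in 𝓝 t₀, (v t, deriv v t) ∈ S :=
      (hv.continuousAt.prodMk hd.continuousAt).eventually (by
        simp only [hv0, hv1]; exact hS)
    have hmem' : ∀ᶠ t in 𝓝 t₀, v t ∈ s :=
      hv.continuousAt.eventually (by rw [hv0]; exact hs.mem_nhds hus)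
    filter_upwards [hgv, hmem, hmem', hv.eventually (by simp), hd.eventually (by simp)]
      with t hg hm hm' hvt hdt
    refine ⟨?_, hm⟩
    have e1 : deriv (deriv v) t = - (G (v t)).inverse (B (v t, deriv v t)) := by
      have : G (v t) (deriv (deriv v) t) = - B (v t, deriv v t) := by
        ext z
        have := hg z
        simp only [B, neg_apply, sub_apply,
          smul_apply, ContinuousLinearMap.flip_apply, smul_eq_mul]
        linarith
      obtain ⟨A, hA⟩ := isInvertible_of_form_pos (hpos _ hm')
      rw [← map_neg, ← this, ← hA]
      simp
    have := ((hvt.differentiableAt (by simp)).hasDerivAt).prodMk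
      ((hdt.differentiableAt (by simp)).hasDerivAt)
    rwa [e1] at this
  have := ODE_solution_unique_of_eventually (v := fun _ ↦ X) (s := fun _ ↦ S) (K := K)
    (Eventually.of_forall fun _ ↦ hlip) (key u hu rfl rfl hgu) (key w hw h0.symm h1.symm hgw)
    (by rw [h0, h1])
  exact this.mono fun t ht ↦ congrArg Prod.fst ht

end SecondOrder

/-! ### Geodesics in charts, variations through geodesics, constant speed -/

section GeodesicBasics

open Filter Topology

variable {d : ℕ} {M : Type*} [TopologicalSpace M]
  [ChartedSpace (EuclideanSpace ℝ (Fin d)) M]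
  [RiemannianBundle (fun x : M ↦ TangentSpace (𝓡 d) x)]
  [IsManifold (𝓡 d) ∞ M]
  [IsContMDiffRiemannianBundle (𝓡 d) ∞ (EuclideanSpace ℝ (Fin d))
      (fun x : M ↦ TangentSpace (𝓡 d) x)]

lemma contDiffAt_metricForm {x₀ : M} {e : EuclideanSpace ℝ (Fin d)}
    (he : e ∈ (extChartAt (𝓡 d) x₀).target) : ContDiffAt ℝ ∞ (metricForm x₀) e :=
  (contDiffOn_metricForm x₀).contDiffAt ((isOpen_extChartAt_target x₀).mem_nhds he)

lemma chartChristoffel_self {x₀ : M} {e : EuclideanSpace ℝ (Fin d)}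
    (he : e ∈ (extChartAt (𝓡 d) x₀).target) (v z : EuclideanSpace ℝ (Fin d)) :
    chartChristoffel x₀ e v v z = fderiv ℝ (metricForm x₀) e v v z
      - (1 / 2 : ℝ) * fderiv ℝ (metricForm x₀) e z v v := by
  have hd : DifferentiableAt ℝ (metricForm x₀) e :=
    (contDiffAt_metricForm he).differentiableAt (by simp)
  have key : ∀ a b c, fderiv ℝ (fun e' ↦ chartMetric x₀ e' a b) e c
      = fderiv ℝ (metricForm x₀) e c a b := by
    intro a b c
    have h := ((hd.hasFDerivAt.clm_apply (hasFDerivAt_const a e)).clm_apply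
      (hasFDerivAt_const b e)).fderiv
    have h' : (fun e' ↦ chartMetric x₀ e' a b) = fun e' ↦ metricForm x₀ e' a b := by
      ext; rw [metricForm_apply]
    rw [h', h]
    simp
  rw [chartChristoffel, key, key]
  ring

lemma contDiffAt_chart_comp {F : Type*} [NormedAddCommGroup F] [NormedSpace ℝ F] {n : ℕ∞}
    {x₀ : M} {f : F → M} {a : F} (hf : ContMDiffAt 𝓘(ℝ, F) (𝓡 d) n f a)
    (ha : f a ∈ (extChartAt (𝓡 d) x₀).source) :
    ContDiffAt ℝ n (fun s ↦ extChartAt (𝓡 d) x₀ (f s)) a := by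
  have : ContMDiffAt (𝓡 d) 𝓘(ℝ, EuclideanSpace ℝ (Fin d)) n (extChartAt (𝓡 d) x₀) (f a) :=
    (contMDiffAt_extChartAt' (n := ∞) (by rwa [extChartAt_source] at ha)).of_le
      (by exact_mod_cast le_top)
  exact (this.comp a hf).contDiffAt

lemma IsGeodesic.coordinate_equation {γ : ℝ → M} (hγ : IsGeodesic (d := d) γ) {x₀ : M} {t : ℝ}
    (ht : γ t ∈ (extChartAt (𝓡 d) x₀).source) (z : EuclideanSpace ℝ (Fin d)) :
    let u : ℝ → EuclideanSpace ℝ (Fin d) := fun s ↦ extChartAt (𝓡 d) x₀ (γ s)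
    metricForm x₀ (u t) (deriv (deriv u) t) z
      + (fderiv ℝ (metricForm x₀) (u t) (deriv u t) (deriv u t) z
        - (1 / 2 : ℝ) * fderiv ℝ (metricForm x₀) (u t) z (deriv u t) (deriv u t)) = 0 := by
  intro u
  have := hγ.2 x₀ t ht z
  rwa [chartChristoffel_self ((extChartAt (𝓡 d) x₀).map_source ht), ← metricForm_apply] at this

/-- This converts the ordinary derivatives in the equation of a single geodesic into partial
derivatives of a family `U` that has the geodesic as one of its lines. -/
lemma line_derivs {E F : Type*} [NormedAddCommGroup E] [NormedSpace ℝ E]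
    [NormedAddCommGroup F] [NormedSpace ℝ F] {U : F → E} {p h : F} (hU : ContDiffAt ℝ 2 U p)
    {u : ℝ → E} {t₀ : ℝ} (hu : u =ᶠ[𝓝 t₀] fun t ↦ U (p + (t - t₀) • h)) :
    u t₀ = U p ∧ deriv u t₀ = fderiv ℝ U p h ∧
      deriv (deriv u) t₀ = fderiv ℝ (fderiv ℝ U) p h h := by
  have hU1 : ContDiffAt ℝ 1 (fderiv ℝ U) p := hU.fderiv_right (m := 1) (by norm_num)
  have hline : ∀ t, HasDerivAt (fun t : ℝ ↦ p + (t - t₀) • h) h t := fun t ↦ by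
    simpa using! (((hasDerivAt_id t).sub_const t₀).smul_const h).const_add p
  have hlim : Tendsto (fun t : ℝ ↦ p + (t - t₀) • h) (𝓝 t₀) (𝓝 p) := by
    simpa using! (hline t₀).continuousAt.tendsto
  have hu1 : ∀ᶠ t in 𝓝 t₀, deriv u t = fderiv ℝ U (p + (t - t₀) • h) h := by
    filter_upwards [hu.eventuallyEq_nhds, hlim.eventually (hU.eventually (by simp))]
      with t ht hUt
    rw [ht.deriv_eq]
    exact ((hUt.differentiableAt (by simp)).hasFDerivAt.comp_hasDerivAt t (hline t)).deriv
  have hp : p + (t₀ - t₀) • h = p := by simp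
  refine ⟨by simpa using hu.self_of_nhds, by simpa using hu1.self_of_nhds, ?_⟩
  rw [Filter.EventuallyEq.deriv_eq hu1]
  have h3 : HasFDerivAt (fderiv ℝ U) (fderiv ℝ (fderiv ℝ U) p) (p + (t₀ - t₀) • h) := by
    rw [hp]; exact (hU1.differentiableAt (by simp)).hasFDerivAt
  have h4 : HasFDerivAt (fun q ↦ fderiv ℝ U q h) ((fderiv ℝ (fderiv ℝ U) p).flip h)
      (p + (t₀ - t₀) • h) := by
    simpa using! h3.clm_apply (hasFDerivAt_const h _)
  exact (h4.comp_hasDerivAt t₀ (hline t₀)).deriv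

/-- If the `h`-line of `f` through `p` is a geodesic, then `∂ₕ⟨∂ₕf, ∂ₖf⟩ = ½ ∂ₖ⟨∂ₕf, ∂ₕf⟩` at `p`. -/
lemma hasFDerivAt_inner_of_geodesic {F : Type*} [NormedAddCommGroup F] [NormedSpace ℝ F]
    {f : F → M} {p h : F} (k : F) (hf : ContMDiffAt 𝓘(ℝ, F) (𝓡 d) 2 f p) {γ : ℝ → M} {t₀ : ℝ}
    (hγ : IsGeodesic (d := d) γ) (hfγ : ∀ᶠ t in 𝓝 t₀, f (p + (t - t₀) • h) = γ t) :
    DifferentiableAt ℝ (fun q ↦ (inner ℝ (mfderiv 𝓘(ℝ, F) (𝓡 d) f q h : TangentSpace (𝓡 d) (f q))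
        (mfderiv 𝓘(ℝ, F) (𝓡 d) f q k : TangentSpace (𝓡 d) (f q)) : ℝ)) p ∧
    fderiv ℝ (fun q ↦ (inner ℝ (mfderiv 𝓘(ℝ, F) (𝓡 d) f q h : TangentSpace (𝓡 d) (f q))
        (mfderiv 𝓘(ℝ, F) (𝓡 d) f q k : TangentSpace (𝓡 d) (f q)) : ℝ)) p h =
      (1 / 2 : ℝ) * fderiv ℝ (fun q ↦ (inner ℝ
        (mfderiv 𝓘(ℝ, F) (𝓡 d) f q h : TangentSpace (𝓡 d) (f q))
        (mfderiv 𝓘(ℝ, F) (𝓡 d) f q h : TangentSpace (𝓡 d) (f q)) : ℝ)) p k := by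
  set x₀ := f p
  set U : F → EuclideanSpace ℝ (Fin d) := fun q ↦ extChartAt (𝓡 d) x₀ (f q) with hUdef
  have hp : f p ∈ (extChartAt (𝓡 d) x₀).source := mem_extChartAt_source _
  have hU : ContDiffAt ℝ 2 U p := contDiffAt_chart_comp (n := 2) hf hp
  have heq : ∀ j : F, (fun q ↦ (inner ℝ (mfderiv 𝓘(ℝ, F) (𝓡 d) f q h : TangentSpace (𝓡 d) (f q))
      (mfderiv 𝓘(ℝ, F) (𝓡 d) f q j : TangentSpace (𝓡 d) (f q)) : ℝ)) =ᶠ[𝓝 p]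
      fun q ↦ metricForm x₀ (U q) (fderiv ℝ U q h) (fderiv ℝ U q j) := by
    intro j
    filter_upwards [contMDiffAt_iff_contMDiffAt_nhds (by simp) |>.1 hf, hf.continuousAt.preimage_mem_nhds
      ((isOpen_extChartAt_source x₀).mem_nhds hp)] with q hq hqs
    exact inner_mfderiv (hq.mdifferentiableAt (by simp)) hqs h j
  have hG : DifferentiableAt ℝ (metricForm x₀) (U p) :=
    (contDiffAt_metricForm ((extChartAt (𝓡 d) x₀).map_source hp)).differentiableAt (by simp)
  have hU1 : ContDiffAt ℝ 1 (fderiv ℝ U) p := hU.fderiv_right (m := 1) (by norm_num)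
  refine ⟨?_, ?_⟩
  · refine DifferentiableAt.congr_of_eventuallyEq ?_ (heq k)
    have h1 : DifferentiableAt ℝ (fun q ↦ metricForm x₀ (U q)) p :=
      DifferentiableAt.comp (g := metricForm x₀) p hG (hU.differentiableAt (by simp))
    have h2 : ∀ j, DifferentiableAt ℝ (fun q ↦ fderiv ℝ U q j) p := fun j ↦
      (hU1.differentiableAt (by simp)).clm_apply (differentiableAt_const j)
    exact (h1.clm_apply (h2 h)).clm_apply (h2 k)
  · rw [(heq k).fderiv_eq, (heq h).fderiv_eq]
    refine fderiv_form_of_geodesic hG (metricForm_symm x₀) hU fun z ↦ ?_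
    set u : ℝ → EuclideanSpace ℝ (Fin d) := fun t ↦ extChartAt (𝓡 d) x₀ (γ t) with hu
    have hu_eq : u =ᶠ[𝓝 t₀] fun t ↦ U (p + (t - t₀) • h) := by
      filter_upwards [hfγ] with t ht
      simp only [hUdef, hu, ht]
    obtain ⟨hu0, hu1, hu2⟩ := line_derivs hU hu_eq
    have hmem : γ t₀ ∈ (extChartAt (𝓡 d) x₀).source := by
      rw [← hfγ.self_of_nhds]; simpa using hp
    have := hγ.coordinate_equation hmem z
    simp only [← hu] at this
    rw [hu2, hu1, show extChartAt (𝓡 d) x₀ (γ t₀) = U p from hu0] at this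
    exact this

lemma IsGeodesic.mdifferentiableAt {γ : ℝ → M} (hγ : IsGeodesic (d := d) γ) (t : ℝ) :
    MDifferentiableAt 𝓘(ℝ, ℝ) (𝓡 d) γ t :=
  hγ.1.mdifferentiableAt (by simp)

/-- For a one-parameter family with `h = k = 1`, the identity `∂ₕ⟨∂ₕf, ∂ₖf⟩ = ½ ∂ₖ⟨∂ₕf, ∂ₕf⟩` says
that the derivative of the squared speed equals half of itself, so it vanishes. -/
lemma IsGeodesic.norm_velocity {γ : ℝ → M} (hγ : IsGeodesic (d := d) γ) (t : ℝ) :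
    ‖velocity (d := d) γ t‖ = ‖velocity (d := d) γ 0‖ := by
  have key : ∀ t, HasDerivAt (fun s ↦ (inner ℝ (velocity (d := d) γ s) (velocity (d := d) γ s) : ℝ))
      0 t := by
    intro t
    obtain ⟨h1, h2⟩ := hasFDerivAt_inner_of_geodesic (p := t) (h := (1 : ℝ)) (1 : ℝ)
      ((hγ.1 t).of_le (by norm_cast)) (t₀ := t) hγ (by simp)
    have h3 := h1.hasDerivAt
    rw [← fderiv_apply_one_eq_deriv] at h3
    have h4 : fderiv ℝ (fun q ↦ (inner ℝ (mfderiv 𝓘(ℝ, ℝ) (𝓡 d) γ q (1 : ℝ) : TangentSpace (𝓡 d) (γ q))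
        (mfderiv 𝓘(ℝ, ℝ) (𝓡 d) γ q (1 : ℝ) : TangentSpace (𝓡 d) (γ q)) : ℝ)) t (1 : ℝ) = 0 := by
      linarith
    rw [h4] at h3
    exact h3
  have hc := is_const_of_deriv_eq_zero (fun t ↦ (key t).differentiableAt) (fun t ↦ (key t).deriv) t 0
  simp only [real_inner_self_eq_norm_sq] at hc
  exact (sq_eq_sq₀ (norm_nonneg _) (norm_nonneg _)).1 hc

end GeodesicBasics

/-! ### Affine reparametrization and uniqueness of geodesics -/

section GeodesicUniqueness

open Filter Topology

variable {d : ℕ} {M : Type*} [TopologicalSpace M]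
  [ChartedSpace (EuclideanSpace ℝ (Fin d)) M]
  [RiemannianBundle (fun x : M ↦ TangentSpace (𝓡 d) x)]
  [IsManifold (𝓡 d) ∞ M]

lemma contDiffAt_deriv {E : Type*} [NormedAddCommGroup E] [NormedSpace ℝ E] {v : ℝ → E} {t : ℝ}
    (hv : ContDiffAt ℝ 2 v t) : ContDiffAt ℝ 1 (deriv v) t :=
  (hv.fderiv_right (m := 1) (by norm_num)).clm_apply (contDiffAt_const (c := (1 : ℝ)))

lemma velocity_eq_chartFrame {γ : ℝ → M} {x₀ : M} {t : ℝ}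
    (hγ : MDifferentiableAt 𝓘(ℝ, ℝ) (𝓡 d) γ t) (ht : γ t ∈ (extChartAt (𝓡 d) x₀).source) :
    (velocity (d := d) γ t : EuclideanSpace ℝ (Fin d)) =
      chartFrame x₀ (extChartAt (𝓡 d) x₀ (γ t)) (deriv (fun s ↦ extChartAt (𝓡 d) x₀ (γ s)) t) :=
  mfderiv_eq_chartFrame hγ ht (1 : ℝ)

lemma velocity_comp_affine {γ : ℝ → M} (hγ : MDifferentiable 𝓘(ℝ, ℝ) (𝓡 d) γ) (a b t : ℝ) :
    velocity (d := d) (fun s ↦ γ (a * s + b)) t = a • velocity (d := d) γ (a * t + b) := by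
  have h1 : HasDerivAt (fun s : ℝ ↦ a * s + b) a t := by
    simpa using ((hasDerivAt_id t).const_mul a).add_const b
  have h2 : MDifferentiableAt 𝓘(ℝ, ℝ) 𝓘(ℝ, ℝ) (fun s : ℝ ↦ a * s + b) t :=
    h1.differentiableAt.mdifferentiableAt
  have h3 := mfderiv_comp t (hγ (a * t + b)) h2
  rw [mfderiv_eq_fderiv] at h3
  let L : ℝ →L[ℝ] EuclideanSpace ℝ (Fin d) := mfderiv 𝓘(ℝ, ℝ) (𝓡 d) γ (a * t + b)
  have h4 : fderiv ℝ (fun s : ℝ ↦ a * s + b) t 1 = a • (1 : ℝ) := by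
    rw [fderiv_apply_one_eq_deriv, h1.deriv, smul_eq_mul, mul_one]
  have h5 : (velocity (d := d) (fun s ↦ γ (a * s + b)) t : EuclideanSpace ℝ (Fin d)) =
      L (fderiv ℝ (fun s : ℝ ↦ a * s + b) t 1) :=
    congrArg (fun L : ℝ →L[ℝ] EuclideanSpace ℝ (Fin d) ↦ L 1) h3
  exact h5.trans ((congrArg L h4).trans (L.map_smul a 1))

variable [IsContMDiffRiemannianBundle (𝓡 d) ∞ (EuclideanSpace ℝ (Fin d))
      (fun x : M ↦ TangentSpace (𝓡 d) x)]

lemma chartChristoffel_smul {x₀ : M} {e : EuclideanSpace ℝ (Fin d)}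
    (he : e ∈ (extChartAt (𝓡 d) x₀).target) (a : ℝ) (v z : EuclideanSpace ℝ (Fin d)) :
    chartChristoffel x₀ e (a • v) (a • v) z = a ^ 2 * chartChristoffel x₀ e v v z := by
  rw [chartChristoffel_self he, chartChristoffel_self he]
  simp only [map_smul, smul_apply, smul_eq_mul]
  ring

lemma IsGeodesic.comp_affine {γ : ℝ → M} (hγ : IsGeodesic (d := d) γ) (a b : ℝ) :
    IsGeodesic (d := d) (fun s ↦ γ (a * s + b)) := by
  have haff : ∀ t : ℝ, HasDerivAt (fun s : ℝ ↦ a * s + b) a t := fun t ↦ by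
    simpa using ((hasDerivAt_id t).const_mul a).add_const b
  refine ⟨hγ.1.comp (ContDiff.contMDiff (by fun_prop)), fun x₀ t ht ↦ ?_⟩
  intro u z
  set w : ℝ → EuclideanSpace ℝ (Fin d) := fun s ↦ extChartAt (𝓡 d) x₀ (γ s) with hw
  have hws : ∀ s, γ s ∈ (extChartAt (𝓡 d) x₀).source → ContDiffAt ℝ ∞ w s :=
    fun s hs ↦ contDiffAt_chart_comp (n := ⊤) (hγ.1 s) hs
  have hu1 : ∀ᶠ s in 𝓝 t, deriv u s = a • deriv w (a * s + b) := by
    have hc : ContinuousAt (fun s ↦ γ (a * s + b)) t :=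
      (hγ.1.continuous.comp (by fun_prop)).continuousAt
    filter_upwards [hc.preimage_mem_nhds ((isOpen_extChartAt_source x₀).mem_nhds ht)] with s hs
    exact (((hws _ hs).differentiableAt (by simp)).hasDerivAt.scomp s (haff s)).deriv
  have hdw : DifferentiableAt ℝ (deriv w) (a * t + b) :=
    (contDiffAt_deriv ((hws _ ht).of_le (by norm_cast))).differentiableAt (by simp)
  have hu2 : deriv (deriv u) t = a • a • deriv (deriv w) (a * t + b) := by
    rw [Filter.EventuallyEq.deriv_eq hu1]
    exact ((hdw.hasDerivAt.scomp t (haff t)).const_smul a).deriv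
  have h := hγ.2 x₀ (a * t + b) ht z
  rw [hu2, hu1.self_of_nhds, chartChristoffel_smul ((extChartAt (𝓡 d) x₀).map_source ht),
    ← metricForm_apply]
  rw [← metricForm_apply] at h
  simp only [map_smul, smul_apply, smul_eq_mul]
  linear_combination a ^ 2 * h

lemma isGeodesic_const (x : M) : IsGeodesic (d := d) (fun _ : ℝ ↦ x) := by
  refine ⟨contMDiff_const, fun x₀ t ht ↦ ?_⟩
  intro u z
  have hu : deriv u = fun _ ↦ 0 := by ext1 s; exact deriv_const s _
  have h0 := chartChristoffel_smul ((extChartAt (𝓡 d) x₀).map_source ht) 0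
    (0 : EuclideanSpace ℝ (Fin d)) z
  simp only [zero_smul, ne_eq, OfNat.ofNat_ne_zero, not_false_eq_true, zero_pow, zero_mul] at h0
  rw [hu, deriv_const, ← metricForm_apply, map_zero, zero_apply, zero_add]
  exact h0

/-- The set of times at which the germs agree is open by definition. It is closed because equality
of position and of velocity passes to limits, and these two data determine the germ. The line is
connected. -/
lemma IsGeodesic.eq_of_initial [T2Space M] {γ η : ℝ → M} (hγ : IsGeodesic (d := d) γ)
    (hη : IsGeodesic (d := d) η) {t₀ : ℝ} (h0 : γ t₀ = η t₀)
    (h1 : (velocity (d := d) γ t₀ : EuclideanSpace ℝ (Fin d)) = velocity (d := d) η t₀) :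
    γ = η := by
  let A : Set ℝ := {t | γ =ᶠ[𝓝 t] η}
  have hA : IsOpen A := isOpen_iff_mem_nhds.2 fun t ht ↦ eventually_eventuallyEq_nhds.2 ht
  have local_eq : ∀ t, γ t = η t → 
      (velocity (d := d) γ t : EuclideanSpace ℝ (Fin d)) = velocity (d := d) η t → t ∈ A := by
    intro t h0 h1
    have hs : γ t ∈ (extChartAt (𝓡 d) (γ t)).source := mem_extChartAt_source _
    have hs' : η t ∈ (extChartAt (𝓡 d) (γ t)).source := by rwa [← h0]
    have hse := hγ.1.continuous.continuousAt.preimage_mem_nhds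
      ((isOpen_extChartAt_source (γ t)).mem_nhds hs)
    have hse' := hη.1.continuous.continuousAt.preimage_mem_nhds
      ((isOpen_extChartAt_source (γ t)).mem_nhds hs')
    have := eventuallyEq_of_geodesic_equation (isOpen_extChartAt_target (γ t))
      (contDiffOn_metricForm (γ t)) (fun e he v hv ↦ metricForm_self_pos he hv)
      (contDiffAt_chart_comp (n := 2) ((hγ.1 t).of_le (by norm_cast)) hs)
      (contDiffAt_chart_comp (n := 2) ((hη.1 t).of_le (by norm_cast)) hs')
      ((extChartAt (𝓡 d) (γ t)).map_source hs)
      (by filter_upwards [hse] with s hs using hγ.coordinate_equation hs)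
      (by filter_upwards [hse'] with s hs using hη.coordinate_equation hs)
      (by rw [h0]) (by
        rw [velocity_eq_chartFrame (hγ.mdifferentiableAt t) hs,
          velocity_eq_chartFrame (hη.mdifferentiableAt t) hs', ← h0] at h1
        exact chartFrame_injective ((extChartAt (𝓡 d) (γ t)).map_source hs) h1)
    filter_upwards [this, hse, hse'] with s hs h1 h2
    exact (extChartAt (𝓡 d) (γ t)).injOn h1 h2 hs
  have hAc : IsClosed A := by
    refine isClosed_of_closure_subset fun t ht ↦ ?_
    have hcl : γ t = η t := by
      have : closure A ⊆ {s | γ s = η s} := closure_minimal (fun s hs ↦ hs.self_of_nhds)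
        (isClosed_eq hγ.1.continuous hη.1.continuous)
      exact this ht
    refine local_eq t hcl ?_
    have hs : γ t ∈ (extChartAt (𝓡 d) (γ t)).source := mem_extChartAt_source _
    have hs' : η t ∈ (extChartAt (𝓡 d) (γ t)).source := by rwa [← hcl]
    have hu := (contDiffAt_chart_comp (n := 2) ((hγ.1 t).of_le (by norm_cast)) hs)
    have hw := (contDiffAt_chart_comp (n := 2) ((hη.1 t).of_le (by norm_cast)) hs')
    rw [velocity_eq_chartFrame (hγ.mdifferentiableAt t) hs,
          velocity_eq_chartFrame (hη.mdifferentiableAt t) hs', ← hcl]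
    congr 1
    refine tendsto_nhds_unique_of_frequently_eq (contDiffAt_deriv hu).continuousAt.tendsto
      (contDiffAt_deriv hw).continuousAt.tendsto ((mem_closure_iff_frequently.1 ht).mono fun s hs ↦ ?_)
    refine Filter.EventuallyEq.deriv_eq ?_
    filter_upwards [show γ =ᶠ[𝓝 s] η from hs] with r hr
    rw [hr, hcl]
  have huniv : A = univ := IsClopen.eq_univ ⟨hAc, hA⟩ ⟨t₀, local_eq t₀ h0 h1⟩
  ext t
  exact (show t ∈ A from huniv ▸ mem_univ t).self_of_nhds

/-- Uniqueness makes the choice in the definition of `expMap` immaterial. -/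
lemma expMap_eq [T2Space M] {γ : ℝ → M} (hγ : IsGeodesic (d := d) γ) {x : M}
    {v : TangentSpace (𝓡 d) x} (h : HasInitialVelocity γ x v) :
    expMap x v = γ 1 := by
  have hex : ∃ γ : ℝ → M, IsGeodesic (d := d) γ ∧ HasInitialVelocity γ x v := ⟨γ, hγ, h⟩
  rw [expMap, dif_pos hex]
  obtain ⟨h1, h2⟩ := hex.choose_spec
  have h3 := h2.trans h.symm
  rw [h1.eq_of_initial hγ (t₀ := 0) (congrArg TotalSpace.proj h3) ?_]
  have := (TotalSpace.mk.injEq _ _ _ _).mp h3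
  exact eq_of_heq this.2

end GeodesicUniqueness

/-! ### The exponential map and the length of geodesics -/

section ExponentialMap

open Filter Topology MeasureTheory

variable {d : ℕ} {M : Type*} [MetricSpace M]
  [ChartedSpace (EuclideanSpace ℝ (Fin d)) M]
  [RiemannianBundle (fun x : M ↦ TangentSpace (𝓡 d) x)]
  [IsManifold (𝓡 d) ∞ M]
  [IsContMDiffRiemannianBundle (𝓡 d) ∞ (EuclideanSpace ℝ (Fin d))
      (fun x : M ↦ TangentSpace (𝓡 d) x)]

/-- Splits an equality in the total space of the tangent bundle into one of base points and one of
vectors; the latter is taken in the model space to avoid heterogeneous equality. -/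
lemma hasInitialVelocity_iff {γ : ℝ → M} {x : M} {v : TangentSpace (𝓡 d) x} :
    HasInitialVelocity γ x v ↔
      γ 0 = x ∧ (velocity (d := d) γ 0 : EuclideanSpace ℝ (Fin d)) = v := by
  constructor
  · intro h
    exact ⟨congrArg TotalSpace.proj h, eq_of_heq ((TotalSpace.mk.injEq _ _ _ _).mp h).2⟩
  · rintro ⟨h1, h2⟩
    exact (TotalSpace.mk.injEq _ _ _ _).mpr ⟨h1, heq_of_eq h2⟩

lemma HasInitialVelocity.norm_eq {γ : ℝ → M} {x : M} {v : TangentSpace (𝓡 d) x}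
    (h : HasInitialVelocity γ x v) : ‖velocity (d := d) γ 0‖ = ‖v‖ :=
  congrArg (fun p : TangentBundle (𝓡 d) M ↦ ‖p.2‖) h

lemma velocity_const (x : M) (t : ℝ) : velocity (d := d) (fun _ : ℝ ↦ x) t = 0 := by
  have : mfderiv 𝓘(ℝ, ℝ) (𝓡 d) (fun _ : ℝ ↦ x) t = 0 := mfderiv_const
  exact congrArg (fun L : ℝ →L[ℝ] EuclideanSpace ℝ (Fin d) ↦ L 1) this

lemma hasInitialVelocity_const (x : M) :
    HasInitialVelocity (fun _ : ℝ ↦ x) x (0 : TangentSpace (𝓡 d) x) :=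
  hasInitialVelocity_iff.2 ⟨rfl, velocity_const x 0⟩

lemma expMap_zero (x : M) : expMap x (0 : TangentSpace (𝓡 d) x) = x :=
  expMap_eq (isGeodesic_const x) (hasInitialVelocity_const x)

lemma HasInitialVelocity.comp_mul {γ : ℝ → M} {x : M} {v : TangentSpace (𝓡 d) x}
    (h : HasInitialVelocity γ x v) (hγ : IsGeodesic (d := d) γ) (a : ℝ) :
    HasInitialVelocity (fun s ↦ γ (a * s + 0)) x (a • v) := by
  obtain ⟨h1, h2⟩ := hasInitialVelocity_iff.1 h
  refine hasInitialVelocity_iff.2 ⟨by simpa using h1, ?_⟩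
  have h3 := velocity_comp_affine (fun t ↦ hγ.mdifferentiableAt t) a 0 0
  have h4 : (velocity (d := d) γ (a * 0 + 0) : EuclideanSpace ℝ (Fin d)) =
      velocity (d := d) γ 0 := by rw [mul_zero, zero_add]
  exact h3.trans (congrArg (fun w : EuclideanSpace ℝ (Fin d) ↦ a • w) (h4.trans h2))

lemma expMap_smul {γ : ℝ → M} (hγ : IsGeodesic (d := d) γ) {x : M}
    {v : TangentSpace (𝓡 d) x} (h : HasInitialVelocity γ x v) (t : ℝ) :
    expMap x (t • v) = γ t := by
  rw [expMap_eq (hγ.comp_affine t 0) (h.comp_mul hγ t), mul_one, add_zero]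

/-- A positive injectivity radius forces geodesics to exist in all directions. -/
lemma exists_isGeodesic_of_injRadiusAt_pos {x : M} (hx : 0 < injRadiusAt d x)
    (v : TangentSpace (𝓡 d) x) :
    ∃ γ : ℝ → M, IsGeodesic (d := d) γ ∧ HasInitialVelocity γ x v := by
  rcases eq_or_ne v 0 with rfl | hv
  · exact ⟨_, isGeodesic_const x, hasInitialVelocity_const x⟩
  obtain ⟨ρ, hρ⟩ := lt_iSup_iff.1 hx
  obtain ⟨⟨hinj, -⟩, hρ0⟩ := lt_iSup_iff.1 hρ
  have hρ0 : (0 : ℝ) < ρ := by exact_mod_cast hρ0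
  have hv0 : 0 < ‖v‖ := norm_pos_iff.2 hv
  -- This factor gives `a • v` the norm `ρ / 2`, inside the ball where `expMap x` is injective.
  set a : ℝ := ρ / (2 * ‖v‖) with ha
  have ha0 : 0 < a := by positivity
  have hmem : a • v ∈ Metric.ball (0 : TangentSpace (𝓡 d) x) ρ := by
    rw [mem_ball_zero_iff, norm_smul, Real.norm_eq_abs, abs_of_pos ha0, ha]
    field_simp
    linarith
  -- Where no geodesic exists, `expMap` has the default value `x`, which is already its value at
  -- `0`. Injectivity on the ball excludes this for `a • v`.
  have hne : expMap x (a • v) ≠ x := fun h ↦ by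
    have := hinj hmem (Metric.mem_ball_self hρ0) (h.trans (expMap_zero x).symm)
    exact (smul_ne_zero ha0.ne' hv) this
  have hex : ∃ γ : ℝ → M, IsGeodesic (d := d) γ ∧ HasInitialVelocity γ x (a • v) := by
    by_contra hcon
    exact hne (by rw [expMap, dif_neg hcon])
  obtain ⟨γ, hγ, hγv⟩ := hex
  refine ⟨_, hγ.comp_affine a⁻¹ 0, ?_⟩
  have := hγv.comp_mul hγ a⁻¹
  rwa [smul_smul, inv_mul_cancel₀ ha0.ne', one_smul] at this

lemma IsGeodesic.pathELength_eq {γ : ℝ → M} (hγ : IsGeodesic (d := d) γ) (a b : ℝ) :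
    Manifold.pathELength (𝓡 d) γ a b = ENNReal.ofReal (b - a) * ‖velocity (d := d) γ 0‖ₑ := by
  have h : ∀ t, ‖mfderiv 𝓘(ℝ, ℝ) (𝓡 d) γ t (1 : ℝ)‖ₑ = ‖velocity (d := d) γ 0‖ₑ := fun t ↦ by
    rw [← ofReal_norm, ← ofReal_norm, ← hγ.norm_velocity t]
    rfl
  rw [Manifold.pathELength_eq_lintegral_mfderiv_Icc]
  calc _ = ∫⁻ t in Icc a b, ‖velocity (d := d) γ 0‖ₑ := lintegral_congr fun t ↦ h t
    _ = _ := by rw [setLIntegral_const, Real.volume_Icc, mul_comm]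

variable [IsRiemannianManifold (𝓡 d) M]

lemma edist_le_pathELength {γ : ℝ → M} (hγ : ContMDiff 𝓘(ℝ, ℝ) (𝓡 d) 1 γ) {a b : ℝ}
    (hab : a ≤ b) : edist (γ a) (γ b) ≤ Manifold.pathELength (𝓡 d) γ a b := by
  rw [IsRiemannianManifold.out (I := 𝓡 d)]
  exact Manifold.riemannianEDist_le_pathELength hγ.contMDiffOn rfl rfl hab

lemma IsGeodesic.dist_le {γ : ℝ → M} (hγ : IsGeodesic (d := d) γ) {a b : ℝ} (hab : a ≤ b) :
    dist (γ a) (γ b) ≤ (b - a) * ‖velocity (d := d) γ 0‖ := by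
  have h := edist_le_pathELength (hγ.1.of_le (by norm_cast)) hab
  rw [hγ.pathELength_eq, edist_dist, ← ofReal_norm, ← ENNReal.ofReal_mul (by linarith)] at h
  exact (ENNReal.ofReal_le_ofReal_iff (mul_nonneg (by linarith) (norm_nonneg _))).1 h

end ExponentialMap

/-! ### The Gauss lemma -/

section GaussLemma

open Filter Topology MeasureTheory

variable {d : ℕ} {M : Type*} [MetricSpace M]
  [ChartedSpace (EuclideanSpace ℝ (Fin d)) M]
  [RiemannianBundle (fun x : M ↦ TangentSpace (𝓡 d) x)]
  [IsManifold (𝓡 d) ∞ M]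
  [IsContMDiffRiemannianBundle (𝓡 d) ∞ (EuclideanSpace ℝ (Fin d))
      (fun x : M ↦ TangentSpace (𝓡 d) x)]
  {V : Type*} [NormedAddCommGroup V] [InnerProductSpace ℝ V]

/-- `φ` parametrizes a normal ball of radius `ρ` around `φ 0`: it maps lines through the origin
isometrically to geodesics and it is a diffeomorphism from the ball onto its image. -/
structure IsNormalBall (d : ℕ) {M : Type*} [TopologicalSpace M]
    [ChartedSpace (EuclideanSpace ℝ (Fin d)) M]
    [RiemannianBundle (fun x : M ↦ TangentSpace (𝓡 d) x)] (φ : V → M) (ρ : ℝ) : Prop where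
  isGeodesic : ∀ u : V, IsGeodesic (d := d) (fun t : ℝ ↦ φ (t • u))
  norm_velocity_zero : ∀ u : V, ‖velocity (d := d) (fun t : ℝ ↦ φ (t • u)) 0‖ = ‖u‖
  injOn : InjOn φ (Metric.ball 0 ρ)
  isLocalDiffeomorphOn : IsLocalDiffeomorphOn 𝓘(ℝ, V) (𝓡 d) ∞ φ (Metric.ball 0 ρ)

lemma mfderiv_comp_vectorSpace {F : Type*} [NormedAddCommGroup F] [NormedSpace ℝ F] {φ : V → M}
    {g : F → V} {q : F} (hg : DifferentiableAt ℝ g q)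
    (hφ : MDifferentiableAt 𝓘(ℝ, V) (𝓡 d) φ (g q)) (h : F) :
    (mfderiv 𝓘(ℝ, F) (𝓡 d) (fun q ↦ φ (g q)) q h : EuclideanSpace ℝ (Fin d)) =
      mfderiv 𝓘(ℝ, V) (𝓡 d) φ (g q) (fderiv ℝ g q h) := by
  have h1 := mfderiv_comp q hφ hg.mdifferentiableAt
  rw [mfderiv_eq_fderiv] at h1
  exact congrArg (fun L : F →L[ℝ] EuclideanSpace ℝ (Fin d) ↦ L h) h1

lemma inner_mfderiv_comp {F : Type*} [NormedAddCommGroup F] [NormedSpace ℝ F] {φ : V → M}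
    {g : F → V} {q : F} {u : V} (hg : DifferentiableAt ℝ g q) (hu : g q = u)
    (hφ : MDifferentiableAt 𝓘(ℝ, V) (𝓡 d) φ u) (h k : F) :
    (inner ℝ (mfderiv 𝓘(ℝ, F) (𝓡 d) (fun q ↦ φ (g q)) q h : TangentSpace (𝓡 d) (φ (g q)))
      (mfderiv 𝓘(ℝ, F) (𝓡 d) (fun q ↦ φ (g q)) q k : TangentSpace (𝓡 d) (φ (g q))) : ℝ) =
    inner ℝ (mfderiv 𝓘(ℝ, V) (𝓡 d) φ u (fderiv ℝ g q h) : TangentSpace (𝓡 d) (φ u))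
      (mfderiv 𝓘(ℝ, V) (𝓡 d) φ u (fderiv ℝ g q k) : TangentSpace (𝓡 d) (φ u)) := by
  subst hu
  have e1 := mfderiv_comp_vectorSpace hg hφ h
  have e2 := mfderiv_comp_vectorSpace hg hφ k
  exact congrArg₂ (fun a b : TangentSpace (𝓡 d) (φ (g q)) ↦ (inner ℝ a b : ℝ)) e1 e2

namespace IsNormalBall

variable {φ : V → M} {ρ : ℝ} (hφ : IsNormalBall d φ ρ)
include hφ

lemma contMDiffAt {u : V} (hu : u ∈ Metric.ball (0 : V) ρ) :
    ContMDiffAt 𝓘(ℝ, V) (𝓡 d) ∞ φ u :=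
  (hφ.isLocalDiffeomorphOn ⟨u, hu⟩).contMDiffAt

lemma mdifferentiableAt {u : V} (hu : u ∈ Metric.ball (0 : V) ρ) :
    MDifferentiableAt 𝓘(ℝ, V) (𝓡 d) φ u :=
  (hφ.contMDiffAt hu).mdifferentiableAt (by simp)

lemma inner_mfderiv_radial_self {t : ℝ} {u : V} (hu : t • u ∈ Metric.ball (0 : V) ρ) :
    (inner ℝ (mfderiv 𝓘(ℝ, V) (𝓡 d) φ (t • u) u : TangentSpace (𝓡 d) (φ (t • u)))
      (mfderiv 𝓘(ℝ, V) (𝓡 d) φ (t • u) u : TangentSpace (𝓡 d) (φ (t • u))) : ℝ) = ‖u‖ ^ 2 := by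
  have hg : HasDerivAt (fun t : ℝ ↦ t • u) u t := by
    simpa using! (hasDerivAt_id t).smul_const u
  have h := inner_mfderiv_comp hg.differentiableAt rfl (hφ.mdifferentiableAt hu) 1 1
  rw [fderiv_apply_one_eq_deriv, hg.deriv] at h
  rw [← h, ← hφ.norm_velocity_zero u, ← (hφ.isGeodesic u).norm_velocity t]
  exact real_inner_self_eq_norm_sq (velocity (d := d) (fun t : ℝ ↦ φ (t • u)) t)

/-- The Gauss lemma. -/
lemma inner_mfderiv_radial {v : V} (hv : v ∈ Metric.ball (0 : V) ρ) (w : V) :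
    (inner ℝ (mfderiv 𝓘(ℝ, V) (𝓡 d) φ v v : TangentSpace (𝓡 d) (φ v))
      (mfderiv 𝓘(ℝ, V) (𝓡 d) φ v w : TangentSpace (𝓡 d) (φ v)) : ℝ) = inner ℝ v w := by
  -- The variation `(t, s) ↦ φ (t (v + s w))` has radial geodesics as its `t`-lines. `B h k` is the
  -- inner product of its derivatives in the directions `h` and `k`.
  let g : ℝ × ℝ → V := fun q ↦ q.1 • (v + q.2 • w)
  have hg : ∀ q, DifferentiableAt ℝ g q := fun q ↦ by fun_prop
  have hgc : ContDiff ℝ ∞ g := by fun_prop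
  have hgd : ∀ q h, fderiv ℝ g q h = q.1 • (h.2 • w) + h.1 • (v + q.2 • w) := by
    intro q h
    have h2 : HasFDerivAt (fun q : ℝ × ℝ ↦ v + q.2 • w)
        ((ContinuousLinearMap.snd ℝ ℝ ℝ).smulRight w) q :=
      (hasFDerivAt_snd.smul_const w).const_add v
    have h1 : HasFDerivAt g _ q := (hasFDerivAt_fst (𝕜 := ℝ) (p := q)).smul h2
    rw [h1.fderiv]
    simp
  let B : ℝ × ℝ → ℝ × ℝ → ℝ × ℝ → ℝ := fun h k q ↦
    inner ℝ (mfderiv 𝓘(ℝ, ℝ × ℝ) (𝓡 d) (fun q ↦ φ (g q)) q h : TangentSpace (𝓡 d) (φ (g q)))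
      (mfderiv 𝓘(ℝ, ℝ × ℝ) (𝓡 d) (fun q ↦ φ (g q)) q k : TangentSpace (𝓡 d) (φ (g q)))
  have hmem : ∀ t ∈ Icc (0 : ℝ) 1, t • v ∈ Metric.ball (0 : V) ρ := by
    intro t ht
    rw [mem_ball_zero_iff] at hv ⊢
    rw [norm_smul, Real.norm_eq_abs, abs_of_nonneg ht.1]
    nlinarith [norm_nonneg v, ht.2]
  have hgt : ∀ t : ℝ, g (t, 0) = t • v := fun t ↦ by simp [g]
  -- `∂ₜ⟨∂ₜ, ∂ₛ⟩ = ½ ∂ₛ‖∂ₜ‖²`, and `‖∂ₜ‖² = ‖v + s w‖²` because radial geodesics have constant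
  -- speed. At `s = 0` this is `⟨v, w⟩`.
  have hder : ∀ t ∈ Icc (0 : ℝ) 1,
      HasDerivAt (fun τ ↦ B (1, 0) (0, 1) (τ, 0)) (inner ℝ v w) t := by
    intro t ht
    have hcf : ContMDiffAt 𝓘(ℝ, ℝ × ℝ) (𝓡 d) 2 (fun q ↦ φ (g q)) (t, 0) := by
      refine ContMDiffAt.comp (t, (0 : ℝ)) (g := φ) (f := g) ?_
        ((hgc.contMDiff (t, 0)).of_le (by norm_cast))
      rw [hgt]
      exact (hφ.contMDiffAt (hmem t ht)).of_le (by norm_cast)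
    obtain ⟨h1, h2⟩ := hasFDerivAt_inner_of_geodesic (p := (t, (0 : ℝ))) (h := (1, 0)) (0, 1)
      hcf (t₀ := t) (hφ.isGeodesic v) (Eventually.of_forall fun τ ↦ by simp [g])
    have h3 : (B (1, 0) (1, 0)) =ᶠ[𝓝 (t, (0 : ℝ))] fun q ↦ ‖v + q.2 • w‖ ^ 2 := by
      have hnear : ∀ᶠ q in 𝓝 (t, (0 : ℝ)), g q ∈ Metric.ball (0 : V) ρ :=
        hgc.continuous.continuousAt.preimage_mem_nhds
          (Metric.isOpen_ball.mem_nhds (by rw [hgt]; exact hmem t ht))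
      filter_upwards [hnear] with q hq
      have e1 := inner_mfderiv_comp (hg q) rfl (hφ.mdifferentiableAt hq) (1, 0) (1, 0)
      simp only [hgd, zero_smul, smul_zero, zero_add, one_smul] at e1
      exact e1.trans (hφ.inner_mfderiv_radial_self hq)
    have h4 : fderiv ℝ (B (1, 0) (1, 0)) (t, 0) (0, 1) = 2 * inner ℝ v w := by
      rw [h3.fderiv_eq]
      have e1 : HasFDerivAt (fun q : ℝ × ℝ ↦ v + q.2 • w)
          ((ContinuousLinearMap.snd ℝ ℝ ℝ).smulRight w) (t, 0) :=
        (hasFDerivAt_snd.smul_const w).const_add v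
      have := e1.norm_sq
      rw [this.fderiv]
      simp
    have h5 : HasDerivAt (fun τ : ℝ ↦ (τ, (0 : ℝ))) (1, 0) t :=
      (hasDerivAt_id t).prodMk (hasDerivAt_const t 0)
    have h6 := h1.hasFDerivAt.comp_hasDerivAt t h5
    rw [h2] at h6
    have h7 : (1 / 2 : ℝ) * fderiv ℝ (B (1, 0) (1, 0)) (t, 0) (0, 1) = inner ℝ v w := by
      rw [h4]; ring
    exact h7 ▸ h6
  have b1 : B (1, 0) (0, 1) (1, 0) =
      inner ℝ (mfderiv 𝓘(ℝ, V) (𝓡 d) φ v v : TangentSpace (𝓡 d) (φ v))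
        (mfderiv 𝓘(ℝ, V) (𝓡 d) φ v w : TangentSpace (𝓡 d) (φ v)) := by
    have e1 := inner_mfderiv_comp (hg (1, 0)) (by simp [g]) (hφ.mdifferentiableAt hv)
      (1, 0) (0, 1)
    simp only [hgd, zero_smul, smul_zero, zero_add, one_smul, add_zero] at e1
    exact e1
  have b0 : B (1, 0) (0, 1) (0, 0) = 0 := by
    have e1 := inner_mfderiv_comp (hg (0, 0)) (u := 0) (by simp [g])
      (hφ.mdifferentiableAt (by simpa using hmem 0 (by simp))) (1, 0) (0, 1)
    simp only [hgd, zero_smul, smul_zero, zero_add, one_smul, add_zero] at e1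
    exact e1.trans ((congrArg (fun z : TangentSpace (𝓡 d) (φ 0) ↦
      (inner ℝ (mfderiv 𝓘(ℝ, V) (𝓡 d) φ 0 v : TangentSpace (𝓡 d) (φ 0)) z : ℝ))
      (map_zero (mfderiv 𝓘(ℝ, V) (𝓡 d) φ 0))).trans (inner_zero_right _))
  -- At `t = 0` the `s`-derivative of the variation vanishes, so `⟨∂ₜ, ∂ₛ⟩ = t ⟨v, w⟩` along `s =
  -- 0`; the claim is the case `t = 1`.
  have hconst := constant_of_has_deriv_right_zero
    (f := fun τ ↦ B (1, 0) (0, 1) (τ, 0) - τ * inner ℝ v w) (a := 0) (b := 1)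
    (fun t ht ↦ ((hder t ht).continuousAt.sub
      (by fun_prop : ContinuousAt (fun τ : ℝ ↦ τ * inner ℝ v w) t)).continuousWithinAt)
    (fun t ht ↦ by
      have := (hder t ⟨ht.1, ht.2.le⟩).sub ((hasDerivAt_id t).mul_const (inner ℝ v w))
      simp only [one_mul, sub_self] at this
      exact this.hasDerivWithinAt) 1 (by simp)
  have h9 : B (1, 0) (0, 1) (1, 0) - 1 * inner ℝ v w =
    B (1, 0) (0, 1) (0, 0) - 0 * inner ℝ v w := hconst
  rw [← b1]
  linarith

end IsNormalBall

end GaussLemma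

/-! ### Distances and shortest geodesics in normal balls -/

section NormalBalls

open Filter Topology MeasureTheory Function

variable {d : ℕ} {M : Type*} [MetricSpace M]
  [ChartedSpace (EuclideanSpace ℝ (Fin d)) M]
  [RiemannianBundle (fun x : M ↦ TangentSpace (𝓡 d) x)]
  [IsManifold (𝓡 d) ∞ M]
  [IsContMDiffRiemannianBundle (𝓡 d) ∞ (EuclideanSpace ℝ (Fin d))
      (fun x : M ↦ TangentSpace (𝓡 d) x)]
  {V : Type*} [NormedAddCommGroup V] [InnerProductSpace ℝ V]

namespace IsNormalBall

variable {φ : V → M} {ρ : ℝ} (hφ : IsNormalBall d φ ρ)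
include hφ

lemma invFunOn_apply {u : V} (hu : u ∈ Metric.ball (0 : V) ρ) :
    invFunOn φ (Metric.ball 0 ρ) (φ u) = u :=
  hφ.injOn.leftInvOn_invFunOn hu

lemma image_mem_nhds {u : V} (hu : u ∈ Metric.ball (0 : V) ρ) {s : Set V} (hs : s ∈ 𝓝 u) :
    φ '' s ∈ 𝓝 (φ u) := by
  have h := hφ.isLocalDiffeomorphOn ⟨u, hu⟩
  have h0 : h.localInverse (φ u) = u := h.localInverse_left_inv h.localInverse_mem_target
  have h1 : ContinuousAt h.localInverse (φ u) := h.localInverse_contMDiffAt.continuousAt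
  have h2 : ∀ᶠ z in 𝓝 (φ u), h.localInverse z ∈ s :=
    h1.preimage_mem_nhds (by rwa [h0])
  filter_upwards [h2, h.localInverse_eventuallyEq_right] with z hz hz'
  exact ⟨_, hz, hz'⟩

lemma isOpen_image {r : ℝ} (hr : r ≤ ρ) : IsOpen (φ '' Metric.ball 0 r) := by
  refine isOpen_iff_mem_nhds.2 ?_
  rintro _ ⟨u, hu, rfl⟩
  exact hφ.image_mem_nhds (Metric.ball_subset_ball hr hu) (Metric.isOpen_ball.mem_nhds hu)

lemma contMDiffAt_invFunOn {u : V} (hu : u ∈ Metric.ball (0 : V) ρ) :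
    ContMDiffAt (𝓡 d) 𝓘(ℝ, V) ∞ (invFunOn φ (Metric.ball 0 ρ)) (φ u) := by
  have h := hφ.isLocalDiffeomorphOn ⟨u, hu⟩
  have h0 : h.localInverse (φ u) = u := h.localInverse_left_inv h.localInverse_mem_target
  have h1 : ContinuousAt h.localInverse (φ u) := h.localInverse_contMDiffAt.continuousAt
  have h2 : ∀ᶠ z in 𝓝 (φ u), h.localInverse z ∈ Metric.ball (0 : V) ρ :=
    h1.preimage_mem_nhds (by rw [h0]; exact Metric.isOpen_ball.mem_nhds hu)
  refine h.localInverse_contMDiffAt.congr_of_eventuallyEq ?_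
  filter_upwards [h2, h.localInverse_eventuallyEq_right] with z hz hz'
  have hz'' : φ (h.localInverse z) = z := hz'
  conv_lhs => rw [← hz'']
  exact hφ.invFunOn_apply hz

lemma lift {c : ℝ → M} {t : ℝ} {u : V} (hc : ContMDiffAt 𝓘(ℝ, ℝ) (𝓡 d) 1 c t)
    (hu : u ∈ Metric.ball (0 : V) ρ) (hcu : c t = φ u) :
    ContDiffAt ℝ 1 (fun s ↦ invFunOn φ (Metric.ball 0 ρ) (c s)) t ∧
    (mfderiv 𝓘(ℝ, ℝ) (𝓡 d) c t (1 : ℝ) : EuclideanSpace ℝ (Fin d)) =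
      mfderiv 𝓘(ℝ, V) (𝓡 d) φ u
        (deriv (fun s ↦ invFunOn φ (Metric.ball 0 ρ) (c s)) t : V) := by
  set w : ℝ → V := fun s ↦ invFunOn φ (Metric.ball 0 ρ) (c s) with hw
  have hwt : w t = u := by simp only [hw, hcu]; exact hφ.invFunOn_apply hu
  have h1 : ContMDiffAt 𝓘(ℝ, ℝ) 𝓘(ℝ, V) 1 w t := by
    refine ContMDiffAt.comp t (g := invFunOn φ (Metric.ball 0 ρ)) ?_ hc
    rw [hcu]
    exact (hφ.contMDiffAt_invFunOn hu).of_le (by norm_cast)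
  have h2 : ContDiffAt ℝ 1 w t := h1.contDiffAt
  refine ⟨h2, ?_⟩
  have hev : c =ᶠ[𝓝 t] fun s ↦ φ (w s) := by
    have := hc.continuousAt.preimage_mem_nhds
      (by rw [hcu]; exact hφ.image_mem_nhds hu (Metric.isOpen_ball.mem_nhds hu))
    filter_upwards [this] with s hs
    exact (invFunOn_eq hs).symm
  have h3 := hev.mfderiv_eq (I := 𝓘(ℝ, ℝ)) (I' := 𝓡 d)
  have h4 := mfderiv_comp_vectorSpace (φ := φ) (h2.differentiableAt (by simp))
    (by rw [hwt]; exact hφ.mdifferentiableAt hu) (1 : ℝ)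
  rw [fderiv_apply_one_eq_deriv] at h4
  have h5 : (mfderiv 𝓘(ℝ, V) (𝓡 d) φ (w t) (deriv w t : V) : EuclideanSpace ℝ (Fin d)) =
      mfderiv 𝓘(ℝ, V) (𝓡 d) φ u (deriv w t : V) := by rw [hwt]
  exact (congrArg (fun L : ℝ →L[ℝ] EuclideanSpace ℝ (Fin d) ↦ L 1) h3).trans (h4.trans h5)

/-- By the Gauss lemma and Cauchy-Schwarz, the radial speed of a curve is at most its speed. The
factor `‖u‖` is not divided out, so the centre needs no exception. -/
lemma abs_inner_deriv_lift_le {c : ℝ → M} {t : ℝ} {u : V}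
    (hc : ContMDiffAt 𝓘(ℝ, ℝ) (𝓡 d) 1 c t)
    (hu : u ∈ Metric.ball (0 : V) ρ) (hcu : c t = φ u) :
    |inner ℝ u (deriv (fun s ↦ invFunOn φ (Metric.ball 0 ρ) (c s)) t)| ≤
      ‖u‖ * ‖mfderiv 𝓘(ℝ, ℝ) (𝓡 d) c t (1 : ℝ)‖ := by
  obtain ⟨-, h2⟩ := hφ.lift hc hu hcu
  set w' := deriv (fun s ↦ invFunOn φ (Metric.ball 0 ρ) (c s)) t
  rw [← hφ.inner_mfderiv_radial hu]
  refine (abs_real_inner_le_norm _ _).trans_eq ?_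
  have e1 : ‖(mfderiv 𝓘(ℝ, V) (𝓡 d) φ u u : TangentSpace (𝓡 d) (φ u))‖ = ‖u‖ := by
    have := hφ.inner_mfderiv_radial hu u
    rw [real_inner_self_eq_norm_sq, real_inner_self_eq_norm_sq] at this
    exact (sq_eq_sq₀ (norm_nonneg _) (norm_nonneg _)).1 this
  have e2 : ‖(mfderiv 𝓘(ℝ, V) (𝓡 d) φ u w' : TangentSpace (𝓡 d) (φ u))‖ =
      ‖mfderiv 𝓘(ℝ, ℝ) (𝓡 d) c t (1 : ℝ)‖ :=
    congrArg (fun p : TangentBundle (𝓡 d) M ↦ ‖p.2‖)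
      ((TotalSpace.mk.injEq (F := EuclideanSpace ℝ (Fin d)) (φ u)
        (mfderiv 𝓘(ℝ, V) (𝓡 d) φ u w' : TangentSpace (𝓡 d) (φ u)) (c t)
        (mfderiv 𝓘(ℝ, ℝ) (𝓡 d) c t (1 : ℝ) : TangentSpace (𝓡 d) (c t))).mpr
        ⟨hcu.symm, heq_of_eq h2.symm⟩)
  rw [e1, e2]

/-- The distance from the origin of the lifted curve grows no faster than arc length. -/
lemma norm_le_pathELength {c : ℝ → M} (hc : ContMDiff 𝓘(ℝ, ℝ) (𝓡 d) 1 c) {b : ℝ} (hb : 0 < b)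
    (hmem : ∀ t ∈ Icc 0 b, c t ∈ φ '' Metric.ball 0 ρ) (h0 : c 0 = φ 0) {v : V}
    (hv : v ∈ Metric.ball (0 : V) ρ) (hvb : c b = φ v) :
    ENNReal.ofReal ‖v‖ ≤ Manifold.pathELength (𝓡 d) c 0 b := by
  set w : ℝ → V := fun s ↦ invFunOn φ (Metric.ball 0 ρ) (c s) with hw
  refine ENNReal.le_of_forall_pos_le_add fun ε hε _ ↦ ?_
  have hε' : (0 : ℝ) < ε := hε
  have hin : ∀ t ∈ Icc 0 b, w t ∈ Metric.ball (0 : V) ρ ∧ c t = φ (w t) := fun t ht ↦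
    ⟨invFunOn_mem (hmem t ht), (invFunOn_eq (hmem t ht)).symm⟩
  -- The norm is not differentiable at the origin, where the curve starts; this smoothing costs `g 0
  -- = ε`, and `ε` is arbitrary.
  let g : ℝ → ℝ := fun t ↦ √(‖w t‖ ^ 2 + (ε : ℝ) ^ 2)
  have hpos : ∀ t, 0 < ‖w t‖ ^ 2 + (ε : ℝ) ^ 2 := fun t ↦ by positivity
  have hg : ∀ t ∈ Icc 0 b, ContDiffAt ℝ 1 g t ∧
      ‖deriv g t‖ ≤ ‖mfderiv 𝓘(ℝ, ℝ) (𝓡 d) c t (1 : ℝ)‖ := by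
    intro t ht
    obtain ⟨h1, h2⟩ := hin t ht
    have hwt := (hφ.lift (hc t) h1 h2).1
    refine ⟨((hwt.norm_sq ℝ).add contDiffAt_const).sqrt (hpos t).ne', ?_⟩
    have hd := (((hwt.differentiableAt (by simp)).hasDerivAt.norm_sq).add_const
      ((ε : ℝ) ^ 2)).sqrt (hpos t).ne'
    rw [hd.deriv]
    have h3 := hφ.abs_inner_deriv_lift_le (hc t) h1 h2
    have h4 : ‖w t‖ ≤ √(‖w t‖ ^ 2 + (ε : ℝ) ^ 2) := Real.le_sqrt_of_sq_le (by nlinarith)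
    have h5 : 0 < √(‖w t‖ ^ 2 + (ε : ℝ) ^ 2) := Real.sqrt_pos.2 (hpos t)
    rw [Real.norm_eq_abs, abs_div, abs_mul, abs_mul, abs_two, abs_of_pos h5,
      mul_div_mul_left _ _ two_ne_zero, div_le_iff₀ h5]
    calc _ ≤ _ := h3
      _ ≤ _ := by
        rw [mul_comm]
        exact mul_le_mul_of_nonneg_left h4 (norm_nonneg _)
  have hmain : ‖g b - g 0‖ₑ ≤ Manifold.pathELength (𝓡 d) c 0 b := by
    have h1 := enorm_sub_le_lintegral_derivWithin_Icc_of_contDiffOn_Icc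
      (f := g) (fun t ht ↦ (hg t ht).1.contDiffWithinAt) hb.le
    refine h1.trans ?_
    rw [Manifold.pathELength_eq_lintegral_mfderiv_Icc]
    refine setLIntegral_mono' measurableSet_Icc fun t ht ↦ ?_
    rw [((hg t ht).1.differentiableAt (by simp)).derivWithin (uniqueDiffOn_Icc hb t ht),
      ← ofReal_norm, ← ofReal_norm]
    exact ENNReal.ofReal_le_ofReal (hg t ht).2
  have hw0 : w 0 = 0 := by
    simp only [hw, h0]
    exact hφ.invFunOn_apply (by
      rw [mem_ball_zero_iff] at hv ⊢
      exact norm_zero.trans_lt ((norm_nonneg v).trans_lt hv))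
  have hwb : w b = v := by
    simp only [hw, hvb]
    exact hφ.invFunOn_apply hv
  have hg0 : g 0 = ε := by
    simp only [g, hw0]
    rw [norm_zero, zero_pow two_ne_zero, zero_add, Real.sqrt_sq hε'.le]
  have hgb : ‖v‖ ≤ g b := by
    simp only [g, hwb]
    exact Real.le_sqrt_of_sq_le (by nlinarith)
  calc ENNReal.ofReal ‖v‖ ≤ ENNReal.ofReal (‖g b - g 0‖ + ε) := by
        refine ENNReal.ofReal_le_ofReal ?_
        have := Real.le_norm_self (g b - g 0)
        linarith
    _ = ‖g b - g 0‖ₑ + ε := by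
        rw [ENNReal.ofReal_add (norm_nonneg _) hε'.le, ofReal_norm, ENNReal.ofReal_coe_nnreal]
    _ ≤ _ := by gcongr

variable [FiniteDimensional ℝ V]

lemma isCompact_image {s : ℝ} (hs : s < ρ) : IsCompact (φ '' Metric.closedBall 0 s) :=
  (isCompact_closedBall 0 s).image_of_continuousOn fun _ hu ↦
    (hφ.contMDiffAt (Metric.closedBall_subset_ball hs hu)).continuousAt.continuousWithinAt

/-- A curve that starts in the centre of a normal ball crosses the spheres in the ball. -/
lemma exists_exit {c : ℝ → M} (hc : ContMDiff 𝓘(ℝ, ℝ) (𝓡 d) 1 c) (h0 : c 0 = φ 0) {s : ℝ}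
    (hs0 : 0 < s) (hs : s < ρ) (h1 : c 1 ∉ φ '' Metric.ball 0 s) :
    ∃ t ∈ Icc (0 : ℝ) 1, ∃ v : V, ‖v‖ = s ∧ c t = φ v ∧
      ENNReal.ofReal s ≤ Manifold.pathELength (𝓡 d) c 0 t := by
  -- The least element of `K` is the first exit time: before it the curve stays in the open ball, so
  -- at it the curve is on the sphere.
  let K : Set ℝ := Icc 0 1 ∩ c ⁻¹' (φ '' Metric.ball 0 s)ᶜ
  have hK : IsCompact K := isCompact_Icc.inter_right
    ((hφ.isOpen_image hs.le).isClosed_compl.preimage hc.continuous)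
  have hne : K.Nonempty := ⟨1, by simp, h1⟩
  have hmem := hK.sInf_mem hne
  set t := sInf K
  have hlt : ∀ τ ∈ Ico 0 t, c τ ∈ φ '' Metric.ball 0 s := by
    intro τ hτ
    by_contra hcon
    have : t ≤ τ := csInf_le hK.bddBelow ⟨⟨hτ.1, hτ.2.le.trans hmem.1.2⟩, hcon⟩
    exact absurd hτ.2 this.not_gt
  have ht0 : 0 < t := by
    refine lt_of_le_of_ne hmem.1.1 fun h ↦ hmem.2 ?_
    rw [← h, h0]
    exact ⟨0, Metric.mem_ball_self hs0, rfl⟩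
  have hcl : c t ∈ φ '' Metric.closedBall 0 s := by
    have h2 : t ∈ closure (Ico 0 t) := by rw [closure_Ico ht0.ne]; exact ⟨ht0.le, le_rfl⟩
    have h3 := (hφ.isCompact_image hs).isClosed.preimage hc.continuous
    have h4 : Ico 0 t ⊆ c ⁻¹' (φ '' Metric.closedBall 0 s) := fun τ hτ ↦
      image_mono Metric.ball_subset_closedBall (hlt τ hτ)
    exact closure_minimal h4 h3 h2
  obtain ⟨v, hv, hvt⟩ := hcl
  have hvs : ‖v‖ = s := by
    refine le_antisymm (mem_closedBall_zero_iff.1 hv) (not_lt.1 fun h ↦ hmem.2 ?_)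
    exact ⟨v, mem_ball_zero_iff.2 h, hvt⟩
  refine ⟨t, hmem.1, v, hvs, hvt.symm, ?_⟩
  rw [← hvs]
  refine hφ.norm_le_pathELength hc ht0 (fun τ hτ ↦ ?_) h0
    (Metric.closedBall_subset_ball hs hv) hvt.symm
  rcases hτ.2.eq_or_lt with rfl | h
  · exact ⟨v, Metric.closedBall_subset_ball hs hv, hvt⟩
  · exact image_mono (Metric.ball_subset_ball hs.le) (hlt τ ⟨hτ.1, h⟩)

variable [IsRiemannianManifold (𝓡 d) M]

omit hφ [FiniteDimensional ℝ V] in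
lemma _root_.exists_path_of_dist_lt {x y : M} {r : ℝ} (h : dist x y < r) :
    ∃ c : ℝ → M, c 0 = x ∧ c 1 = y ∧ ContMDiff 𝓘(ℝ, ℝ) (𝓡 d) 1 c ∧
      Manifold.pathELength (𝓡 d) c 0 1 < ENNReal.ofReal r := by
  have h1 : Manifold.riemannianEDist (𝓡 d) x y < ENNReal.ofReal r := by
    rw [← IsRiemannianManifold.out (I := 𝓡 d), edist_dist]
    exact (ENNReal.ofReal_lt_ofReal_iff (dist_nonneg.trans_lt h)).2 h
  obtain ⟨c, h0, h1, hc, hl, -⟩ :=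
    Manifold.exists_lt_locally_constant_of_riemannianEDist_lt h1 zero_lt_one
  exact ⟨c, h0, h1, hc, hl⟩

/-- Every path from the centre to `y` has to cross the sphere of radius `s`, which already costs
length `s`. -/
lemma le_dist {s : ℝ} (hs : s < ρ) {y : M} (hy : y ∉ φ '' Metric.ball 0 s) :
    s ≤ dist (φ 0) y := by
  rcases le_or_gt s 0 with hs0 | hs0
  · exact hs0.trans dist_nonneg
  by_contra! hlt
  obtain ⟨c, h0, h1, hc, hl⟩ := exists_path_of_dist_lt (d := d) hlt
  obtain ⟨t, ht, -, -, -, hle⟩ := hφ.exists_exit hc h0 hs0 hs (h1 ▸ hy)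
  exact absurd ((hle.trans (Manifold.pathELength_mono le_rfl ht.2)).trans_lt hl) (lt_irrefl _)

omit [FiniteDimensional ℝ V] in
lemma dist_radial_le (u : V) {a b : ℝ} (hab : a ≤ b) :
    dist (φ (a • u)) (φ (b • u)) ≤ (b - a) * ‖u‖ := by
  rw [← hφ.norm_velocity_zero u]
  exact (hφ.isGeodesic u).dist_le hab

lemma dist_eq {v : V} (hv : v ∈ Metric.ball (0 : V) ρ) : dist (φ 0) (φ v) = ‖v‖ := by
  refine le_antisymm ?_ (hφ.le_dist (mem_ball_zero_iff.1 hv) ?_)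
  · simpa using hφ.dist_radial_le v (zero_le_one (α := ℝ))
  · rintro ⟨u, hu, huv⟩
    have := hφ.injOn (Metric.ball_subset_ball (mem_ball_zero_iff.1 hv).le hu) hv huv
    subst this
    exact absurd (mem_ball_zero_iff.1 hu) (lt_irrefl _)

/-- The first step of Hopf-Rinow: take the point of the sphere nearest to `y`. A path to `y` spends
length `s` before it crosses the sphere and at least this minimal distance afterwards. -/
lemma exists_mem_sphere_dist_le {y : M} {s : ℝ} (hs0 : 0 < s) (hs : s < ρ)
    (hsy : s < dist (φ 0) y) : ∃ v : V, ‖v‖ = s ∧ dist (φ v) y ≤ dist (φ 0) y - s := by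
  have hy : y ∉ φ '' Metric.ball 0 s := by
    rintro ⟨u, hu, rfl⟩
    rw [hφ.dist_eq (Metric.ball_subset_ball hs.le hu)] at hsy
    exact absurd (mem_ball_zero_iff.1 hu) hsy.not_gt
  have hsph : IsCompact (Metric.sphere (0 : V) s) := isCompact_sphere 0 s
  -- A path to `y` crosses the sphere, which is therefore nonempty without any assumption on the
  -- dimension of `V`.
  have hne : (Metric.sphere (0 : V) s).Nonempty := by
    obtain ⟨c, h0, h1, hc, -⟩ := exists_path_of_dist_lt (d := d) (lt_add_one (dist (φ 0) y))
    obtain ⟨-, -, v, hv, -⟩ := hφ.exists_exit hc h0 hs0 hs (h1 ▸ hy)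
    exact ⟨v, mem_sphere_zero_iff_norm.2 hv⟩
  obtain ⟨v, hv, hmin⟩ := hsph.exists_isMinOn hne (f := fun v ↦ dist (φ v) y) fun u hu ↦
    (show ContinuousAt (fun v ↦ dist (φ v) y) u from Filter.Tendsto.dist
      (hφ.contMDiffAt (Metric.closedBall_subset_ball hs
        (Metric.sphere_subset_closedBall hu))).continuousAt tendsto_const_nhds).continuousWithinAt
  refine ⟨v, mem_sphere_zero_iff_norm.1 hv, ?_⟩
  by_contra! hcon
  obtain ⟨c, h0, h1, hc, hl⟩ := exists_path_of_dist_lt (d := d) (sub_lt_iff_lt_add.1 hcon)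
  obtain ⟨t, ht, u, hu, hut, hle⟩ := hφ.exists_exit hc h0 hs0 hs (h1 ▸ hy)
  have h2 : ENNReal.ofReal (dist (φ v) y) ≤ Manifold.pathELength (𝓡 d) c t 1 := by
    refine le_trans ?_ (edist_le_pathELength hc ht.2)
    rw [edist_dist, hut, h1]
    exact ENNReal.ofReal_le_ofReal (hmin (mem_sphere_zero_iff_norm.2 hu))
  rw [← Manifold.pathELength_add ht.1 ht.2, ENNReal.ofReal_add dist_nonneg hs0.le,
    add_comm (ENNReal.ofReal _)] at hl
  exact absurd hl (not_lt.2 (add_le_add hle h2))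

end IsNormalBall

/-- Let `D` be the distance to `y`. For `s < D`, the unit directions `u` with `dist (φ (s u)) y ≤ D
- s` form nonempty compact sets that decrease in `s`. A direction common to all of them reaches `y`
at `s = D` by continuity. The limit is what admits `D = R`, although only balls of radius less than
`R` are known to be normal. -/
lemma exists_norm_eq_dist [FiniteDimensional ℝ V] [IsRiemannianManifold (𝓡 d) M] {φ : V → M}
    {R : ℝ} (hφ : ∀ ρ < R, IsNormalBall d φ ρ)
    {y : M} (hy0 : 0 < dist (φ 0) y) (hy : dist (φ 0) y ≤ R) :
    ∃ v : V, ‖v‖ = dist (φ 0) y ∧ φ v = y := by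
  set D := dist (φ 0) y with hD
  let K : Ioo 0 D → Set V := fun s ↦
    Metric.sphere (0 : V) 1 ∩ {u | dist (φ ((s : ℝ) • u)) y ≤ D - s}
  have hex : ∀ s : Ioo 0 D, ∃ ρ, (s : ℝ) < ρ ∧ ρ < R := fun s ↦ exists_between (s.2.2.trans_le hy)
  have hanti : ∀ s s' : Ioo 0 D, s ≤ s' → K s' ⊆ K s := by
    intro s s' hss u hu
    refine ⟨hu.1, ?_⟩
    obtain ⟨ρ, h1, h2⟩ := hex s'
    have h3 := (hφ ρ h2).dist_radial_le u (show (s : ℝ) ≤ s' from hss)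
    rw [mem_sphere_zero_iff_norm.1 hu.1, mul_one] at h3
    have h4 : dist (φ ((s' : ℝ) • u)) y ≤ D - s' := hu.2
    have h5 := dist_triangle (φ ((s : ℝ) • u)) (φ ((s' : ℝ) • u)) y
    show dist (φ ((s : ℝ) • u)) y ≤ D - s
    linarith
  have hclosed : ∀ s, IsClosed (K s) := by
    intro s
    obtain ⟨ρ, h1, h2⟩ := hex s
    have hcont : ContinuousOn (fun u ↦ dist (φ ((s : ℝ) • u)) y) (Metric.sphere (0 : V) 1) := by
      intro u hu
      have hmem : (s : ℝ) • u ∈ Metric.ball (0 : V) ρ := by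
        rwa [mem_ball_zero_iff, norm_smul, mem_sphere_zero_iff_norm.1 hu, mul_one,
          Real.norm_eq_abs, abs_of_pos s.2.1]
      have hc := ((hφ ρ h2).contMDiffAt hmem).continuousAt
      have hc' : ContinuousAt (fun u ↦ φ ((s : ℝ) • u)) u :=
        ContinuousAt.comp (f := fun u : V ↦ (s : ℝ) • u) hc (by fun_prop)
      have hc'' : ContinuousAt (fun u ↦ dist (φ ((s : ℝ) • u)) y) u := hc'.dist continuousAt_const
      exact hc''.continuousWithinAt
    exact hcont.preimage_isClosed_of_isClosed Metric.isClosed_sphere isClosed_Iic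
  have hne : ∀ s, (K s).Nonempty := by
    intro s
    obtain ⟨ρ, h1, h2⟩ := hex s
    obtain ⟨v, hv, hvy⟩ := (hφ ρ h2).exists_mem_sphere_dist_le s.2.1 h1 s.2.2
    have hs : (s : ℝ) ≠ 0 := s.2.1.ne'
    refine ⟨(s : ℝ)⁻¹ • v, ?_, ?_⟩
    · rw [mem_sphere_zero_iff_norm, norm_smul, hv, Real.norm_eq_abs, abs_of_pos (inv_pos.2 s.2.1),
        inv_mul_cancel₀ hs]
    · show dist (φ ((s : ℝ) • (s : ℝ)⁻¹ • v)) y ≤ D - s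
      rwa [smul_smul, mul_inv_cancel₀ hs, one_smul]
  have : Nonempty (Ioo 0 D) := ⟨⟨D / 2, by linarith, by linarith⟩⟩
  obtain ⟨u, hu⟩ := IsCompact.nonempty_iInter_of_directed_nonempty_isCompact_isClosed K
    (fun s s' ↦ ⟨max s s', hanti _ _ (le_max_left _ _), hanti _ _ (le_max_right _ _)⟩) hne
    (fun s ↦ (isCompact_sphere 0 1).of_isClosed_subset (hclosed s) inter_subset_left) hclosed
  rw [mem_iInter] at hu
  obtain ⟨ρ, h1, h2⟩ := hex ⟨D / 2, by linarith, by linarith⟩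
  have hcont : Continuous fun t : ℝ ↦ φ (t • u) := ((hφ ρ h2).isGeodesic u).1.continuous
  have hcl : IsClosed {t : ℝ | dist (φ (t • u)) y ≤ D - t} :=
    isClosed_le (hcont.dist continuous_const) (by fun_prop)
  have hDm : D ∈ closure (Ioo 0 D) := by rw [closure_Ioo hy0.ne]; exact ⟨hy0.le, le_rfl⟩
  have hfin : dist (φ (D • u)) y ≤ D - D :=
    closure_minimal (fun t ht ↦ (hu ⟨t, ht⟩).2) hcl hDm
  rw [sub_self] at hfin
  refine ⟨D • u, ?_, dist_le_zero.1 hfin⟩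
  rw [norm_smul, mem_sphere_zero_iff_norm.1 (hu ⟨D / 2, by linarith, by linarith⟩).1, mul_one,
    Real.norm_eq_abs, abs_of_pos hy0]

/-- A geodesic that realizes the distance to a set meets that set orthogonally. -/
lemma IsNormalBall.inner_radial_eq_zero [FiniteDimensional ℝ V] [IsRiemannianManifold (𝓡 d) M]
    {φ : V → M} {ρ : ℝ} (hφ : IsNormalBall d φ ρ) {v : V} (hv : v ∈ Metric.ball (0 : V) ρ)
    {c : ℝ → M} (hc : ContMDiff 𝓘(ℝ, ℝ) (𝓡 d) 1 c) {w : TangentSpace (𝓡 d) (φ v)}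
    (hcw : HasInitialVelocity c (φ v) w) (hmin : ∀ s, ‖v‖ ≤ dist (φ 0) (c s)) :
    (inner ℝ (mfderiv 𝓘(ℝ, V) (𝓡 d) φ v v : TangentSpace (𝓡 d) (φ v)) w : ℝ) = 0 := by
  obtain ⟨h0, h1⟩ := hasInitialVelocity_iff.1 hcw
  obtain ⟨h2, h3⟩ := hφ.lift (hc 0) hv h0
  set u : ℝ → V := fun s ↦ invFunOn φ (Metric.ball 0 ρ) (c s) with hu
  have hu0 : u 0 = v := by simp only [hu, h0]; exact hφ.invFunOn_apply hv
  -- Inside the ball `‖u s‖` is the distance from the centre to `c s`, which is least at `s = 0`.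
  -- Hence `⟨v, u'(0)⟩ = 0`, and the Gauss lemma transports this to the manifold.
  have hloc : IsLocalMin (fun s ↦ ‖u s‖ ^ 2) 0 := by
    have := hc.continuous.continuousAt.preimage_mem_nhds (x := 0)
      (by rw [h0]; exact hφ.image_mem_nhds hv (Metric.isOpen_ball.mem_nhds hv))
    filter_upwards [this] with s hs
    have e1 : c s = φ (u s) := (invFunOn_eq hs).symm
    have e2 := hφ.dist_eq (invFunOn_mem hs)
    have e3 := hmin s
    rw [e1] at e3
    rw [hu0]
    exact pow_le_pow_left₀ (norm_nonneg _) (e3.trans_eq e2) 2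
  have hder := (h2.differentiableAt (by simp)).hasDerivAt.norm_sq
  have h4 := hloc.hasDerivAt_eq_zero hder
  have h5 := hφ.inner_mfderiv_radial hv (deriv u 0 : V)
  rw [hu0] at h4
  have h6 : (inner ℝ v (deriv u 0) : ℝ) = 0 := by linarith
  rw [h6] at h5
  refine Eq.trans ?_ h5
  exact congrArg (fun z : TangentSpace (𝓡 d) (φ v) ↦
    (inner ℝ (mfderiv 𝓘(ℝ, V) (𝓡 d) φ v v : TangentSpace (𝓡 d) (φ v)) z : ℝ)) (h1.symm.trans h3)

end NormalBalls

/-! ### Shortest geodesics to a set are orthogonal to it -/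

section MinimalGeodesics

open Filter Topology

variable {d : ℕ} {M : Type*} [MetricSpace M]
  [ChartedSpace (EuclideanSpace ℝ (Fin d)) M]
  [RiemannianBundle (fun x : M ↦ TangentSpace (𝓡 d) x)]
  [IsManifold (𝓡 d) ∞ M]
  [IsContMDiffRiemannianBundle (𝓡 d) ∞ (EuclideanSpace ℝ (Fin d))
      (fun x : M ↦ TangentSpace (𝓡 d) x)]

/-- Strictly below the supremum there is an admissible radius at least `ρ`. The strict inequality
also makes the injectivity radius positive, so that geodesics exist in all directions. -/
lemma isNormalBall_expMap {x : M} {ρ : ℝ} (h : ENNReal.ofReal ρ < injRadiusAt d x) :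
    IsNormalBall d (expMap (d := d) x) ρ := by
  have hex := exists_isGeodesic_of_injRadiusAt_pos (pos_of_gt h)
  have hgeo : ∀ u : TangentSpace (𝓡 d) x,
      ∃ γ : ℝ → M, (fun t : ℝ ↦ expMap x (t • u)) = γ ∧ IsGeodesic (d := d) γ ∧
        HasInitialVelocity γ x u := fun u ↦ by
    obtain ⟨γ, hγ, hγu⟩ := hex u
    exact ⟨γ, funext fun t ↦ expMap_smul hγ hγu t, hγ, hγu⟩
  obtain ⟨ρ', hρ'⟩ := lt_iSup_iff.1 h
  obtain ⟨⟨hinj, hloc⟩, hρ'⟩ := lt_iSup_iff.1 hρ'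
  have hle : ρ ≤ ρ' := Real.toNNReal_le_iff_le_coe.1 (ENNReal.coe_lt_coe.1 hρ').le
  refine ⟨fun u ↦ ?_, fun u ↦ ?_, hinj.mono (Metric.ball_subset_ball hle),
    fun u ↦ hloc ⟨u, Metric.ball_subset_ball hle u.2⟩⟩
  · obtain ⟨γ, h1, h2, h3⟩ := hgeo u
    rwa [h1]
  · obtain ⟨γ, h1, h2, h3⟩ := hgeo u
    exact (congrArg (fun β : ℝ → M ↦ ‖velocity (d := d) β 0‖) h1).trans h3.norm_eq

lemma mem_normalSpaceOf_iff {P : Set M} {y : M} {u : TangentSpace (𝓡 d) y} :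
    u ∈ normalSpaceOf (d := d) P y ↔ ∀ (c : ℝ → M) (w : TangentSpace (𝓡 d) y),
      ContMDiff 𝓘(ℝ, ℝ) (𝓡 d) ∞ c → (∀ t, c t ∈ P) → HasInitialVelocity c y w →
        (inner ℝ u w : ℝ) = 0 := by
  rw [normalSpaceOf, Submodule.mem_orthogonal', tangentSpaceOf]
  constructor
  · exact fun h c w h1 h2 h3 ↦ h w (Submodule.subset_span ⟨c, h1, h2, h3⟩)
  · intro h w hw
    induction hw using Submodule.span_induction with
    | mem w hw => obtain ⟨c, h1, h2, h3⟩ := hw; exact h c w h1 h2 h3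
    | zero => exact inner_zero_right _
    | add a b _ _ ha hb => rw [inner_add_right, ha, hb, add_zero]
    | smul a b _ hb => rw [real_inner_smul_right, hb, mul_zero]

variable [IsRiemannianManifold (𝓡 d) M]

/-- The distance from `y` to `q` may equal the injectivity radius, and then `q` need not lie in a
normal ball around `y`. Orthogonality is therefore proved from the midpoint `z` of a shortest
geodesic: `q` is also nearest to `z` in `P`, at half the distance. -/
lemma exists_geodesic_normal_of_isMin {P : Set M} {q y : M}
    (hmin : ∀ q' ∈ P, dist y q ≤ dist y q')
    (hy : ENNReal.ofReal (dist y q) ≤ injRadius d M) :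
    ∃ γ : ℝ → M, IsGeodesic (d := d) γ ∧ γ 1 = y ∧ γ 0 = q ∧
      velocity (d := d) γ 0 ∈ normalSpaceOf (d := d) P (γ 0) ∧
      ‖velocity (d := d) γ 0‖ = dist y q := by
  rcases eq_or_ne y q with rfl | hyq
  · refine ⟨_, isGeodesic_const y, rfl, rfl, ?_, ?_⟩
    · rw [velocity_const]; exact zero_mem _
    · rw [velocity_const, norm_zero, dist_self]
  set D := dist y q with hD
  have hD0 : 0 < D := dist_pos.2 hyq
  have hfd : ∀ x : M, FiniteDimensional ℝ (TangentSpace (𝓡 d) x) := fun x ↦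
    inferInstanceAs (FiniteDimensional ℝ (EuclideanSpace ℝ (Fin d)))
  have hball : ∀ x : M, ∀ ρ < D, IsNormalBall d (expMap (d := d) x) ρ := fun x ρ hρ ↦
    isNormalBall_expMap (((ENNReal.ofReal_lt_ofReal_iff hD0).2 hρ).trans_le
      (hy.trans (iInf_le _ x)))
  obtain ⟨v, hv, hvq⟩ := exists_norm_eq_dist (y := q) (hball y)
    (by rw [expMap_zero]; exact hD0) (by rw [expMap_zero])
  rw [expMap_zero, ← hD] at hv
  have hx0 : 0 < injRadiusAt d y :=
    (ENNReal.ofReal_pos.2 hD0).trans_le (hy.trans (iInf_le _ y))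
  obtain ⟨α, hα, hαv⟩ := exists_isGeodesic_of_injRadiusAt_pos hx0 v
  have hα0 : α 0 = y := (hasInitialVelocity_iff.1 hαv).1
  have hα1 : α 1 = q := by rw [← expMap_eq hα hαv, hvq]
  have hαn : ‖velocity (d := d) α 0‖ = D := by rw [hαv.norm_eq, hv]
  set z := α (1 / 2) with hz
  have hyz : dist y z ≤ D / 2 := by
    have := hα.dist_le (show (0 : ℝ) ≤ 1 / 2 by norm_num)
    rw [hαn, hα0] at this
    linarith
  let η : ℝ → M := fun s ↦ α (1 / 2 * s + 1 / 2)
  have hη : IsGeodesic (d := d) η := hα.comp_affine _ _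
  have hη0 : η 0 = z := by simp only [η, hz, mul_zero, zero_add]
  have hη1 : η 1 = q := by rw [← hα1]; simp only [η]; norm_num
  let w₀ : TangentSpace (𝓡 d) z := (velocity (d := d) η 0 : EuclideanSpace ℝ (Fin d))
  have hηw : HasInitialVelocity η z w₀ := hasInitialVelocity_iff.2 ⟨hη0, rfl⟩
  have hαd : MDifferentiable 𝓘(ℝ, ℝ) (𝓡 d) α := fun t ↦ hα.mdifferentiableAt t
  have hw₀ : ‖w₀‖ = D / 2 := by
    rw [← hηw.norm_eq, velocity_comp_affine hαd, norm_smul, hα.norm_velocity, hαn]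
    norm_num
    ring
  -- Any radius strictly between `D / 2`, the distance from `z` to `q`, and `D` would do.
  have hφ := hball z (3 / 4 * D) (by linarith)
  have hw₀m : w₀ ∈ Metric.ball (0 : TangentSpace (𝓡 d) z) (3 / 4 * D) := by
    rw [mem_ball_zero_iff, hw₀]; linarith
  have hφη : (fun s : ℝ ↦ expMap z (s • w₀)) = η := funext fun s ↦ expMap_smul hη hηw s
  have hφq : expMap z w₀ = q := by rw [expMap_eq hη hηw, hη1]
  have hvel : (mfderiv 𝓘(ℝ, TangentSpace (𝓡 d) z) (𝓡 d) (expMap (d := d) z) w₀ w₀ :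
      EuclideanSpace ℝ (Fin d)) = (1 / 2 : ℝ) • (velocity (d := d) α 1 :
        EuclideanSpace ℝ (Fin d)) := by
    have hg : HasDerivAt (fun s : ℝ ↦ s • w₀) w₀ 1 := by
      simpa using! (hasDerivAt_id (1 : ℝ)).smul_const w₀
    have h1w : (1 : ℝ) • w₀ = w₀ := one_smul _ _
    have h1 := mfderiv_comp_vectorSpace (φ := expMap (d := d) z) hg.differentiableAt
      (by rw [h1w]; exact hφ.mdifferentiableAt hw₀m) (1 : ℝ)
    rw [fderiv_apply_one_eq_deriv, hg.deriv] at h1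
    have h2 : (mfderiv 𝓘(ℝ, TangentSpace (𝓡 d) z) (𝓡 d) (expMap (d := d) z) ((1 : ℝ) • w₀) w₀ :
      EuclideanSpace ℝ (Fin d)) =
      mfderiv 𝓘(ℝ, TangentSpace (𝓡 d) z) (𝓡 d) (expMap (d := d) z) w₀ w₀ := by
      rw [h1w]
    have h3 : (mfderiv 𝓘(ℝ, ℝ) (𝓡 d) (fun s : ℝ ↦ expMap z (s • w₀)) 1 (1 : ℝ) :
      EuclideanSpace ℝ (Fin d)) = velocity (d := d) η 1 := by rw [hφη]; rfl
    have h4 := velocity_comp_affine hαd (1 / 2) (1 / 2) 1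
    have h5 : (velocity (d := d) α (1 / 2 * 1 + 1 / 2) : EuclideanSpace ℝ (Fin d)) =
      velocity (d := d) α 1 := by rw [show (1 / 2 * 1 + 1 / 2 : ℝ) = 1 by norm_num]
    exact h2.symm.trans (h1.symm.trans (h3.trans (h4.trans
      (congrArg (fun u : EuclideanSpace ℝ (Fin d) ↦ (1 / 2 : ℝ) • u) h5))))
  -- The geodesic reversed, to start at `q`. The radial vector at `q` seen from `z` is `½ α'(1)`,
  -- which explains the factor `-2`.
  let γ : ℝ → M := fun t ↦ α (-1 * t + 1)
  have hγ0 : γ 0 = q := by rw [← hα1]; simp only [γ]; norm_num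
  have hγv : (velocity (d := d) γ 0 : EuclideanSpace ℝ (Fin d)) = (-2 : ℝ) •
      (mfderiv 𝓘(ℝ, TangentSpace (𝓡 d) z) (𝓡 d) (expMap (d := d) z) w₀ w₀ :
        EuclideanSpace ℝ (Fin d)) := by
    have h4 := velocity_comp_affine hαd (-1) 1 0
    have h5 : (velocity (d := d) α (-1 * 0 + 1) : EuclideanSpace ℝ (Fin d)) =
      velocity (d := d) α 1 := by rw [show (-1 * 0 + 1 : ℝ) = 1 by norm_num]
    have h6 : ∀ u : EuclideanSpace ℝ (Fin d), (-2 : ℝ) • ((1 / 2 : ℝ) • u) = (-1 : ℝ) • u :=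
      fun u ↦ by rw [smul_smul]; norm_num
    exact h4.trans ((congrArg (fun u : EuclideanSpace ℝ (Fin d) ↦ (-1 : ℝ) • u) h5).trans
      ((h6 _).symm.trans
        (congrArg (fun u : EuclideanSpace ℝ (Fin d) ↦ (-2 : ℝ) • u) hvel.symm)))
  refine ⟨γ, hα.comp_affine _ _, ?_, hγ0, ?_, ?_⟩
  · rw [← hα0]; simp only [γ]; norm_num
  · rw [mem_normalSpaceOf_iff]
    intro c w hc hcP hcw
    obtain ⟨hc0, hc1⟩ := hasInitialVelocity_iff.1 hcw
    have hcw' : HasInitialVelocity c (expMap z w₀)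
        (show TangentSpace (𝓡 d) (expMap z w₀) from w) :=
      hasInitialVelocity_iff.2 ⟨by rw [hc0, hγ0, hφq], hc1⟩
    -- For `q' ∈ P`, `dist z q' ≥ dist y q' - dist y z ≥ D - D / 2`, so `q` is nearest to `z` as
    -- well.
    have key := hφ.inner_radial_eq_zero hw₀m (hc.of_le (by norm_cast)) hcw' fun s ↦ by
      rw [expMap_zero, hw₀]
      have h1 := hmin (c s) (hcP s)
      have h2 := dist_triangle y z (c s)
      linarith
    have h6 := inner_congr_base (hγ0.trans hφq.symm) (velocity (d := d) γ 0) w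
    refine h6.trans ?_
    have h7 := congrArg (fun u : TangentSpace (𝓡 d) (expMap z w₀) ↦
      (inner ℝ u (show TangentSpace (𝓡 d) (expMap z w₀) from w) : ℝ)) hγv
    refine h7.trans ?_
    refine (real_inner_smul_left (F := TangentSpace (𝓡 d) (expMap z w₀)) _ _ _).trans ?_
    exact (congrArg (fun a : ℝ ↦ -2 * a) key).trans (mul_zero _)
  · have h4 := velocity_comp_affine hαd (-1) 1 0
    have h5 : ‖velocity (d := d) γ 0‖ = ‖velocity (d := d) α (-1 * 0 + 1)‖ := by
      rw [← norm_neg (velocity (d := d) α (-1 * 0 + 1)), ← neg_one_smul ℝ (velocity α _), ← h4]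
    rw [h5, hα.norm_velocity, hαn]

end MinimalGeodesics

/-! ### Vector fields and Lie brackets in charts -/

section ChartRepresentation

open Filter Topology VectorField

variable {F : Type*} [NormedAddCommGroup F] [NormedSpace ℝ F] {H : Type*} [TopologicalSpace H]
  {I : ModelWithCorners ℝ F H} [I.Boundaryless] {N : Type*} [TopologicalSpace N] [ChartedSpace H N]

/-- The vector field `A` is given by `a` in the chart around `x₀`. -/
def HasChartRep (I : ModelWithCorners ℝ F H) (x₀ : N) (A : ∀ x : N, TangentSpace I x)
    (a : F → F) : Prop :=
  ∀ q ∈ (extChartAt I x₀).target, (A ((extChartAt I x₀).symm q) : F) =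
    mfderiv 𝓘(ℝ, F) I (extChartAt I x₀).symm q (a q)

/-- The coordinate field with constant coordinates `u` in the chart around `x₀`. -/
def coordField (I : ModelWithCorners ℝ F H) (x₀ : N) (u : F) (x : N) : TangentSpace I x :=
  (show F from mfderiv 𝓘(ℝ, F) I (extChartAt I x₀).symm (extChartAt I x₀ x) u)

lemma hasChartRep_coordField (x₀ : N) (u : F) :
    HasChartRep I x₀ (coordField I x₀ u) (fun _ ↦ u) := fun q hq ↦ by
  have h : extChartAt I x₀ ((extChartAt I x₀).symm q) = q := (extChartAt I x₀).right_inv hq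
  exact congrArg (fun q' ↦ (mfderiv 𝓘(ℝ, F) I (extChartAt I x₀).symm q' u : F)) h

variable [IsManifold I ∞ N]

lemma contMDiffAt_extChartAt_symm {x₀ : N} {q : F} (hq : q ∈ (extChartAt I x₀).target) :
    ContMDiffAt 𝓘(ℝ, F) I ∞ (extChartAt I x₀).symm q :=
  (contMDiffOn_extChartAt_symm x₀).contMDiffAt ((isOpen_extChartAt_target x₀).mem_nhds hq)

lemma isInvertible_mfderiv_extChartAt_symm' {x₀ : N} {q : F}
    (hq : q ∈ (extChartAt I x₀).target) :
    (mfderiv 𝓘(ℝ, F) I (extChartAt I x₀).symm q).IsInvertible := by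
  have := isInvertible_mfderivWithin_extChartAt_symm (I := I) hq
  rwa [I.range_eq_univ, mfderivWithin_univ] at this

lemma HasChartRep.mpullback_eq {x₀ : N} {A : ∀ x : N, TangentSpace I x} {a : F → F}
    (h : HasChartRep I x₀ A a) {q : F} (hq : q ∈ (extChartAt I x₀).target) :
    mpullback 𝓘(ℝ, F) I (extChartAt I x₀).symm A q = a q := by
  rw [mpullback_apply]
  have hinv := isInvertible_mfderiv_extChartAt_symm' hq
  have h1 := congrArg (mfderiv 𝓘(ℝ, F) I (extChartAt I x₀).symm q).inverse (h q hq)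
  exact h1.trans (hinv.inverse_apply_self (a q))

lemma hasChartRep_mpullback (x₀ : N) (A : ∀ x : N, TangentSpace I x) :
    HasChartRep I x₀ A (mpullback 𝓘(ℝ, F) I (extChartAt I x₀).symm A) := fun q hq ↦ by
  rw [mpullback_apply]
  exact ((isInvertible_mfderiv_extChartAt_symm' hq).self_apply_inverse _).symm

lemma HasChartRep.contMDiffAt {x₀ : N} {A : ∀ x : N, TangentSpace I x} {a : F → F}
    (h : HasChartRep I x₀ A a) {q : F} (hq : q ∈ (extChartAt I x₀).target) {n : ℕ∞}
    (ha : ContDiffAt ℝ n a q) :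
    ContMDiffAt I I.tangent n (fun x ↦ (⟨x, A x⟩ : TangentBundle I N))
      ((extChartAt I x₀).symm q) := by
  have hopen : IsOpen (extChartAt I x₀).target := isOpen_extChartAt_target x₀
  have hsrc := (extChartAt I x₀).map_target hq
  have hmap := (extChartAt I x₀).right_inv hq
  have h1 : ContMDiffAt 𝓘(ℝ, F).tangent I.tangent n
      (tangentMapWithin 𝓘(ℝ, F) I (extChartAt I x₀).symm (extChartAt I x₀).target)
      (⟨q, a q⟩ : TangentBundle 𝓘(ℝ, F) F) :=
    (((contMDiffOn_extChartAt_symm (I := I) (n := ∞) x₀).contMDiffOn_tangentMapWithin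
      (m := n) (by exact_mod_cast le_top) hopen.uniqueMDiffOn)).contMDiffAt
      ((FiberBundle.continuous_proj F (TangentSpace 𝓘(ℝ, F))).continuousAt.preimage_mem_nhds
        (hopen.mem_nhds hq))
  have h2 : ContMDiffAt 𝓘(ℝ, F) 𝓘(ℝ, F).tangent n
      (fun e ↦ (⟨e, a e⟩ : TangentBundle 𝓘(ℝ, F) F)) q :=
    contMDiffAt_vectorSpace_iff_contDiffAt.2 ha
  have h3 : ContMDiffAt I 𝓘(ℝ, F) n (extChartAt I x₀) ((extChartAt I x₀).symm q) :=
    (contMDiffAt_extChartAt' (n := ∞) (by rwa [extChartAt_source] at hsrc)).of_le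
      (by exact_mod_cast le_top)
  have h4 := ContMDiffAt.comp_of_eq h1 h2 rfl
  have h5 := ContMDiffAt.comp_of_eq h4 h3 hmap
  refine h5.congr_of_eventuallyEq ?_
  filter_upwards [(isOpen_extChartAt_source x₀).mem_nhds hsrc] with x hx
  have hx' := (extChartAt I x₀).map_source hx
  have hinv := (extChartAt I x₀).left_inv hx
  simp only [Function.comp_apply, tangentMapWithin]
  rw [mfderivWithin_of_isOpen hopen hx']
  refine (TotalSpace.mk.injEq (F := F) _ _ _ _).mpr ⟨hinv.symm, heq_of_eq ?_⟩
  refine Eq.trans ?_ (h _ hx')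
  rw [hinv]

lemma HasChartRep.contDiffAt {x₀ : N} {A : ∀ x : N, TangentSpace I x} {a : F → F}
    (h : HasChartRep I x₀ A a) {q : F} (hq : q ∈ (extChartAt I x₀).target) [CompleteSpace F]
    {n : ℕ∞}
    (hA : ContMDiffAt I I.tangent n (fun x ↦ (⟨x, A x⟩ : TangentBundle I N))
      ((extChartAt I x₀).symm q)) : ContDiffAt ℝ n a q := by
  have h1 := hA.mpullback_vectorField_preimage (f := (extChartAt I x₀).symm) (n := ∞)
    (contMDiffAt_extChartAt_symm hq) (isInvertible_mfderiv_extChartAt_symm' hq) (m := n)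
    (by exact_mod_cast le_top)
  have h2 := contMDiffAt_vectorSpace_iff_contDiffAt.1 h1
  refine h2.congr_of_eventuallyEq ?_
  filter_upwards [(isOpen_extChartAt_target x₀).mem_nhds hq] with q' hq'
  exact (h.mpullback_eq hq').symm

/-- The bracket commutes with the pullback by the inverse chart, and in a vector space it is the
usual difference of derivatives. -/
lemma HasChartRep.mlieBracket_eq [CompleteSpace F] {x₀ : N} {A B : ∀ x : N, TangentSpace I x}
    {a b : F → F} (hA : HasChartRep I x₀ A a) (hB : HasChartRep I x₀ B b) {q : F}
    (hq : q ∈ (extChartAt I x₀).target) (ha : ContDiffAt ℝ 1 a q) (hb : ContDiffAt ℝ 1 b q) :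
    (mlieBracket I A B ((extChartAt I x₀).symm q) : F) =
      mfderiv 𝓘(ℝ, F) I (extChartAt I x₀).symm q (fderiv ℝ b q (a q) - fderiv ℝ a q (b q)) := by
  have : IsManifold I (minSmoothness ℝ 3) N := by
    rw [minSmoothness_of_isRCLikeNormedField]
    exact IsManifold.of_le (n := ∞) (by norm_cast)
  have h1 := mpullback_mlieBracket (n := ∞) (f := (extChartAt I x₀).symm) (x₀ := q)
    ((hA.contMDiffAt (n := 1) hq ha).mdifferentiableAt (by simp))
    ((hB.contMDiffAt (n := 1) hq hb).mdifferentiableAt (by simp))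
    (contMDiffAt_extChartAt_symm hq)
    (by rw [minSmoothness_of_isRCLikeNormedField]; norm_cast)
  have h2 : mlieBracket 𝓘(ℝ, F) (mpullback 𝓘(ℝ, F) I (extChartAt I x₀).symm A)
      (mpullback 𝓘(ℝ, F) I (extChartAt I x₀).symm B) q = mlieBracket 𝓘(ℝ, F) a b q := by
    have hn := (isOpen_extChartAt_target (I := I) x₀).mem_nhds hq
    refine EventuallyEq.mlieBracket_vectorField_eq ?_ ?_
    · filter_upwards [hn] with q' hq' using hA.mpullback_eq hq'
    · filter_upwards [hn] with q' hq' using hB.mpullback_eq hq'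
  have h3 : mlieBracket 𝓘(ℝ, F) a b q = fderiv ℝ b q (a q) - fderiv ℝ a q (b q) := by
    have h4 : lieBracketWithin ℝ a b univ q = fderiv ℝ b q (a q) - fderiv ℝ a q (b q) := by
      rw [lieBracketWithin_univ]; rfl
    exact (congrFun (mlieBracketWithin_eq_lieBracketWithin (V := a) (W := b) (s := univ)) q).trans
      h4
  have h4 := h1.trans (h2.trans h3)
  have h5 := congrArg (mfderiv 𝓘(ℝ, F) I (extChartAt I x₀).symm q) h4
  rw [mpullback_apply] at h5
  exact ((isInvertible_mfderiv_extChartAt_symm' hq).self_apply_inverse _).symm.trans h5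

end ChartRepresentation

/-! ### Coordinates on the cone -/

section ConeCoordinates

open Filter Topology VectorField

variable {d : ℕ} {S : Type*} [TopologicalSpace S] [ChartedSpace (EuclideanSpace ℝ (Fin d)) S]

/-- The point of the cone over `x` at height one. -/
def slicePoint (x : S) : Cone S := (⟨1, mem_Ioi.2 one_pos⟩, x)

/-- Every chart of the half-line is the inclusion into `ℝ`. Hence the charts of the cone around
points at height one cover all heights and have the form `(r, chart of S)`. -/
lemma extChartAt_halfLine (r s : (⟨Ioi (0 : ℝ), isOpen_Ioi⟩ : TopologicalSpace.Opens ℝ)) :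
    s ∈ (extChartAt 𝓘(ℝ, ℝ) r).source ∧ extChartAt 𝓘(ℝ, ℝ) r s = s := by
  constructor
  · rw [extChartAt_source, TopologicalSpace.Opens.chartAt_eq]
    simp only [OpenPartialHomeomorph.subtypeRestr_source]
    exact mem_univ _
  · rfl

lemma mem_extChartAt_cone_source {x₀ : S} {c : Cone S}
    (hc : c.2 ∈ (extChartAt (𝓡 d) x₀).source) :
    c ∈ (extChartAt (coneModel d) (slicePoint x₀)).source := by
  rw [extChartAt_prod]
  exact ⟨(extChartAt_halfLine _ _).1, hc⟩

lemma extChartAt_cone_apply (x₀ : S) (c : Cone S) :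
    extChartAt (coneModel d) (slicePoint x₀) c = ((c.1 : ℝ), extChartAt (𝓡 d) x₀ c.2) := by
  rw [extChartAt_prod]
  rfl

lemma mem_extChartAt_cone_target {x₀ : S} {s : ℝ} (hs : 0 < s) {e : EuclideanSpace ℝ (Fin d)}
    (he : e ∈ (extChartAt (𝓡 d) x₀).target) :
    (s, e) ∈ (extChartAt (coneModel d) (slicePoint x₀)).target := by
  have h := (extChartAt (coneModel d) (slicePoint x₀)).map_source
    (mem_extChartAt_cone_source (c := (⟨s, hs⟩, (extChartAt (𝓡 d) x₀).symm e))
      ((extChartAt (𝓡 d) x₀).map_target he))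
  rw [extChartAt_cone_apply] at h
  rwa [(extChartAt (𝓡 d) x₀).right_inv he] at h

lemma extChartAt_cone_symm {x₀ : S} {q : ℝ × EuclideanSpace ℝ (Fin d)}
    (hq : q ∈ (extChartAt (coneModel d) (slicePoint x₀)).target) :
    (((extChartAt (coneModel d) (slicePoint x₀)).symm q).1 : ℝ) = q.1 ∧
    ((extChartAt (coneModel d) (slicePoint x₀)).symm q).2 = (extChartAt (𝓡 d) x₀).symm q.2 ∧
    q.2 ∈ (extChartAt (𝓡 d) x₀).target := by
  have h1 := (extChartAt (coneModel d) (slicePoint x₀)).right_inv hq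
  rw [extChartAt_cone_apply] at h1
  have h2 := (extChartAt (coneModel d) (slicePoint x₀)).map_target hq
  rw [extChartAt_prod] at h2
  have h3 : ((extChartAt (coneModel d) (slicePoint x₀)).symm q).2 ∈
    (extChartAt (𝓡 d) x₀).source := h2.2
  have h4 := (extChartAt (𝓡 d) x₀).left_inv h3
  have h5 := (extChartAt (𝓡 d) x₀).map_source h3
  rw [show extChartAt (𝓡 d) x₀ ((extChartAt (coneModel d) (slicePoint x₀)).symm q).2 = q.2 from
    congrArg Prod.snd h1] at h4 h5
  exact ⟨congrArg Prod.fst h1, h4.symm, h5⟩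

lemma coneTangential_apply (c : Cone S) (u : TangentSpace (coneModel d) c) :
    (coneTangential c u : EuclideanSpace ℝ (Fin d)) = u.2 := by
  have h : mfderiv (coneModel d) (𝓡 d) (fun c' : Cone S ↦ c'.2) c =
    ContinuousLinearMap.snd ℝ ℝ (EuclideanSpace ℝ (Fin d)) := mfderiv_snd
  exact congrArg (fun L : ℝ × EuclideanSpace ℝ (Fin d) →L[ℝ] EuclideanSpace ℝ (Fin d) ↦ L u) h

lemma hasMFDerivAt_halfLine_val (r : (⟨Ioi (0 : ℝ), isOpen_Ioi⟩ : TopologicalSpace.Opens ℝ)) :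
    HasMFDerivAt 𝓘(ℝ, ℝ) 𝓘(ℝ, ℝ)
      (fun s : (⟨Ioi (0 : ℝ), isOpen_Ioi⟩ : TopologicalSpace.Opens ℝ) ↦ (s : ℝ)) r
      (ContinuousLinearMap.id ℝ ℝ) := by
  refine ⟨continuous_subtype_val.continuousAt, ?_⟩
  have hr : (r : ℝ) ∈ (extChartAt 𝓘(ℝ, ℝ) r).target :=
    (extChartAt 𝓘(ℝ, ℝ) r).map_source (extChartAt_halfLine r r).1
  refine (hasFDerivWithinAt_id (𝕜 := ℝ) (r : ℝ) _).congr_of_eventuallyEq ?_ ?_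
  · filter_upwards [mem_nhdsWithin_of_mem_nhds ((isOpen_extChartAt_target r).mem_nhds hr)]
      with s hs
    exact (extChartAt 𝓘(ℝ, ℝ) r).right_inv hs
  · exact (extChartAt 𝓘(ℝ, ℝ) r).right_inv hr

lemma hasMFDerivAt_cone_radius (c : Cone S) :
    HasMFDerivAt (coneModel d) 𝓘(ℝ, ℝ) (fun c' : Cone S ↦ (c'.1 : ℝ)) c
      (ContinuousLinearMap.fst ℝ ℝ (EuclideanSpace ℝ (Fin d))) :=
  (hasMFDerivAt_halfLine_val c.1).comp c (hasMFDerivAt_fst (I := 𝓘(ℝ, ℝ)) (I' := 𝓡 d) c)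

lemma coneRadial_apply (c : Cone S) (u : TangentSpace (coneModel d) c) :
    coneRadial c u = u.1 := by
  exact congrArg (fun L : ℝ × EuclideanSpace ℝ (Fin d) →L[ℝ] ℝ ↦ L u)
    (hasMFDerivAt_cone_radius c).mfderiv

variable [IsManifold (𝓡 d) ∞ S]

/-- The differential of the inverse of the chart of the cone. -/
def coneFrame (x₀ : S) (q : ℝ × EuclideanSpace ℝ (Fin d)) :
    ℝ × EuclideanSpace ℝ (Fin d) →L[ℝ] ℝ × EuclideanSpace ℝ (Fin d) :=
  mfderiv 𝓘(ℝ, ℝ × EuclideanSpace ℝ (Fin d)) (coneModel d)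
    (extChartAt (coneModel d) (slicePoint x₀)).symm q

lemma coneFrame_apply {x₀ : S} {q : ℝ × EuclideanSpace ℝ (Fin d)}
    (hq : q ∈ (extChartAt (coneModel d) (slicePoint x₀)).target)
    (u : ℝ × EuclideanSpace ℝ (Fin d)) :
    coneFrame x₀ q u = (u.1, (chartFrame x₀ q.2 u.2 : EuclideanSpace ℝ (Fin d))) := by
  set Φ := (extChartAt (coneModel d) (slicePoint x₀)).symm with hΦ
  have hd : MDifferentiableAt 𝓘(ℝ, ℝ × EuclideanSpace ℝ (Fin d)) (coneModel d) Φ q :=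
    (contMDiffAt_extChartAt_symm hq).mdifferentiableAt (by simp)
  have hn := (isOpen_extChartAt_target (I := coneModel d) (slicePoint x₀)).mem_nhds hq
  refine Prod.ext ?_ ?_
  · have h1 := ((hasMFDerivAt_cone_radius (Φ q)).comp q hd.hasMFDerivAt).mfderiv
    have h2 : (fun c' : Cone S ↦ (c'.1 : ℝ)) ∘ Φ =ᶠ[𝓝 q] Prod.fst := by
      filter_upwards [hn] with q' hq' using (extChartAt_cone_symm hq').1
    rw [h2.mfderiv_eq, mfderiv_eq_fderiv, fderiv_fst] at h1
    exact (congrArg (fun L : ℝ × EuclideanSpace ℝ (Fin d) →L[ℝ] ℝ ↦ L u) h1).symm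
  · have h1 := ((hasMFDerivAt_snd (I := 𝓘(ℝ, ℝ)) (I' := 𝓡 d) (Φ q)).comp q hd.hasMFDerivAt).mfderiv
    have h2 : (fun c' : Cone S ↦ c'.2) ∘ Φ =ᶠ[𝓝 q] (extChartAt (𝓡 d) x₀).symm ∘ Prod.snd := by
      filter_upwards [hn] with q' hq' using (extChartAt_cone_symm hq').2.1
    have h3 := mfderiv_comp (I := 𝓘(ℝ, ℝ × EuclideanSpace ℝ (Fin d)))
      (I' := 𝓘(ℝ, EuclideanSpace ℝ (Fin d))) (I'' := 𝓡 d) q (f := Prod.snd)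
      (mdifferentiableAt_extChartAt_symm (extChartAt_cone_symm hq).2.2)
      differentiableAt_snd.mdifferentiableAt
    rw [mfderiv_eq_fderiv, fderiv_snd] at h3
    have h4 := (h2.mfderiv_eq (I := 𝓘(ℝ, ℝ × EuclideanSpace ℝ (Fin d))) (I' := 𝓡 d))
    have h5 := congrArg (fun L : ℝ × EuclideanSpace ℝ (Fin d) →L[ℝ] EuclideanSpace ℝ (Fin d) ↦ L u)
      h1
    have h6 := congrArg (fun L : ℝ × EuclideanSpace ℝ (Fin d) →L[ℝ] EuclideanSpace ℝ (Fin d) ↦ L u)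
      h4
    have h7 := congrArg (fun L : ℝ × EuclideanSpace ℝ (Fin d) →L[ℝ] EuclideanSpace ℝ (Fin d) ↦ L u)
      h3
    exact h5.symm.trans (h6.trans h7)

lemma hasChartRep_eulerField (x₀ : S) :
    HasChartRep (coneModel d) (slicePoint x₀) (eulerField (d := d)) (fun q ↦ (q.1, 0)) := by
  intro q hq
  refine Eq.trans ?_ (coneFrame_apply hq (q.1, 0)).symm
  rw [map_zero]
  exact Prod.ext (extChartAt_cone_symm hq).1 rfl

variable [RiemannianBundle (fun x : S ↦ TangentSpace (𝓡 d) x)]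

/-- The cone metric in the chart of the cone. -/
def coneForm (x₀ : S) (q u v : ℝ × EuclideanSpace ℝ (Fin d)) : ℝ :=
  u.1 * v.1 + q.1 ^ 2 * metricForm x₀ q.2 u.2 v.2

lemma coneMetric_coneFrame {x₀ : S} {q : ℝ × EuclideanSpace ℝ (Fin d)}
    (hq : q ∈ (extChartAt (coneModel d) (slicePoint x₀)).target)
    (u v : ℝ × EuclideanSpace ℝ (Fin d)) :
    coneMetric (d := d) ((extChartAt (coneModel d) (slicePoint x₀)).symm q)
      (coneFrame x₀ q u) (coneFrame x₀ q v) = coneForm x₀ q u v := by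
  obtain ⟨h1, h2, h3⟩ := extChartAt_cone_symm hq
  have e : ∀ u, (coneTangential ((extChartAt (coneModel d) (slicePoint x₀)).symm q)
      (coneFrame x₀ q u) : EuclideanSpace ℝ (Fin d)) = chartFrame x₀ q.2 u.2 := fun u ↦
    (coneTangential_apply _ _).trans (congrArg Prod.snd (coneFrame_apply hq u))
  have e1 : ∀ u, coneRadial ((extChartAt (coneModel d) (slicePoint x₀)).symm q)
      (coneFrame x₀ q u) = u.1 := fun u ↦ by
    have h := congrArg Prod.fst (coneFrame_apply hq u)
    exact (coneRadial_apply _ _).trans h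
  have e2 := inner_congr_base h2 (chartFrame x₀ q.2 u.2) (chartFrame x₀ q.2 v.2)
  have e3 := congrArg₂ (fun a b : TangentSpace (𝓡 d)
    ((extChartAt (coneModel d) (slicePoint x₀)).symm q).2 ↦ (inner ℝ a b : ℝ)) (e u) (e v)
  have e4 : (inner ℝ (coneTangential ((extChartAt (coneModel d) (slicePoint x₀)).symm q)
      (coneFrame x₀ q u)) (coneTangential ((extChartAt (coneModel d) (slicePoint x₀)).symm q)
      (coneFrame x₀ q v)) : ℝ) = metricForm x₀ q.2 u.2 v.2 := e3.trans e2
  exact congrArg₂ (· + ·) (congrArg₂ (· * ·) (e1 u) (e1 v)) 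
    (congrArg₂ (· * ·) (congrArg (· ^ 2) h1) e4)

end ConeCoordinates

/-! ### The Levi-Civita connection of the cone in coordinates -/

section ConeConnection

open Filter Topology VectorField

variable {d : ℕ} {S : Type*} [TopologicalSpace S] [ChartedSpace (EuclideanSpace ℝ (Fin d)) S]
  [IsManifold (𝓡 d) ∞ S] [RiemannianBundle (fun x : S ↦ TangentSpace (𝓡 d) x)]
  [IsContMDiffRiemannianBundle (𝓡 d) ∞ (EuclideanSpace ℝ (Fin d))
      (fun x : S ↦ TangentSpace (𝓡 d) x)]

lemma hasFDerivAt_coneForm {x₀ : S} {q : ℝ × EuclideanSpace ℝ (Fin d)}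
    (hq : q.2 ∈ (extChartAt (𝓡 d) x₀).target) (u v z : ℝ × EuclideanSpace ℝ (Fin d)) :
    fderiv ℝ (fun q ↦ coneForm x₀ q u v) q z =
      2 * q.1 * z.1 * metricForm x₀ q.2 u.2 v.2 +
        q.1 ^ 2 * fderiv ℝ (metricForm x₀) q.2 z.2 u.2 v.2 := by
  have hG := ((contDiffAt_metricForm hq).differentiableAt (by simp)).hasFDerivAt
  have h1 : HasFDerivAt (fun q : ℝ × EuclideanSpace ℝ (Fin d) ↦ metricForm x₀ q.2) _ q :=
    HasFDerivAt.comp (g := metricForm x₀) q hG hasFDerivAt_snd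
  have h2 := (h1.clm_apply (hasFDerivAt_const u.2 q)).clm_apply (hasFDerivAt_const v.2 q)
  have h3 : HasFDerivAt (fun q : ℝ × EuclideanSpace ℝ (Fin d) ↦ q.1 ^ 2) _ q :=
    (hasFDerivAt_fst (𝕜 := ℝ) (p := q)).pow 2
  have h4 := (h3.mul h2).const_add (u.1 * v.1)
  have h5 : HasFDerivAt (fun q ↦ coneForm x₀ q u v) _ q := h4
  rw [h5.fderiv]
  simp
  ring

lemma contDiffAt_coneForm {x₀ : S} {q : ℝ × EuclideanSpace ℝ (Fin d)}
    (hq : q.2 ∈ (extChartAt (𝓡 d) x₀).target)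
    {a b : ℝ × EuclideanSpace ℝ (Fin d) → ℝ × EuclideanSpace ℝ (Fin d)}
    (ha : ContDiffAt ℝ 1 a q) (hb : ContDiffAt ℝ 1 b q) :
    ContDiffAt ℝ 1 (fun q ↦ coneForm x₀ q (a q) (b q)) q := by
  have hG : ContDiffAt ℝ 1 (fun q : ℝ × EuclideanSpace ℝ (Fin d) ↦ metricForm x₀ q.2) q :=
    ContDiffAt.comp (g := metricForm x₀) q ((contDiffAt_metricForm hq).of_le (by norm_cast))
      contDiffAt_snd
  exact (ha.fst.mul hb.fst).add ((contDiffAt_fst.pow 2).mul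
    ((hG.clm_apply ha.snd).clm_apply hb.snd))

lemma coneMetric_of_hasChartRep {x₀ : S} {A B : ∀ c : Cone S, TangentSpace (coneModel d) c}
    {a b : ℝ × EuclideanSpace ℝ (Fin d) → ℝ × EuclideanSpace ℝ (Fin d)}
    (hA : HasChartRep (coneModel d) (slicePoint x₀) A a)
    (hB : HasChartRep (coneModel d) (slicePoint x₀) B b) {q : ℝ × EuclideanSpace ℝ (Fin d)}
    (hq : q ∈ (extChartAt (coneModel d) (slicePoint x₀)).target) :
    coneMetric (d := d) ((extChartAt (coneModel d) (slicePoint x₀)).symm q) (A _) (B _) =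
      coneForm x₀ q (a q) (b q) :=
  (congrArg₂ (fun u v : TangentSpace (coneModel d)
    ((extChartAt (coneModel d) (slicePoint x₀)).symm q) ↦ coneMetric (d := d) _ u v)
      (hA q hq) (hB q hq)).trans (coneMetric_coneFrame hq _ _)

/-- The components of `D_u A` in the chart of the cone around `(1, x₀)`. -/
def coneNabla (D : CovariantDerivative (coneModel d) (ℝ × EuclideanSpace ℝ (Fin d))
      (TangentSpace (coneModel d) : Cone S → Type _)) (x₀ : S) (q : ℝ × EuclideanSpace ℝ (Fin d))
    (A : ∀ c : Cone S, TangentSpace (coneModel d) c) (u : ℝ × EuclideanSpace ℝ (Fin d)) :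
    ℝ × EuclideanSpace ℝ (Fin d) :=
  (coneFrame x₀ q).inverse
    (D A ((extChartAt (coneModel d) (slicePoint x₀)).symm q) (coneFrame x₀ q u))

variable {D : CovariantDerivative (coneModel d) (ℝ × EuclideanSpace ℝ (Fin d))
      (TangentSpace (coneModel d) : Cone S → Type _)} {x₀ : S}
  {q : ℝ × EuclideanSpace ℝ (Fin d)} (hq : q ∈ (extChartAt (coneModel d) (slicePoint x₀)).target)
include hq

lemma isInvertible_coneFrame : (coneFrame x₀ q).IsInvertible :=
  isInvertible_mfderiv_extChartAt_symm' hq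

lemma coneFrame_coneNabla (A : ∀ c : Cone S, TangentSpace (coneModel d) c)
    (u : ℝ × EuclideanSpace ℝ (Fin d)) :
    coneFrame x₀ q (coneNabla D x₀ q A u) =
      D A ((extChartAt (coneModel d) (slicePoint x₀)).symm q) (coneFrame x₀ q u) :=
  (isInvertible_coneFrame hq).self_apply_inverse _

variable (hD : IsLeviCivita (coneModel d) coneMetric D)
  {A B : ∀ c : Cone S, TangentSpace (coneModel d) c}
  {a b : ℝ × EuclideanSpace ℝ (Fin d) → ℝ × EuclideanSpace ℝ (Fin d)}
  (hA : HasChartRep (coneModel d) (slicePoint x₀) A a)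
  (hB : HasChartRep (coneModel d) (slicePoint x₀) B b)
  (ha : ContDiffAt ℝ 1 a q) (hb : ContDiffAt ℝ 1 b q)
include hD hA hB ha hb

/-- The vanishing of the torsion, in components. -/
lemma coneNabla_sub : coneNabla D x₀ q B (a q) - coneNabla D x₀ q A (b q) =
    fderiv ℝ b q (a q) - fderiv ℝ a q (b q) := by
  have h1 := CovariantDerivative.torsion_eq_zero_iff (cov := D) |>.1 hD.1
    ((hA.contMDiffAt (n := 1) hq ha).mdifferentiableAt (by simp))
    ((hB.contMDiffAt (n := 1) hq hb).mdifferentiableAt (by simp))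
  have h2 := HasChartRep.mlieBracket_eq hA hB hq ha hb
  have h3 : (D B ((extChartAt (coneModel d) (slicePoint x₀)).symm q) (coneFrame x₀ q (a q)) :
      ℝ × EuclideanSpace ℝ (Fin d)) -
      D A ((extChartAt (coneModel d) (slicePoint x₀)).symm q) (coneFrame x₀ q (b q)) =
      coneFrame x₀ q (fderiv ℝ b q (a q) - fderiv ℝ a q (b q)) := by
    refine Eq.trans ?_ (h1.trans h2)
    exact congrArg₂ (fun u v : TangentSpace (coneModel d)
      ((extChartAt (coneModel d) (slicePoint x₀)).symm q) ↦
        (D B _ u - D A _ v : ℝ × EuclideanSpace ℝ (Fin d))) (hA q hq).symm (hB q hq).symm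
  have h4 := congrArg (coneFrame x₀ q).inverse h3
  exact (map_sub (coneFrame x₀ q).inverse _ _).symm.trans
    (h4.trans ((isInvertible_coneFrame hq).inverse_apply_self _))

/-- The compatibility of the connection with the cone metric, in components. -/
lemma fderiv_coneForm_eq (u : ℝ × EuclideanSpace ℝ (Fin d)) :
    fderiv ℝ (fun q ↦ coneForm x₀ q (a q) (b q)) q u =
      coneForm x₀ q (coneNabla D x₀ q A u) (b q) + coneForm x₀ q (a q) (coneNabla D x₀ q B u) := by
  set c := (extChartAt (coneModel d) (slicePoint x₀)).symm q with hc
  let h : ℝ × EuclideanSpace ℝ (Fin d) → ℝ := fun q ↦ coneForm x₀ q (a q) (b q)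
  let k : Cone S → ℝ := fun y ↦ coneMetric (d := d) y (A y) (B y)
  have hn := (isOpen_extChartAt_target (I := coneModel d) (slicePoint x₀)).mem_nhds hq
  have hsrc := (extChartAt (coneModel d) (slicePoint x₀)).map_target hq
  have hmap : extChartAt (coneModel d) (slicePoint x₀) c = q :=
    (extChartAt (coneModel d) (slicePoint x₀)).right_inv hq
  have hcd : ContDiffAt ℝ 1 h q := contDiffAt_coneForm (extChartAt_cone_symm hq).2.2 ha hb
  have hhk : h =ᶠ[𝓝 q] k ∘ (extChartAt (coneModel d) (slicePoint x₀)).symm := by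
    filter_upwards [hn] with q' hq' using (coneMetric_of_hasChartRep hA hB hq').symm
  have hkd : MDifferentiableAt (coneModel d) 𝓘(ℝ, ℝ) k c := by
    have h1 : MDifferentiableAt (coneModel d) 𝓘(ℝ, ℝ)
        (h ∘ extChartAt (coneModel d) (slicePoint x₀)) c := by
      refine MDifferentiableAt.comp c (I' := 𝓘(ℝ, ℝ × EuclideanSpace ℝ (Fin d))) ?_
        (mdifferentiableAt_extChartAt (by rwa [extChartAt_source] at hsrc))
      rw [hmap]
      exact (hcd.differentiableAt (by simp)).mdifferentiableAt
    refine h1.congr_of_eventuallyEq ?_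
    filter_upwards [(isOpen_extChartAt_source (I := coneModel d) (slicePoint x₀)).mem_nhds hsrc]
      with y hy
    have h2 := coneMetric_of_hasChartRep hA hB
      ((extChartAt (coneModel d) (slicePoint x₀)).map_source hy)
    rw [(extChartAt (coneModel d) (slicePoint x₀)).left_inv hy] at h2
    exact h2
  have h1 := mfderiv_comp (I := 𝓘(ℝ, ℝ × EuclideanSpace ℝ (Fin d))) q hkd
    ((contMDiffAt_extChartAt_symm hq).mdifferentiableAt (by simp))
  rw [← hhk.mfderiv_eq, mfderiv_eq_fderiv] at h1
  have h2 := congrArg (fun L : ℝ × EuclideanSpace ℝ (Fin d) →L[ℝ] ℝ ↦ L u) h1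
  have h3 := hD.2 A B c
    ((hA.contMDiffAt (n := 1) hq ha).mdifferentiableAt (by simp))
    ((hB.contMDiffAt (n := 1) hq hb).mdifferentiableAt (by simp)) (coneFrame x₀ q u)
  refine h2.trans (h3.trans ?_)
  rw [← coneMetric_coneFrame hq, ← coneMetric_coneFrame hq, coneFrame_coneNabla hq,
    coneFrame_coneNabla hq]
  exact congrArg₂ (· + ·)
    (congrArg (fun v : TangentSpace (coneModel d) c ↦ coneMetric (d := d) c
      (D A c (coneFrame x₀ q u)) v) (hB q hq))
    (congrArg (fun v : TangentSpace (coneModel d) c ↦ coneMetric (d := d) c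
      v (D B c (coneFrame x₀ q u))) (hA q hq))

end ConeConnection

/-! ### The Reeb field is a Killing field -/

section Killing

open Filter Topology VectorField

variable {d : ℕ} {S : Type*} [TopologicalSpace S] [ChartedSpace (EuclideanSpace ℝ (Fin d)) S]
  [IsManifold (𝓡 d) ∞ S] [RiemannianBundle (fun x : S ↦ TangentSpace (𝓡 d) x)]
  [IsContMDiffRiemannianBundle (𝓡 d) ∞ (EuclideanSpace ℝ (Fin d))
      (fun x : S ↦ TangentSpace (𝓡 d) x)]
  {J : ∀ c : Cone S, TangentSpace (coneModel d) c →L[ℝ] TangentSpace (coneModel d) c}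

/-- The components of `J (r ∂_r)` in the chart of the cone around `(1, x₀)`. -/
def coneReebRep (J : ∀ c : Cone S, TangentSpace (coneModel d) c →L[ℝ] TangentSpace (coneModel d) c)
    (x₀ : S) : ℝ × EuclideanSpace ℝ (Fin d) → ℝ × EuclideanSpace ℝ (Fin d) :=
  mpullback 𝓘(ℝ, ℝ × EuclideanSpace ℝ (Fin d)) (coneModel d)
    (extChartAt (coneModel d) (slicePoint x₀)).symm (fun c ↦ J c (eulerField c))

/-- The components of `J (r ∂_r)` along the slice `{r = 1}` in the chart of `S` around `x₀`. -/
def reebRep (J : ∀ c : Cone S, TangentSpace (coneModel d) c →L[ℝ] TangentSpace (coneModel d) c)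
    (x₀ : S) (e : EuclideanSpace ℝ (Fin d)) : EuclideanSpace ℝ (Fin d) :=
  (coneReebRep J x₀ (1, e)).2

lemma hasChartRep_coneReebRep (x₀ : S) :
    HasChartRep (coneModel d) (slicePoint x₀) (fun c ↦ J c (eulerField c)) (coneReebRep J x₀) :=
  hasChartRep_mpullback _ _

lemma coneForm_comm (x₀ : S) (q u v : ℝ × EuclideanSpace ℝ (Fin d)) :
    coneForm x₀ q u v = coneForm x₀ q v u := by
  rw [coneForm, coneForm, metricForm_symm, mul_comm u.1]

lemma coneForm_add_left (x₀ : S) (q u u' v : ℝ × EuclideanSpace ℝ (Fin d)) :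
    coneForm x₀ q (u + u') v = coneForm x₀ q u v + coneForm x₀ q u' v := by
  simp only [coneForm, Prod.fst_add, Prod.snd_add, map_add, add_apply]
  ring

lemma coneForm_neg_right (x₀ : S) (q u v : ℝ × EuclideanSpace ℝ (Fin d)) :
    coneForm x₀ q u (-v) = -coneForm x₀ q u v := by
  simp only [coneForm, Prod.fst_neg, Prod.snd_neg, map_neg]
  ring

variable (hJ : IsKahler (coneModel d) coneMetric J)
include hJ

lemma contDiffAt_coneReebRep {x₀ : S} {q : ℝ × EuclideanSpace ℝ (Fin d)}
    (hq : q ∈ (extChartAt (coneModel d) (slicePoint x₀)).target) :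
    ContDiffAt ℝ ∞ (coneReebRep J x₀) q := by
  refine (hasChartRep_coneReebRep x₀).contDiffAt hq (n := ⊤) ?_
  have h1 : ContMDiffAt (coneModel d) (coneModel d).tangent ∞
      (fun c ↦ (⟨c, eulerField c⟩ : TangentBundle (coneModel d) (Cone S)))
      ((extChartAt (coneModel d) (slicePoint x₀)).symm q) :=
    (hasChartRep_eulerField x₀).contMDiffAt hq (n := ⊤) (contDiffAt_fst.prodMk contDiffAt_const)
  exact ContMDiffAt.clm_bundle_apply (hJ.smooth _) h1

lemma contDiffAt_reebRep {x₀ : S} {e : EuclideanSpace ℝ (Fin d)}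
    (he : e ∈ (extChartAt (𝓡 d) x₀).target) : ContDiffAt ℝ ∞ (reebRep J x₀) e := by
  have h1 := contDiffAt_coneReebRep hJ (mem_extChartAt_cone_target one_pos he)
  exact (ContDiffAt.comp (g := coneReebRep J x₀) e h1
    (contDiffAt_const.prodMk contDiffAt_id)).snd

omit hJ in
lemma coneTangential_eq_reebRep {x₀ : S} {e : EuclideanSpace ℝ (Fin d)}
    (he : e ∈ (extChartAt (𝓡 d) x₀).target) :
    (coneTangential (slicePoint ((extChartAt (𝓡 d) x₀).symm e))
      (J (slicePoint ((extChartAt (𝓡 d) x₀).symm e))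
        (eulerField (slicePoint ((extChartAt (𝓡 d) x₀).symm e)))) :
          EuclideanSpace ℝ (Fin d)) = chartFrame x₀ e (reebRep J x₀ e) := by
  have hq := mem_extChartAt_cone_target one_pos he
  obtain ⟨h1, h2, -⟩ := extChartAt_cone_symm hq
  have h3 : (extChartAt (coneModel d) (slicePoint x₀)).symm (1, e) =
      slicePoint ((extChartAt (𝓡 d) x₀).symm e) := Prod.ext (Subtype.ext h1) h2
  have h4 := hasChartRep_coneReebRep (J := J) x₀ (1, e) hq
  have h5 := congrArg Prod.snd (h4.trans (coneFrame_apply hq (coneReebRep J x₀ (1, e))))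
  refine (coneTangential_apply _ _).trans (Eq.trans ?_ h5)
  rw [h3]

/-- The Killing equation for the Reeb field. -/
lemma fderiv_metricForm_reebRep {x₀ : S} {e : EuclideanSpace ℝ (Fin d)}
    (he : e ∈ (extChartAt (𝓡 d) x₀).target) (w : EuclideanSpace ℝ (Fin d)) :
    fderiv ℝ (metricForm x₀) e (reebRep J x₀ e) w w +
      2 * metricForm x₀ e (fderiv ℝ (reebRep J x₀) e w) w = 0 := by
  obtain ⟨D, hD, hpar⟩ := hJ.parallel
  set q : ℝ × EuclideanSpace ℝ (Fin d) := (1, e) with hqdef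
  have hq : q ∈ (extChartAt (coneModel d) (slicePoint x₀)).target :=
    mem_extChartAt_cone_target one_pos he
  have hL := isInvertible_coneFrame hq
  set c := (extChartAt (coneModel d) (slicePoint x₀)).symm q
  set X := coneReebRep J x₀ q
  have hXd : ContDiffAt ℝ 1 (coneReebRep J x₀) q :=
    (contDiffAt_coneReebRep hJ hq).of_le (by norm_cast)
  have hEd : ContDiffAt ℝ 1
      (fun q : ℝ × EuclideanSpace ℝ (Fin d) ↦ (q.1, (0 : EuclideanSpace ℝ (Fin d)))) q :=
    contDiffAt_fst.prodMk contDiffAt_const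
  have hE := hasChartRep_eulerField (d := d) x₀
  have hV := hasChartRep_coneReebRep (J := J) x₀
  have hW := hasChartRep_coordField (I := coneModel d) (slicePoint x₀)
  have hWd : ∀ u : ℝ × EuclideanSpace ℝ (Fin d), ContDiffAt ℝ 1
    (fun _ : ℝ × EuclideanSpace ℝ (Fin d) ↦ u) q := fun u ↦ contDiffAt_const
  -- With `W_u` the coordinate field of constant components `u`, `E` the Euler field and `V = JE`:
  -- `nW u v` is `∇_v W_u`, while `nE u` and `nV u` are `∇_u E` and `∇_u V`. The facts named `t..`
  -- express the vanishing torsion of a pair of fields, those named `m..` metric compatibility.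
  let nW := fun u v : ℝ × EuclideanSpace ℝ (Fin d) ↦
    coneNabla D x₀ q (coordField (coneModel d) (slicePoint x₀) u) v
  let nE := coneNabla D x₀ q (eulerField (d := d))
  let nV := coneNabla D x₀ q (fun c ↦ J c (eulerField c))
  have hdE : ∀ u, fderiv ℝ (fun q : ℝ × EuclideanSpace ℝ (Fin d) ↦
      (q.1, (0 : EuclideanSpace ℝ (Fin d)))) q u = (u.1, 0) := fun u ↦ by
    have : HasFDerivAt (fun q : ℝ × EuclideanSpace ℝ (Fin d) ↦
      (q.1, (0 : EuclideanSpace ℝ (Fin d)))) _ q :=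
      (hasFDerivAt_fst (𝕜 := ℝ) (p := q)).prodMk (hasFDerivAt_const _ q)
    rw [this.fderiv]
    rfl
  have tWW : ∀ u v, nW v u = nW u v := fun u v ↦ by
    have := coneNabla_sub hq hD (hW u) (hW v) (hWd u) (hWd v)
    simp only [fderiv_fun_const, Pi.zero_apply, zero_apply, sub_zero, sub_eq_zero] at this
    exact this
  have tEW : ∀ u, nW u (1, 0) = nE u + -(u.1, 0) := fun u ↦ by
    have := coneNabla_sub hq hD hE (hW u) hEd (hWd u)
    simp only [fderiv_fun_const, Pi.zero_apply, zero_apply, zero_sub, hdE] at this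
    rw [← this]
    exact (add_sub_cancel _ _).symm
  have tVW : ∀ u, nW u X = nV u + -fderiv ℝ (coneReebRep J x₀) q u := fun u ↦ by
    have := coneNabla_sub hq hD hV (hW u) hXd (hWd u)
    simp only [fderiv_fun_const, Pi.zero_apply, zero_apply, zero_sub] at this
    rw [← this]
    exact (add_sub_cancel _ _).symm
  have mWW : ∀ u v z, 2 * z.1 * metricForm x₀ e u.2 v.2 +
      fderiv ℝ (metricForm x₀) e z.2 u.2 v.2 =
      coneForm x₀ q (nW u z) v + coneForm x₀ q u (nW v z) := fun u v z ↦ by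
    have h1 := fderiv_coneForm_eq hq hD (hW u) (hW v) (hWd u) (hWd v) z
    rw [hasFDerivAt_coneForm he] at h1
    rw [← h1]
    simp [hqdef]
  have mEW : ∀ z w, w.1 * z.1 = coneForm x₀ q (nE w) z + coneForm x₀ q (1, 0) (nW z w) :=
    fun z w ↦ by
      have h1 := fderiv_coneForm_eq hq hD hE (hW z) hEd (hWd z) w
      have h2 : (fun q : ℝ × EuclideanSpace ℝ (Fin d) ↦
          coneForm x₀ q (q.1, 0) z) = fun q ↦ q.1 * z.1 := by
        ext q'
        simp [coneForm]
      have h3 : HasFDerivAt (fun q : ℝ × EuclideanSpace ℝ (Fin d) ↦ q.1 * z.1) _ q :=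
        (hasFDerivAt_fst (𝕜 := ℝ) (p := q)).mul_const z.1
      rw [h2, h3.fderiv] at h1
      simp only [smul_apply, ContinuousLinearMap.coe_fst', smul_eq_mul] at h1
      rw [mul_comm]
      exact h1
  -- `∇_u E = u`: `mEW` and the symmetry `tWW` make `⟨∇_u E, z⟩` symmetric in `u` and `z`, and the
  -- radial derivative of the cone metric determines the symmetric part.
  have key : ∀ u z, coneForm x₀ q (nE u) z = coneForm x₀ q u z := by
    intro u z
    have h1 := mWW u z (1, 0)
    have h2 := mEW z u
    have h3 := mEW u z
    rw [tEW u, tEW z, coneForm_comm x₀ q u, coneForm_add_left, coneForm_add_left] at h1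
    rw [tWW u z] at h2
    simp only [map_zero, zero_apply, mul_one, add_zero] at h1
    have h4 : ∀ u v : ℝ × EuclideanSpace ℝ (Fin d),
        coneForm x₀ q (-(u.1, (0 : EuclideanSpace ℝ (Fin d)))) v = -(u.1 * v.1) := by
      intro u v; simp [coneForm]
    rw [h4, h4] at h1
    have h5 : coneForm x₀ q u z = u.1 * z.1 + metricForm x₀ e u.2 z.2 := by
      simp [coneForm, hqdef]
    linarith
  -- `J` in components. Being orthogonal with square `-1`, it is skew.
  let j : ℝ × EuclideanSpace ℝ (Fin d) → ℝ × EuclideanSpace ℝ (Fin d) := fun u ↦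
    (coneFrame x₀ q).inverse (J c (coneFrame x₀ q u))
  have hLj : ∀ u, coneFrame x₀ q (j u) = J c (coneFrame x₀ q u) := fun u ↦
    hL.self_apply_inverse _
  have hjj : ∀ u v, coneForm x₀ q (j u) (j v) = coneForm x₀ q u v := by
    intro u v
    rw [← coneMetric_coneFrame hq, ← coneMetric_coneFrame hq, hLj, hLj]
    exact hJ.hermitian c _ _
  have hj2 : ∀ u, j (j u) = -u := by
    intro u
    have h1 : coneFrame x₀ q (j (j u)) = coneFrame x₀ q (-u) := by
      rw [hLj, hLj, map_neg]
      exact hJ.sq c _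
    exact hL.injective h1
  have hskew : ∀ u v, coneForm x₀ q (j u) v = -coneForm x₀ q u (j v) := fun u v ↦ by
    have h := hjj (j u) v
    rw [hj2] at h
    rw [← h, coneForm_comm, coneForm_neg_right, coneForm_comm]
  have hpV : ∀ u, nV u = j (nE u) := fun u ↦ by
    have h1 := hpar (eulerField (d := d)) c
      ((hE.contMDiffAt (n := 1) hq hEd).mdifferentiableAt (by simp)) (coneFrame x₀ q u)
    have h2 := coneFrame_coneNabla (D := D) hq (eulerField (d := d)) u
    have h3 : (J c (coneFrame x₀ q (nE u)) : ℝ × EuclideanSpace ℝ (Fin d)) =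
      J c (D (eulerField (d := d)) c (coneFrame x₀ q u)) :=
      congrArg (fun v : TangentSpace (coneModel d) c ↦ J c v) h2
    exact congrArg (coneFrame x₀ q).inverse (h1.trans h3.symm)
  have hXE : X = j (1, 0) := by
    have h1 : (J c (eulerField c) : ℝ × EuclideanSpace ℝ (Fin d)) = J c (coneFrame x₀ q (1, 0)) :=
      congrArg (fun v : TangentSpace (coneModel d) c ↦ J c v) (hE q hq)
    exact congrArg (coneFrame x₀ q).inverse h1
  have hself : ∀ u, coneForm x₀ q (j u) u = 0 := fun u ↦ by
    have := hskew u u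
    rw [coneForm_comm x₀ q u] at this
    linarith
  -- `JE` is orthogonal to `E`, so it is tangent to the slices of constant `r`.
  have hX1 : X.1 = 0 := by
    have h1 := hself (1, 0)
    rw [← hXE] at h1
    simpa [coneForm] using h1
  -- `⟨∇_w V, w⟩ = ⟨J ∇_w E, w⟩ = ⟨Jw, w⟩ = 0`: the Killing equation in invariant form.
  have h0 : coneForm x₀ q (nV (0, w)) (0, w) = 0 := by
    rw [hpV, hskew, key, ← hskew, hself]
  have hder : fderiv ℝ (reebRep J x₀) e w = (fderiv ℝ (coneReebRep J x₀) q (0, w)).2 := by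
    have h1 : HasFDerivAt (𝕜 := ℝ) (fun e : EuclideanSpace ℝ (Fin d) ↦ ((1 : ℝ), e)) _ e :=
      (hasFDerivAt_const (𝕜 := ℝ) (1 : ℝ) e).prodMk (hasFDerivAt_id e)
    have h2 : HasFDerivAt (𝕜 := ℝ) (coneReebRep J x₀) _ (1, e) :=
      (hXd.differentiableAt (by simp)).hasFDerivAt
    have h3 : HasFDerivAt (𝕜 := ℝ) (reebRep J x₀) _ e := (h2.comp e h1).snd
    rw [h3.fderiv]
    rfl
  -- Differentiate `g(w, w)` along `X` with `w` constant. The radial term drops out since `X.1 = 0`,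
  -- and the torsion identity replaces `∇_X W_w` by `∇_w V - ∂_w X`.
  have h1 := mWW (0, w) (0, w) X
  rw [coneForm_comm x₀ q (0, w), tVW, coneForm_add_left, h0, hX1] at h1
  have h2 : coneForm x₀ q (-fderiv ℝ (coneReebRep J x₀) q (0, w)) (0, w) =
      -metricForm x₀ e (fderiv ℝ (coneReebRep J x₀) q (0, w)).2 w := by
    simp [coneForm, hqdef]
  rw [h2] at h1
  rw [hder]
  have h3 : fderiv ℝ (metricForm x₀) e (reebRep J x₀ e) w w =
    fderiv ℝ (metricForm x₀) e X.2 w w := rfl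
  rw [h3]
  simp only [mul_zero, zero_mul, zero_add] at h1
  linarith

end Killing

/-! ### The metric under one Euler step of a Killing field -/

section PushedForm

open Filter Topology

variable {E : Type*} [NormedAddCommGroup E] [NormedSpace ℝ E]

/-- The minimum of `G e₀` on the compact unit sphere is a positive constant, half of which survives
a small change of the form. -/
lemma exists_coercive_of_form_pos [FiniteDimensional ℝ E] {G : E → E →L[ℝ] E →L[ℝ] ℝ} {e₀ : E}
    (hG : ContinuousAt G e₀) (hpos : ∀ w, w ≠ 0 → 0 < G e₀ w w) :
    ∃ m > 0, ∀ᶠ e in 𝓝 e₀, ∀ w, m * ‖w‖ ^ 2 ≤ G e w w := by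
  obtain ⟨m, hm, hmw⟩ : ∃ m > 0, ∀ w, m * ‖w‖ ^ 2 ≤ G e₀ w w := by
    rcases subsingleton_or_nontrivial E with hE | hE
    · exact ⟨1, one_pos, fun w ↦ by rw [Subsingleton.elim w 0]; simp⟩
    · obtain ⟨w₀, hw₀, hmin⟩ := (isCompact_sphere (0 : E) 1).exists_isMinOn
        (NormedSpace.sphere_nonempty.2 zero_le_one) (f := fun w ↦ G e₀ w w)
        (by fun_prop)
      have hw₀' : w₀ ≠ 0 := by
        rintro rfl
        simp at hw₀
      refine ⟨G e₀ w₀ w₀, hpos _ hw₀', fun w ↦ ?_⟩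
      rcases eq_or_ne w 0 with rfl | hw
      · simp
      have hn : 0 < ‖w‖ := norm_pos_iff.2 hw
      have h1 : ‖w‖⁻¹ • w ∈ Metric.sphere (0 : E) 1 := by
        rw [mem_sphere_zero_iff_norm, norm_smul, norm_inv, norm_norm, inv_mul_cancel₀ hn.ne']
      have h2 : G e₀ w₀ w₀ ≤ G e₀ (‖w‖⁻¹ • w) (‖w‖⁻¹ • w) := hmin h1
      simp only [map_smul, smul_apply, smul_eq_mul] at h2
      calc G e₀ w₀ w₀ * ‖w‖ ^ 2 ≤ ‖w‖⁻¹ * (‖w‖⁻¹ * G e₀ w w) * ‖w‖ ^ 2 := by gcongr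
        _ = G e₀ w w := by field_simp
  refine ⟨m / 2, half_pos hm, ?_⟩
  filter_upwards [Metric.continuousAt_iff'.1 hG (m / 2) (half_pos hm)] with e he w
  rw [dist_eq_norm] at he
  have h1 : ‖(G e - G e₀) w w‖ ≤ m / 2 * ‖w‖ ^ 2 := by
    refine ((G e - G e₀).le_opNorm₂ w w).trans ?_
    rw [mul_assoc, ← sq]
    gcongr
  have h2 := (abs_le.1 (Real.norm_eq_abs _ ▸ h1)).1
  simp only [sub_apply] at h2
  linarith [hmw w]

/-- Along a Killing field, the first order push-forward changes the metric only to second order. -/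
lemma exists_pushed_form_le [FiniteDimensional ℝ E] {T : Set E} (hT : IsOpen T)
    {G : E → E →L[ℝ] E →L[ℝ] ℝ} {X : E → E} (hG : ∀ e ∈ T, ContDiffAt ℝ ∞ G e)
    (hX : ∀ e ∈ T, ContDiffAt ℝ ∞ X e) (hsymm : ∀ e v w, G e v w = G e w v)
    (hpos : ∀ e ∈ T, ∀ w, w ≠ 0 → 0 < G e w w)
    (hkill : ∀ e ∈ T, ∀ w, fderiv ℝ G e (X e) w w + 2 * G e (fderiv ℝ X e w) w = 0)
    {e₀ : E} (he₀ : e₀ ∈ T) :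
    ∃ ρ > 0, ∃ s₀ > 0, ∃ C ≥ 0, ∀ e ∈ Metric.ball e₀ ρ, ∀ s ∈ Icc (0 : ℝ) s₀,
      e + s • X e ∈ T ∧ ∀ w, G (e + s • X e) (w + s • fderiv ℝ X e w) (w + s • fderiv ℝ X e w) ≤
        (1 + C * s ^ 2) * G e w w := by
  let A : ℝ × E → E →L[ℝ] E := fun p ↦ ContinuousLinearMap.id ℝ E + p.1 • fderiv ℝ X p.2
  let Y : ℝ × E → E := fun p ↦ p.2 + p.1 • X p.2
  -- `Q (s, e)` is the pullback of `G` under the Euler step `e ↦ e + s X(e)`, whose differential is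
  -- `A`.
  let Q : ℝ × E → E →L[ℝ] E →L[ℝ] ℝ := fun p ↦
    ((ContinuousLinearMap.compL ℝ E E ℝ).flip (A p)).comp ((G (Y p)).comp (A p))
  have hQ : ∀ p v w, Q p v w = G (Y p) (A p v) (A p w) := fun p v w ↦ rfl
  have hY0 : ∀ e, Y (0, e) = e := fun e ↦ by simp [Y]
  have hYc : ∀ p : ℝ × E, p.2 ∈ T → ContDiffAt ℝ ∞ Y p := fun p hp ↦
    contDiffAt_snd.add (contDiffAt_fst.smul (ContDiffAt.comp p (hX _ hp) contDiffAt_snd))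
  have hAc : ∀ p : ℝ × E, p.2 ∈ T → ContDiffAt ℝ ∞ A p := fun p hp ↦
    contDiffAt_const.add (contDiffAt_fst.smul (ContDiffAt.comp (g := fderiv ℝ X) p
      ((hX _ hp).fderiv_right (m := ∞) (by simp)) contDiffAt_snd))
  have hQc : ∀ p : ℝ × E, p.2 ∈ T → Y p ∈ T → ContDiffAt ℝ ∞ Q p := fun p hp hp' ↦
    (((ContinuousLinearMap.compL ℝ E E ℝ).flip).contDiff.contDiffAt.comp p (hAc p hp)).clm_comp
      ((ContDiffAt.comp (g := G) p (hG _ hp') (hYc p hp)).clm_comp (hAc p hp))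
  have hline : ∀ (e : E) (s : ℝ), HasDerivAt (fun s : ℝ ↦ (s, e)) (1, 0) s := fun e s ↦
    (hasDerivAt_id s).prodMk (hasDerivAt_const s e)
  let R : ℝ × E → E →L[ℝ] E →L[ℝ] ℝ := fun p ↦ fderiv ℝ Q p (1, 0)
  have hR : ∀ e s, e ∈ T → Y (s, e) ∈ T → ∀ w,
      HasDerivAt (fun s ↦ Q (s, e) w w) (R (s, e) w w) s := by
    intro e s he hs w
    have h1 := ((hQc (s, e) he hs).differentiableAt (by simp)).hasFDerivAt.comp_hasDerivAt s
      (hline e s)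
    exact (h1.clm_apply (hasDerivAt_const s w)).clm_apply (hasDerivAt_const s w) |>.congr_deriv
      (by simp [R])
  -- At `s = 0` the derivative of the pullback is the Lie derivative of `G` along `X`, which is zero
  -- for a Killing field.
  have hR0 : ∀ e ∈ T, ∀ w, R (0, e) w w = 0 := by
    intro e he w
    have hGd := ((hG e he).differentiableAt (by simp)).hasFDerivAt
    have h0 : HasDerivAt (fun s : ℝ ↦ e + s • X e) (X e) 0 := by
      simpa using! ((hasDerivAt_id (0 : ℝ)).smul_const (X e)).const_add e
    have h1 : HasDerivAt (fun s : ℝ ↦ w + s • fderiv ℝ X e w) (fderiv ℝ X e w) 0 := by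
      simpa using! ((hasDerivAt_id (0 : ℝ)).smul_const (fderiv ℝ X e w)).const_add w
    have h2 : HasDerivAt (fun s : ℝ ↦ G (e + s • X e)) (fderiv ℝ G e (X e)) 0 := by
      have hGd' : HasFDerivAt G (fderiv ℝ G e) (e + (0 : ℝ) • X e) := by simpa using hGd
      exact hGd'.comp_hasDerivAt (0 : ℝ) h0
    have h3 := (h2.clm_apply h1).clm_apply h1
    have h4 := hR e 0 he (by rw [hY0]; exact he) w
    have h5 := h4.unique h3
    rw [h5]
    simp only [zero_smul, add_zero, add_apply]
    rw [hsymm e w (fderiv ℝ X e w)]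
    linarith [hkill e he w]
  have hp₀ : Y (0, e₀) ∈ T := by rw [hY0]; exact he₀
  have hRc : ContDiffAt ℝ 1 R (0, e₀) :=
    ((hQc (0, e₀) he₀ hp₀).fderiv_right (m := 1) (by norm_cast)).clm_apply contDiffAt_const
  obtain ⟨K, U, hU, hK⟩ := hRc.exists_lipschitzOnWith
  obtain ⟨m, hm, hcoer⟩ := exists_coercive_of_form_pos (hG e₀ he₀).continuousAt (hpos e₀ he₀)
  have hev : ∀ᶠ p : ℝ × E in 𝓝 (0, e₀), p ∈ U ∧ p.2 ∈ T ∧ Y p ∈ T ∧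
      ∀ w, m * ‖w‖ ^ 2 ≤ G p.2 w w := by
    filter_upwards [hU, continuous_snd.continuousAt.eventually_mem
      (show T ∈ 𝓝 ((0, e₀) : ℝ × E).2 from hT.mem_nhds he₀),
      (hYc (0, e₀) he₀).continuousAt.eventually_mem (hT.mem_nhds hp₀),
      (continuous_snd.continuousAt (x := ((0, e₀) : ℝ × E))).eventually hcoer] with p h1 h2 h3 h4
    exact ⟨h1, h2, h3, h4⟩
  obtain ⟨r, hr, hball⟩ := Metric.eventually_nhds_iff_ball.1 hev
  have hmem : ∀ e ∈ Metric.ball e₀ r, ∀ s ∈ Icc (0 : ℝ) (r / 2),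
      ((s, e) : ℝ × E) ∈ Metric.ball ((0, e₀) : ℝ × E) r := by
    intro e he s hs
    rw [Metric.mem_ball, Prod.dist_eq]
    refine max_lt ?_ he
    simp only [dist_zero_right, Real.norm_eq_abs, abs_of_nonneg hs.1]
    linarith [hs.2]
  -- The derivative `R` vanishes at `s = 0` and is `K`-Lipschitz, so the pullback changes by at most
  -- `K s² ‖w‖²`; coercivity with constant `m` bounds this by `(K / m) s² G(w, w)`.
  refine ⟨r, hr, r / 2, half_pos hr, K / m, by positivity, fun e he s hs ↦ ?_⟩
  obtain ⟨h1, h2, h3, h4⟩ := hball _ (hmem e he s hs)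
  refine ⟨h3, fun w ↦ ?_⟩
  have hderiv : ∀ τ ∈ Icc (0 : ℝ) s, HasDerivWithinAt (fun s ↦ Q (s, e) w w) (R (τ, e) w w)
      (Icc 0 s) τ := fun τ hτ ↦ by
    obtain ⟨-, h2, h3, -⟩ := hball _ (hmem e he τ ⟨hτ.1, hτ.2.trans hs.2⟩)
    exact (hR e τ h2 h3 w).hasDerivWithinAt
  have hbound : ∀ τ ∈ Icc (0 : ℝ) s, ‖R (τ, e) w w‖ ≤ K * s * ‖w‖ ^ 2 := by
    intro τ hτ
    have hU1 := (hball _ (hmem e he τ ⟨hτ.1, hτ.2.trans hs.2⟩)).1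
    have hU0 := (hball _ (hmem e he 0 ⟨le_rfl, hs.1.trans hs.2⟩)).1
    have h5 := hK.norm_sub_le hU1 hU0
    have h6 : R (τ, e) w w = (R (τ, e) - R (0, e)) w w := by
      simp only [sub_apply, hR0 e h2 w, sub_zero]
    rw [h6]
    refine ((R (τ, e) - R (0, e)).le_opNorm₂ w w).trans ?_
    rw [mul_assoc, ← sq]
    gcongr
    refine h5.trans ?_
    gcongr
    rw [Prod.mk_sub_mk, sub_self, sub_zero, Prod.norm_def, norm_zero]
    refine max_le ?_ hs.1
    rw [Real.norm_eq_abs, abs_of_nonneg hτ.1]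
    exact hτ.2
  have h5 := (convex_Icc (0 : ℝ) s).norm_image_sub_le_of_norm_hasDerivWithin_le hderiv hbound
    (left_mem_Icc.2 hs.1) (right_mem_Icc.2 hs.1)
  have h6 : Q (0, e) w w = G e w w := by rw [hQ, hY0]; simp [A]
  have h7 : Q (s, e) w w = G (e + s • X e) (w + s • fderiv ℝ X e w) (w + s • fderiv ℝ X e w) := rfl
  rw [h6, h7, sub_zero, Real.norm_eq_abs, Real.norm_eq_abs, abs_of_nonneg hs.1] at h5
  have h8 := (abs_le.1 h5).2
  have h9 : K * s * ‖w‖ ^ 2 * s ≤ K / m * s ^ 2 * G e w w := by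
    calc K * s * ‖w‖ ^ 2 * s = K / m * s ^ 2 * (m * ‖w‖ ^ 2) := by field_simp
      _ ≤ _ := by gcongr; exact h4 w
  linarith

end PushedForm

/-! ### Integral curves of smooth fields on a compact manifold -/

section Flow

open Filter Topology

variable {d : ℕ} {M : Type*} [MetricSpace M] [ChartedSpace (EuclideanSpace ℝ (Fin d)) M]
  [RiemannianBundle (fun x : M ↦ TangentSpace (𝓡 d) x)] [IsManifold (𝓡 d) ∞ M]

/-- Solutions of an autonomous equation that start near `e₀` exist, and stay in a given
neighbourhood of `e₀`, for a uniform time. -/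
lemma exists_uniform_time_solution {E : Type*} [NormedAddCommGroup E] [NormedSpace ℝ E]
    [CompleteSpace E] {f : E → E} {e₀ : E} (hf : ContDiffAt ℝ 1 f e₀) {U : Set E} (hU : U ∈ 𝓝 e₀) :
    ∃ ε > 0, ∀ᶠ e in 𝓝 e₀, ∃ α : ℝ → E, α 0 = e ∧
      ∀ t ∈ Ioo (-ε) ε, α t ∈ U ∧ HasDerivAt α (f (α t)) t := by
  obtain ⟨ε, hε, a, r, L, K, hr, hPL⟩ := IsPicardLindelof.of_contDiffAt_one hf
  obtain ⟨α, hα, hαc⟩ :=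
    (hPL 0).exists_forall_mem_closedBall_eq_hasDerivWithinAt_continuousOn
  simp only [zero_sub, zero_add] at hα hαc
  have hnhds : Metric.closedBall e₀ r ×ˢ Icc (-ε) ε ∈ 𝓝 (e₀, (0 : ℝ)) :=
    prod_mem_nhds (Metric.closedBall_mem_nhds _ (NNReal.coe_pos.2 hr))
      (Icc_mem_nhds (neg_lt_zero.2 hε) hε)
  have h0 : α (e₀, 0) = e₀ := (hα e₀ (Metric.mem_closedBall_self r.2)).1
  have hcont : ContinuousAt α (e₀, 0) := (hαc _ (mem_of_mem_nhds hnhds)).continuousAt hnhds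
  have hmem : ∀ᶠ q in 𝓝 (e₀, (0 : ℝ)), α q ∈ U :=
    hcont.eventually_mem (by rw [h0]; exact hU)
  rw [nhds_prod_eq] at hmem
  obtain ⟨p, hp, p', hp', hpp⟩ := eventually_prod_iff.1 hmem
  obtain ⟨ε', hε', hball⟩ := Metric.eventually_nhds_iff_ball.1 hp'
  refine ⟨min ε ε', lt_min hε hε', ?_⟩
  filter_upwards [hp, Metric.closedBall_mem_nhds e₀ (NNReal.coe_pos.2 hr)] with e he her
  refine ⟨fun t ↦ α (e, t), (hα e her).1, fun t ht ↦ ⟨hpp he (hball t ?_), ?_⟩⟩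
  · rw [Metric.mem_ball, dist_zero_right, Real.norm_eq_abs, abs_lt]
    exact ⟨by linarith [ht.1, min_le_right ε ε'], ht.2.trans_le (min_le_right _ _)⟩
  · have h1 : -ε < t := by linarith [ht.1, min_le_left ε ε']
    have h2 : t < ε := ht.2.trans_le (min_le_left _ _)
    exact ((hα e her).2 t ⟨h1.le, h2.le⟩).hasDerivAt (Icc_mem_nhds h1 h2)

/-- The vector field `v` has the smooth components `X x₀` in the chart around `x₀`. -/
structure HasSmoothReps (v : ∀ x : M, TangentSpace (𝓡 d) x)
    (X : M → EuclideanSpace ℝ (Fin d) → EuclideanSpace ℝ (Fin d)) : Prop where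
  rep : ∀ x₀, HasChartRep (𝓡 d) x₀ v (X x₀)
  smooth : ∀ x₀, ∀ e ∈ (extChartAt (𝓡 d) x₀).target, ContDiffAt ℝ ∞ (X x₀) e

namespace HasSmoothReps

variable {v : ∀ x : M, TangentSpace (𝓡 d) x}
  {X : M → EuclideanSpace ℝ (Fin d) → EuclideanSpace ℝ (Fin d)} (h : HasSmoothReps v X)
include h

lemma contMDiff : ContMDiff (𝓡 d) (𝓡 d).tangent 1
    (fun x ↦ (⟨x, v x⟩ : TangentBundle (𝓡 d) M)) := fun x ↦ by
  have hq := mem_extChartAt_target (I := 𝓡 d) x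
  have h1 := (h.rep x).contMDiffAt (n := 1) hq ((h.smooth x _ hq).of_le (by norm_cast))
  rwa [extChartAt_to_inv] at h1

lemma hasMFDerivAt_symm_comp {x₀ : M} {α : ℝ → EuclideanSpace ℝ (Fin d)} {t : ℝ}
    (ht : α t ∈ (extChartAt (𝓡 d) x₀).target) (hα : HasDerivAt α (X x₀ (α t)) t) :
    HasMFDerivAt 𝓘(ℝ, ℝ) (𝓡 d) (fun t ↦ (extChartAt (𝓡 d) x₀).symm (α t)) t
      ((1 : ℝ →L[ℝ] ℝ).smulRight (v ((extChartAt (𝓡 d) x₀).symm (α t)))) := by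
  have h1 := (mdifferentiableAt_extChartAt_symm ht).hasMFDerivAt.comp t hα.hasFDerivAt.hasMFDerivAt
  refine h1.congr_mfderiv (ContinuousLinearMap.ext fun (s : ℝ) ↦ ?_)
  refine ((mfderiv 𝓘(ℝ, EuclideanSpace ℝ (Fin d)) (𝓡 d) (extChartAt (𝓡 d) x₀).symm (α t)).map_smul
    s (X x₀ (α t))).trans ?_
  exact congrArg (fun w : EuclideanSpace ℝ (Fin d) ↦ s • w) (h.rep x₀ _ ht).symm

lemma hasDerivAt_chart {γ : ℝ → M} (hγ : IsMIntegralCurve (I := 𝓡 d) γ v) {x₀ : M} {t : ℝ}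
    (ht : γ t ∈ (extChartAt (𝓡 d) x₀).source) :
    HasDerivAt (fun s ↦ extChartAt (𝓡 d) x₀ (γ s)) (X x₀ (extChartAt (𝓡 d) x₀ (γ t))) t := by
  have hmd : MDifferentiableAt 𝓘(ℝ, ℝ) (𝓡 d) γ t := (hγ t).mdifferentiableAt
  have hu : DifferentiableAt ℝ (fun s ↦ extChartAt (𝓡 d) x₀ (γ s)) t :=
    mdifferentiableAt_iff_differentiableAt.1
      ((mdifferentiableAt_extChartAt (by rwa [extChartAt_source] at ht)).comp t hmd)
  have htar := (extChartAt (𝓡 d) x₀).map_source ht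
  have h1 := mfderiv_eq_chartFrame hmd ht 1
  have h2 : (mfderiv 𝓘(ℝ, ℝ) (𝓡 d) γ t (1 : ℝ) : EuclideanSpace ℝ (Fin d)) = v (γ t) := by
    have h3 := congrArg (fun L : ℝ →L[ℝ] EuclideanSpace ℝ (Fin d) ↦ L 1) (hγ t).mfderiv
    exact h3.trans (one_smul ℝ (v (γ t) : EuclideanSpace ℝ (Fin d)))
  have h3 : (v (γ t) : EuclideanSpace ℝ (Fin d)) =
      chartFrame x₀ (extChartAt (𝓡 d) x₀ (γ t)) (X x₀ (extChartAt (𝓡 d) x₀ (γ t))) := by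
    refine Eq.trans ?_ (h.rep x₀ _ htar)
    rw [(extChartAt (𝓡 d) x₀).left_inv ht]
  have h4 := chartFrame_injective htar (h1.symm.trans (h2.trans h3))
  rw [fderiv_apply_one_eq_deriv] at h4
  rw [← h4]
  exact hu.hasDerivAt

/-- Near each point there is a common existence time for all initial points. Compactness makes it
uniform over the manifold, and a uniform time lets integral curves be continued forever. -/
lemma exists_isMIntegralCurve [CompactSpace M] (x : M) :
    ∃ γ : ℝ → M, γ 0 = x ∧ IsMIntegralCurve (I := 𝓡 d) γ v := by
  obtain ⟨ε, hε, hεx⟩ : ∃ ε > 0, ∀ x ∈ (univ : Set M), ∃ γ : ℝ → M, γ 0 = x ∧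
      IsMIntegralCurveOn (I := 𝓡 d) γ v (Ioo (-ε) ε) := by
    refine isCompact_univ.induction_on (p := fun s : Set M ↦ ∃ ε > 0, ∀ x ∈ s, ∃ γ : ℝ → M,
      γ 0 = x ∧ IsMIntegralCurveOn (I := 𝓡 d) γ v (Ioo (-ε) ε)) ⟨1, one_pos, by simp⟩ ?_ ?_ ?_
    · rintro s s' hss ⟨ε, hε, hx⟩
      exact ⟨ε, hε, fun x hxs ↦ hx x (hss hxs)⟩
    · rintro s s' ⟨ε, hε, hx⟩ ⟨ε', hε', hx'⟩
      refine ⟨min ε ε', lt_min hε hε', fun x hxs ↦ ?_⟩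
      rcases hxs with hxs | hxs
      · obtain ⟨γ, h0, hγ⟩ := hx x hxs
        exact ⟨γ, h0, hγ.mono (Ioo_subset_Ioo (neg_le_neg (min_le_left _ _)) (min_le_left _ _))⟩
      · obtain ⟨γ, h0, hγ⟩ := hx' x hxs
        exact ⟨γ, h0, hγ.mono (Ioo_subset_Ioo (neg_le_neg (min_le_right _ _)) (min_le_right _ _))⟩
    · intro x₀ _
      have hq := mem_extChartAt_target (I := 𝓡 d) x₀
      obtain ⟨ε, hε, hev⟩ := exists_uniform_time_solution
        ((h.smooth x₀ _ hq).of_le (show (1 : WithTop ℕ∞) ≤ (⊤ : ℕ∞) by norm_cast))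
        ((isOpen_extChartAt_target x₀).mem_nhds hq)
      refine ⟨_, mem_nhdsWithin_of_mem_nhds (inter_mem
        ((continuousAt_extChartAt (I := 𝓡 d) x₀).eventually hev)
        (extChartAt_source_mem_nhds (I := 𝓡 d) x₀)), ε, hε, ?_⟩
      rintro x ⟨⟨α, h0, hα⟩, hx⟩
      refine ⟨fun t ↦ (extChartAt (𝓡 d) x₀).symm (α t), ?_, fun t ht ↦ ?_⟩
      · exact (congrArg (extChartAt (𝓡 d) x₀).symm h0).trans ((extChartAt (𝓡 d) x₀).left_inv hx)
      · exact (h.hasMFDerivAt_symm_comp (hα t ht).1 (hα t ht).2).hasMFDerivWithinAt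
  exact exists_isMIntegralCurve_of_isMIntegralCurveOn h.contMDiff hε (fun x ↦ hεx x (mem_univ x)) x

lemma neg : HasSmoothReps (-v) (fun x₀ e ↦ -X x₀ e) where
  rep x₀ q hq := (congrArg (fun w : EuclideanSpace ℝ (Fin d) ↦ -w) (h.rep x₀ q hq)).trans
    ((mfderiv 𝓘(ℝ, EuclideanSpace ℝ (Fin d)) (𝓡 d) (extChartAt (𝓡 d) x₀).symm q).map_neg
      (X x₀ q)).symm
  smooth x₀ e he := (h.smooth x₀ e he).neg

end HasSmoothReps

end Flow

/-! ### Lengths of curves in charts -/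

section LengthEstimates

open Filter Topology MeasureTheory

variable {d : ℕ} {M : Type*} [MetricSpace M] [ChartedSpace (EuclideanSpace ℝ (Fin d)) M]
  [RiemannianBundle (fun x : M ↦ TangentSpace (𝓡 d) x)] [IsManifold (𝓡 d) ∞ M]
  [IsContMDiffRiemannianBundle (𝓡 d) ∞ (EuclideanSpace ℝ (Fin d))
      (fun x : M ↦ TangentSpace (𝓡 d) x)]

lemma enorm_mfderiv_eq {x₀ : M} {f : ℝ → M} {t : ℝ} (hf : MDifferentiableAt 𝓘(ℝ, ℝ) (𝓡 d) f t)
    (ht : f t ∈ (extChartAt (𝓡 d) x₀).source) {u : ℝ → EuclideanSpace ℝ (Fin d)}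
    (hu : (fun s ↦ extChartAt (𝓡 d) x₀ (f s)) =ᶠ[𝓝 t] u) {u' : EuclideanSpace ℝ (Fin d)}
    (hu' : HasDerivAt u u' t) :
    ‖(mfderiv 𝓘(ℝ, ℝ) (𝓡 d) f t (1 : ℝ) : TangentSpace (𝓡 d) (f t))‖ₑ =
      ENNReal.ofReal √(metricForm x₀ (u t) u' u') := by
  have h1 := inner_mfderiv hf ht 1 1
  have h2 : fderiv ℝ (fun s ↦ extChartAt (𝓡 d) x₀ (f s)) t 1 = u' := by
    rw [hu.fderiv_eq, fderiv_apply_one_eq_deriv, hu'.deriv]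
  have h3 : extChartAt (𝓡 d) x₀ (f t) = u t := hu.self_of_nhds
  rw [h2, h3] at h1
  rw [← h1, ← ofReal_norm]
  exact congrArg ENNReal.ofReal (norm_eq_sqrt_real_inner _)

lemma pathELength_eq_lintegral_metricForm {x₀ : M} {f : ℝ → M}
    {u u' : ℝ → EuclideanSpace ℝ (Fin d)} {a b : ℝ}
    (hf : ∀ t ∈ Icc a b, MDifferentiableAt 𝓘(ℝ, ℝ) (𝓡 d) f t)
    (hs : ∀ t ∈ Icc a b, f t ∈ (extChartAt (𝓡 d) x₀).source)
    (hu : ∀ t ∈ Icc a b, (fun s ↦ extChartAt (𝓡 d) x₀ (f s)) =ᶠ[𝓝 t] u)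
    (hu' : ∀ t ∈ Icc a b, HasDerivAt u (u' t) t) :
    Manifold.pathELength (𝓡 d) f a b =
      ∫⁻ t in Icc a b, ENNReal.ofReal √(metricForm x₀ (u t) (u' t) (u' t)) := by
  rw [Manifold.pathELength_eq_lintegral_mfderiv_Icc]
  exact setLIntegral_congr_fun measurableSet_Icc fun t ht ↦
    enorm_mfderiv_eq (hf t ht) (hs t ht) (hu t ht) (hu' t ht)

variable [IsRiemannianManifold (𝓡 d) M]

lemma edist_symm_le_lintegral {x₀ : M} {u u' : ℝ → EuclideanSpace ℝ (Fin d)}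
    (hu : ∀ t ∈ Icc (0 : ℝ) 1, ContDiffAt ℝ 1 u t)
    (ht : ∀ t ∈ Icc (0 : ℝ) 1, u t ∈ (extChartAt (𝓡 d) x₀).target)
    (hu' : ∀ t ∈ Icc (0 : ℝ) 1, HasDerivAt u (u' t) t) :
    edist ((extChartAt (𝓡 d) x₀).symm (u 0)) ((extChartAt (𝓡 d) x₀).symm (u 1)) ≤
      ∫⁻ t in Icc (0 : ℝ) 1, ENNReal.ofReal √(metricForm x₀ (u t) (u' t) (u' t)) := by
  have hf : ∀ t ∈ Icc (0 : ℝ) 1, ContMDiffAt 𝓘(ℝ, ℝ) (𝓡 d) 1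
      (fun t ↦ (extChartAt (𝓡 d) x₀).symm (u t)) t := fun t h ↦
    ((contMDiffAt_extChartAt_symm (ht t h)).of_le (by norm_cast)).comp t (hu t h).contMDiffAt
  have h1 := Manifold.riemannianEDist_le_pathELength (I := 𝓡 d) (a := 0) (b := 1)
    (γ := fun t ↦ (extChartAt (𝓡 d) x₀).symm (u t))
    (fun t h ↦ (hf t h).contMDiffWithinAt) rfl rfl zero_le_one
  rw [← IsRiemannianManifold.out (I := 𝓡 d)] at h1
  refine h1.trans_eq (pathELength_eq_lintegral_metricForm
    (fun t h ↦ (hf t h).mdifferentiableAt (by simp))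
    (fun t h ↦ (extChartAt (𝓡 d) x₀).map_target (ht t h)) (fun t h ↦ ?_) hu')
  filter_upwards [(hu t h).continuousAt.preimage_mem_nhds
    ((isOpen_extChartAt_target x₀).mem_nhds (ht t h))] with s hs
  exact (extChartAt (𝓡 d) x₀).right_inv hs

/-- The inverse of a chart is locally Lipschitz. -/
lemma exists_dist_symm_le (x₀ : M) {e₀ : EuclideanSpace ℝ (Fin d)}
    (he₀ : e₀ ∈ (extChartAt (𝓡 d) x₀).target) :
    ∃ K : ℝ, 0 ≤ K ∧ ∃ ρ > 0, ∀ e ∈ Metric.ball e₀ ρ, ∀ e' ∈ Metric.ball e₀ ρ,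
      dist ((extChartAt (𝓡 d) x₀).symm e) ((extChartAt (𝓡 d) x₀).symm e') ≤ K * ‖e - e'‖ := by
  have hc : ContinuousAt (metricForm x₀) e₀ := (contDiffAt_metricForm he₀).continuousAt
  have hev : ∀ᶠ e in 𝓝 e₀, e ∈ (extChartAt (𝓡 d) x₀).target ∧
      ‖metricForm x₀ e‖ < ‖metricForm x₀ e₀‖ + 1 :=
    Eventually.and ((isOpen_extChartAt_target x₀).mem_nhds he₀)
      (hc.norm.eventually (gt_mem_nhds (lt_add_one _)))
  obtain ⟨ρ, hρ, hball⟩ := Metric.eventually_nhds_iff_ball.1 hev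
  set K := ‖metricForm x₀ e₀‖ + 1 with hK
  have hK0 : 0 ≤ K := by positivity
  refine ⟨√K, Real.sqrt_nonneg _, ρ, hρ, fun e he e' he' ↦ ?_⟩
  let u : ℝ → EuclideanSpace ℝ (Fin d) := fun t ↦ e + t • (e' - e)
  have hub : ∀ t ∈ Icc (0 : ℝ) 1, u t ∈ Metric.ball e₀ ρ := fun t ht ↦
    (convex_ball e₀ ρ).add_smul_sub_mem he he' ht
  have hd : ∀ t ∈ Icc (0 : ℝ) 1, HasDerivAt u (e' - e) t := fun t _ ↦ by
    simpa [u, id] using! ((hasDerivAt_id t).smul_const (e' - e)).const_add e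
  have hle := edist_symm_le_lintegral (x₀ := x₀) (u := u) (u' := fun _ ↦ e' - e)
    (fun t _ ↦ by fun_prop) (fun t ht ↦ (hball _ (hub t ht)).1) hd
  have hle2 : ∫⁻ t in Icc (0 : ℝ) 1, ENNReal.ofReal √(metricForm x₀ (u t) (e' - e) (e' - e)) ≤
      ∫⁻ _ in Icc (0 : ℝ) 1, ENNReal.ofReal (√K * ‖e - e'‖) := by
    refine setLIntegral_mono measurable_const fun t ht ↦ ENNReal.ofReal_le_ofReal ?_
    rw [norm_sub_rev e e', ← Real.sqrt_sq (norm_nonneg (e' - e)), ← Real.sqrt_mul hK0]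
    refine Real.sqrt_le_sqrt (((le_abs_self _).trans
      ((metricForm x₀ (u t)).le_opNorm₂ _ _)).trans ?_)
    rw [mul_assoc, ← sq]
    gcongr
    exact (hball _ (hub t ht)).2.le
  have h := hle.trans hle2
  rw [setLIntegral_const, Real.volume_Icc, sub_zero, ENNReal.ofReal_one, mul_one, edist_dist,
    ENNReal.ofReal_le_ofReal_iff (by positivity)] at h
  simpa [u] using h

/-- The length of a path grows at most quadratically under the first order flow of a Killing
field. -/
lemma edist_pushed_le {x₀ : M} {X : EuclideanSpace ℝ (Fin d) → EuclideanSpace ℝ (Fin d)}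
    {c : ℝ → M} (hc : ContMDiff 𝓘(ℝ, ℝ) (𝓡 d) 1 c)
    (hcs : ∀ t ∈ Icc (0 : ℝ) 1, c t ∈ (extChartAt (𝓡 d) x₀).source)
    (hX : ∀ e ∈ (extChartAt (𝓡 d) x₀).target, ContDiffAt ℝ ∞ X e) {s C : ℝ} (hC : 0 ≤ C)
    (hpush : ∀ t ∈ Icc (0 : ℝ) 1, extChartAt (𝓡 d) x₀ (c t) + s • X (extChartAt (𝓡 d) x₀ (c t)) ∈
      (extChartAt (𝓡 d) x₀).target ∧ ∀ w,
        metricForm x₀ (extChartAt (𝓡 d) x₀ (c t) + s • X (extChartAt (𝓡 d) x₀ (c t)))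
          (w + s • fderiv ℝ X (extChartAt (𝓡 d) x₀ (c t)) w)
          (w + s • fderiv ℝ X (extChartAt (𝓡 d) x₀ (c t)) w) ≤
        (1 + C * s ^ 2) * metricForm x₀ (extChartAt (𝓡 d) x₀ (c t)) w w) :
    edist ((extChartAt (𝓡 d) x₀).symm
        (extChartAt (𝓡 d) x₀ (c 0) + s • X (extChartAt (𝓡 d) x₀ (c 0))))
      ((extChartAt (𝓡 d) x₀).symm
        (extChartAt (𝓡 d) x₀ (c 1) + s • X (extChartAt (𝓡 d) x₀ (c 1)))) ≤
      ENNReal.ofReal (1 + C * s ^ 2) * Manifold.pathELength (𝓡 d) c 0 1 := by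
  let u : ℝ → EuclideanSpace ℝ (Fin d) := fun t ↦ extChartAt (𝓡 d) x₀ (c t)
  have hu : ∀ t ∈ Icc (0 : ℝ) 1, ContDiffAt ℝ 1 u t := fun t ht ↦
    contDiffAt_chart_comp (n := 1) (hc t) (hcs t ht)
  have hud : ∀ t ∈ Icc (0 : ℝ) 1, HasDerivAt u (deriv u t) t := fun t ht ↦
    ((hu t ht).differentiableAt (by simp)).hasDerivAt
  have htar : ∀ t ∈ Icc (0 : ℝ) 1, u t ∈ (extChartAt (𝓡 d) x₀).target := fun t ht ↦
    (extChartAt (𝓡 d) x₀).map_source (hcs t ht)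
  have hY : ∀ t ∈ Icc (0 : ℝ) 1, ContDiffAt ℝ 1 (fun t ↦ u t + s • X (u t)) t := fun t ht ↦
    (hu t ht).add (ContDiffAt.const_smul s (ContDiffAt.comp (g := X) t
      ((hX _ (htar t ht)).of_le (by norm_cast)) (hu t ht)))
  have hYd : ∀ t ∈ Icc (0 : ℝ) 1, HasDerivAt (fun t ↦ u t + s • X (u t))
      (deriv u t + s • fderiv ℝ X (u t) (deriv u t)) t := fun t ht ↦
    (hud t ht).add ((((hX _ (htar t ht)).differentiableAt (by simp)).hasFDerivAt.comp_hasDerivAt t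
      (hud t ht)).const_smul s)
  have h1 := edist_symm_le_lintegral (x₀ := x₀) hY (fun t ht ↦ (hpush t ht).1) hYd
  have h2 := pathELength_eq_lintegral_metricForm (x₀ := x₀) (f := c) (u := u) (u' := deriv u)
    (a := 0) (b := 1) (fun t _ ↦ (hc t).mdifferentiableAt (by simp)) hcs
    (fun t _ ↦ EventuallyEq.rfl) hud
  refine h1.trans ?_
  rw [h2, ← lintegral_const_mul' _ _ ENNReal.ofReal_ne_top]
  refine setLIntegral_mono' measurableSet_Icc fun t ht ↦ ?_
  have hq : 0 ≤ C * s ^ 2 := by positivity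
  rw [← ENNReal.ofReal_mul (by positivity)]
  refine ENNReal.ofReal_le_ofReal ?_
  -- Since `1 + C s² ≥ 1`, it may be replaced by its square, so that the root leaves a polynomial
  -- factor.
  calc _ ≤ √((1 + C * s ^ 2) ^ 2 * metricForm x₀ (u t) (deriv u t) (deriv u t)) := by
        refine Real.sqrt_le_sqrt (((hpush t ht).2 _).trans ?_)
        have := metricForm_self_nonneg x₀ (u t) (deriv u t)
        gcongr
        nlinarith
    _ = _ := by rw [Real.sqrt_mul (by positivity), Real.sqrt_sq (by positivity)]

end LengthEstimates

/-! ### The flow of a Killing field does not increase distances -/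

section KillingFlow

open Filter Topology

variable {d : ℕ} {M : Type*} [MetricSpace M] [ChartedSpace (EuclideanSpace ℝ (Fin d)) M]
  [RiemannianBundle (fun x : M ↦ TangentSpace (𝓡 d) x)] [IsManifold (𝓡 d) ∞ M]
  [IsContMDiffRiemannianBundle (𝓡 d) ∞ (EuclideanSpace ℝ (Fin d))
      (fun x : M ↦ TangentSpace (𝓡 d) x)] [IsRiemannianManifold (𝓡 d) M]

/-- `v` is a smooth Killing field, with components `X x₀` in the chart around `x₀`. -/
structure HasKillingReps (v : ∀ x : M, TangentSpace (𝓡 d) x)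
    (X : M → EuclideanSpace ℝ (Fin d) → EuclideanSpace ℝ (Fin d)) : Prop
    extends HasSmoothReps v X where
  killing : ∀ x₀, ∀ e ∈ (extChartAt (𝓡 d) x₀).target, ∀ w,
    fderiv ℝ (metricForm x₀) e (X x₀ e) w w + 2 * metricForm x₀ e (fderiv ℝ (X x₀) e w) w = 0

namespace HasKillingReps

variable {v : ∀ x : M, TangentSpace (𝓡 d) x}
  {X : M → EuclideanSpace ℝ (Fin d) → EuclideanSpace ℝ (Fin d)} (h : HasKillingReps v X)
include h

lemma neg : HasKillingReps (-v) (fun x₀ e ↦ -X x₀ e) where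
  toHasSmoothReps := h.toHasSmoothReps.neg
  killing x₀ e he w := by
    have h1 := h.killing x₀ e he w
    rw [fderiv_fun_neg]
    simp only [map_neg, neg_apply]
    linarith

/-- Over a short time each curve differs from its Euler step by `o(s)`. An almost shortest path
between the starting points, pushed by the Euler step, joins the two ends, and its length grows only
by `O(s²)`. The radius `δ` is the same for all pairs of curves; only the range of `s` depends on
them. -/
lemma exists_eventually_dist_le (x₀ : M) : ∃ δ > 0, ∀ γ η : ℝ → M,
    IsMIntegralCurve (I := 𝓡 d) γ v → IsMIntegralCurve (I := 𝓡 d) η v →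
    γ 0 ∈ Metric.ball x₀ δ → η 0 ∈ Metric.ball x₀ δ → ∀ ε > 0, ∀ᶠ s in 𝓝[>] (0 : ℝ),
      dist (γ s) (η s) ≤ dist (γ 0) (η 0) + ε * s := by
  have he₀ := mem_extChartAt_target (I := 𝓡 d) x₀
  set e₀ := extChartAt (𝓡 d) x₀ x₀ with he₀def
  obtain ⟨ρ₁, hρ₁, s₀, hs₀, C, hC, hpush⟩ := exists_pushed_form_le
    (isOpen_extChartAt_target (I := 𝓡 d) x₀) (G := metricForm x₀) (X := X x₀)
    (fun e he ↦ contDiffAt_metricForm he) (h.smooth x₀) (metricForm_symm x₀)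
    (fun e he w hw ↦ metricForm_self_pos he hw) (h.killing x₀) he₀
  obtain ⟨K, hK, ρ₂, hρ₂, hlip⟩ := exists_dist_symm_le x₀ he₀
  have hball : Metric.ball e₀ (min ρ₁ ρ₂) ∈ 𝓝 e₀ := Metric.ball_mem_nhds _ (lt_min hρ₁ hρ₂)
  have hev : ∀ᶠ x in 𝓝 x₀, x ∈ (extChartAt (𝓡 d) x₀).source ∧
      extChartAt (𝓡 d) x₀ x ∈ Metric.ball e₀ (min ρ₁ ρ₂) :=
    Eventually.and (extChartAt_source_mem_nhds (I := 𝓡 d) x₀)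
      ((continuousAt_extChartAt (I := 𝓡 d) x₀).eventually_mem hball)
  obtain ⟨δ, hδ, hδx⟩ := Metric.eventually_nhds_iff_ball.1 hev
  -- With both starting points within `δ / 4` of `x₀`, a path between them of length less than `δ /
  -- 2 + δ / 4` stays in the ball of radius `δ`.
  refine ⟨δ / 4, by positivity, fun γ η hγ hη hγ0 hη0 ε hε ↦ ?_⟩
  set ε' := ε / (4 * (K + 1)) with hε'
  have hε'0 : 0 < ε' := by positivity
  have euler : ∀ γ : ℝ → M, IsMIntegralCurve (I := 𝓡 d) γ v → γ 0 ∈ Metric.ball x₀ (δ / 4) →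
      ∀ᶠ s in 𝓝[>] (0 : ℝ), dist (γ s) ((extChartAt (𝓡 d) x₀).symm
        (extChartAt (𝓡 d) x₀ (γ 0) + s • X x₀ (extChartAt (𝓡 d) x₀ (γ 0)))) ≤ ε / 4 * s := by
    intro γ hγ hγ0
    obtain ⟨hsrc, hb⟩ := hδx _ (Metric.ball_subset_ball (by linarith) hγ0)
    have hd := h.hasDerivAt_chart hγ hsrc
    have h1 := (hasDerivAt_iff_isLittleO.1 hd).def hε'0
    have hγc : ContinuousAt γ 0 := (hγ 0).continuousAt
    have h2 : ∀ᶠ s in 𝓝 (0 : ℝ), γ s ∈ (extChartAt (𝓡 d) x₀).source :=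
      hγc.eventually_mem ((isOpen_extChartAt_source x₀).mem_nhds hsrc)
    have hbo := Metric.isOpen_ball (x := e₀) (ε := min ρ₁ ρ₂)
    have h3 : ∀ᶠ s in 𝓝 (0 : ℝ), extChartAt (𝓡 d) x₀ (γ s) ∈ Metric.ball e₀ (min ρ₁ ρ₂) :=
      hd.continuousAt.eventually_mem (hbo.mem_nhds hb)
    have h4 : ∀ᶠ s in 𝓝 (0 : ℝ), extChartAt (𝓡 d) x₀ (γ 0) +
        s • X x₀ (extChartAt (𝓡 d) x₀ (γ 0)) ∈ Metric.ball e₀ (min ρ₁ ρ₂) := by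
      have hc : ContinuousAt (fun s : ℝ ↦ extChartAt (𝓡 d) x₀ (γ 0) +
        s • X x₀ (extChartAt (𝓡 d) x₀ (γ 0))) 0 := by fun_prop
      refine hc.eventually_mem (hbo.mem_nhds ?_)
      simpa using hb
    filter_upwards [h1.filter_mono nhdsWithin_le_nhds, h2.filter_mono nhdsWithin_le_nhds,
      h3.filter_mono nhdsWithin_le_nhds, h4.filter_mono nhdsWithin_le_nhds,
      self_mem_nhdsWithin] with s h1 h2 h3 h4 hs
    have hs' : (0 : ℝ) < s := hs
    have h5 := hlip _ (Metric.ball_subset_ball (min_le_right _ _) h3) _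
      (Metric.ball_subset_ball (min_le_right _ _) h4)
    rw [(extChartAt (𝓡 d) x₀).left_inv h2] at h5
    refine h5.trans ?_
    rw [sub_zero, Real.norm_eq_abs, abs_of_pos hs', sub_sub] at h1
    calc K * _ ≤ K * (ε' * s) := by gcongr
      _ ≤ (K + 1) * (ε' * s) := by gcongr; linarith
      _ = ε / 4 * s := by rw [hε']; field_simp
  set D := dist (γ 0) (η 0) with hD
  have hD0 : 0 ≤ D := dist_nonneg
  have hDδ : D < δ / 2 := by
    have := dist_triangle_right (γ 0) (η 0) x₀
    rw [Metric.mem_ball] at hγ0 hη0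
    linarith
  -- `(1 + C s²)(D + s²) - D = s² (C D + 1 + C s²)`, so the first bound leaves `ε s / 2` for the
  -- pushed path. The other half of `ε s` pays for the two Euler errors.
  have hsmall : ∀ᶠ s in 𝓝 (0 : ℝ), s * (C * D + 1 + C * s ^ 2) < ε / 2 ∧ s ^ 2 < δ / 4 ∧ s < s₀ := by
    refine Eventually.and ?_ (Eventually.and ?_ (gt_mem_nhds hs₀))
    · have hc : ContinuousAt (fun s : ℝ ↦ s * (C * D + 1 + C * s ^ 2)) 0 := by fun_prop
      exact hc.eventually (gt_mem_nhds (by simpa using half_pos hε))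
    · have hc : ContinuousAt (fun s : ℝ ↦ s ^ 2) 0 := by fun_prop
      exact hc.eventually (gt_mem_nhds (by simpa using hδ))
  filter_upwards [euler γ hγ hγ0, euler η hη hη0, hsmall.filter_mono nhdsWithin_le_nhds,
    self_mem_nhdsWithin] with s h1 h2 ⟨h3, h4, h5⟩ hs
  have hs' : (0 : ℝ) < s := hs
  obtain ⟨c, hc0, hc1, hc, hlen⟩ := exists_path_of_dist_lt (d := d)
    (show dist (γ 0) (η 0) < D + s ^ 2 by rw [← hD]; linarith [pow_pos hs' 2])
  have hcb : ∀ t ∈ Icc (0 : ℝ) 1, c t ∈ Metric.ball x₀ δ := by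
    intro t ht
    have h6 := ((edist_le_pathELength hc ht.1).trans
      (Manifold.pathELength_mono le_rfl ht.2)).trans_lt hlen
    rw [edist_dist, ENNReal.ofReal_lt_ofReal_iff (by positivity), hc0] at h6
    have h7 := dist_triangle_left (c t) x₀ (γ 0)
    rw [Metric.mem_ball] at hγ0 ⊢
    linarith
  have h6 := edist_pushed_le (x₀ := x₀) (X := X x₀) (s := s) hc
    (fun t ht ↦ (hδx _ (hcb t ht)).1) (h.smooth x₀) hC
    (fun t ht ↦ hpush _ (Metric.ball_subset_ball (min_le_left _ _) (hδx _ (hcb t ht)).2) s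
      ⟨hs'.le, h5.le⟩)
  rw [hc0, hc1] at h6
  have h7 := h6.trans (mul_le_mul_right hlen.le _)
  rw [← ENNReal.ofReal_mul (by positivity), edist_dist,
    ENNReal.ofReal_le_ofReal_iff (by positivity)] at h7
  have h8 := dist_triangle4 (γ s) ((extChartAt (𝓡 d) x₀).symm
        (extChartAt (𝓡 d) x₀ (γ 0) + s • X x₀ (extChartAt (𝓡 d) x₀ (γ 0))))
    ((extChartAt (𝓡 d) x₀).symm
        (extChartAt (𝓡 d) x₀ (η 0) + s • X x₀ (extChartAt (𝓡 d) x₀ (η 0)))) (η s)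
  rw [dist_comm ((extChartAt (𝓡 d) x₀).symm
    (extChartAt (𝓡 d) x₀ (η 0) + s • X x₀ (extChartAt (𝓡 d) x₀ (η 0)))) (η s)] at h8
  have h9 : (1 + C * s ^ 2) * (D + s ^ 2) ≤ D + ε / 2 * s := by
    nlinarith [mul_lt_mul_of_pos_right h3 hs']
  linarith

variable [CompactSpace M]

/-- A Lebesgue number makes the local radius uniform. Continuous induction in `t` then gives a
distance of at most `dist (γ 0) (η 0) + ε t`, and `ε` is arbitrary. -/
lemma exists_dist_le_of_dist_lt : ∃ δ > 0, ∀ γ η : ℝ → M,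
    IsMIntegralCurve (I := 𝓡 d) γ v → IsMIntegralCurve (I := 𝓡 d) η v →
    dist (γ 0) (η 0) < δ → ∀ t ≥ 0, dist (γ t) (η t) ≤ dist (γ 0) (η 0) := by
  choose δ hδ hx using h.exists_eventually_dist_le
  obtain ⟨δ', hδ', hleb⟩ := lebesgue_number_lemma_of_metric (c := fun x ↦ Metric.ball x (δ x))
    isCompact_univ (fun _ ↦ Metric.isOpen_ball)
    (fun x _ ↦ mem_iUnion.2 ⟨x, Metric.mem_ball_self (hδ x)⟩)
  refine ⟨δ', hδ', fun γ η hγ hη hlt T hT ↦ le_of_forall_pos_le_add fun κ hκ ↦ ?_⟩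
  -- The total allowed growth `κ'` keeps the curves closer than `δ'` up to time `T`, so the local
  -- estimate can be restarted at each time.
  obtain ⟨κ', hκ', hκκ, hκδ⟩ : ∃ κ' > 0, κ' ≤ κ ∧ dist (γ 0) (η 0) + κ' < δ' :=
    ⟨min κ ((δ' - dist (γ 0) (η 0)) / 2), lt_min hκ (by linarith), min_le_left _ _, by
      linarith [min_le_right κ ((δ' - dist (γ 0) (η 0)) / 2)]⟩
  set ε := κ' / (T + 1) with hε
  have hε0 : 0 < ε := by positivity
  have hεT : ∀ t ∈ Icc 0 T, ε * t ≤ κ' := fun t ht ↦ by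
    rw [hε, div_mul_eq_mul_div, div_le_iff₀ (by positivity)]
    gcongr
    linarith [ht.2]
  have hsub : Icc 0 T ⊆ {t | dist (γ t) (η t) ≤ dist (γ 0) (η 0) + ε * t} := by
    refine IsClosed.Icc_subset_of_forall_exists_gt ?_ (by simp) ?_
    · have h1 : IsClosed {t : ℝ | dist (γ t) (η t) ≤ dist (γ 0) (η 0) + ε * t} :=
        isClosed_le (hγ.continuous.dist hη.continuous) (by fun_prop)
      exact h1.inter isClosed_Icc
    · rintro t ⟨ht, htT⟩ y hy
      have hlt' : dist (γ t) (η t) < δ' :=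
        (show dist (γ t) (η t) ≤ _ from ht).trans_lt
          (by linarith [hεT t ⟨htT.1, htT.2.le⟩])
      obtain ⟨x, hball⟩ := hleb (γ t) (mem_univ _)
      have h1 := hx x _ _ (hγ.comp_add t) (hη.comp_add t)
        (hball (by simpa using hδ')) (hball (by simpa [dist_comm] using hlt')) ε hε0
      have hyt : (0 : ℝ) < y - t := sub_pos.2 hy
      obtain ⟨s, hs, hs0, hsy⟩ := (h1.and (Ioc_mem_nhdsGT hyt)).exists
      simp only [Function.comp_apply, zero_add] at hs
      refine ⟨s + t, ?_, by linarith, by linarith⟩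
      have ht' : dist (γ t) (η t) ≤ dist (γ 0) (η 0) + ε * t := ht
      show dist (γ (s + t)) (η (s + t)) ≤ dist (γ 0) (η 0) + ε * (s + t)
      linarith
  have h1 : dist (γ T) (η T) ≤ dist (γ 0) (η 0) + ε * T := hsub (right_mem_Icc.2 hT)
  linarith [hεT T (right_mem_Icc.2 hT)]

/-- For distant starting points, cut an almost shortest path between them into pieces with endpoints
closer than `δ`, flow the division points, and add up. Only finitely many points are moved, so no
regularity of the flow in its initial point is needed. -/
lemma dist_le_of_nonneg {γ η : ℝ → M} (hγ : IsMIntegralCurve (I := 𝓡 d) γ v)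
    (hη : IsMIntegralCurve (I := 𝓡 d) η v) {t : ℝ} (ht : 0 ≤ t) :
    dist (γ t) (η t) ≤ dist (γ 0) (η 0) := by
  obtain ⟨δ, hδ, hδx⟩ := h.exists_dist_le_of_dist_lt
  choose Φ hΦ0 hΦ using h.exists_isMIntegralCurve
  have huniq : ∀ γ : ℝ → M, IsMIntegralCurve (I := 𝓡 d) γ v → Φ (γ 0) = γ := fun γ hγ ↦
    isMIntegralCurve_Ioo_eq_of_contMDiff_boundaryless (t₀ := 0) h.contMDiff (hΦ _) hγ (hΦ0 _)
  refine le_of_forall_pos_lt_add fun κ hκ ↦ ?_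
  obtain ⟨c, hc0, hc1, hc, hlen⟩ := exists_path_of_dist_lt (d := d)
    (lt_add_of_pos_right (dist (γ 0) (η 0)) hκ)
  obtain ⟨δ', hδ', hδc⟩ := Metric.uniformContinuousOn_iff.1
    (isCompact_Icc.uniformContinuousOn_of_continuous (hc.continuous.continuousOn (s := Icc 0 1)))
    δ hδ
  obtain ⟨N, hN⟩ := exists_nat_one_div_lt hδ'
  have hN0 : (0 : ℝ) < N + 1 := by positivity
  have hstep : ∀ k : ℕ, k ≤ N + 1 → edist (Φ (c 0) t) (Φ (c (k / (N + 1))) t) ≤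
      Manifold.pathELength (𝓡 d) c 0 (k / (N + 1)) := by
    intro k
    induction k with
    | zero => intro _; simp
    | succ k ih =>
      intro hk
      have hk' : ((k : ℝ) + 1) ≤ N + 1 := by exact_mod_cast hk
      have h1 : (0 : ℝ) ≤ k / (N + 1) := by positivity
      have h2 : (k : ℝ) / (N + 1) ≤ ((k + 1 : ℕ) : ℝ) / (N + 1) := by
        gcongr
        simp
      have h3 : ((k + 1 : ℕ) : ℝ) / (N + 1) ≤ 1 := by
        rw [div_le_one hN0]
        exact_mod_cast hk
      have h4 : dist (c (k / (N + 1))) (c ((k + 1 : ℕ) / (N + 1))) < δ := by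
        refine hδc _ ⟨h1, h2.trans h3⟩ _ ⟨h1.trans h2, h3⟩ ?_
        rw [dist_comm, Real.dist_eq, ← sub_div, abs_of_nonneg (by simp; positivity)]
        simpa using hN
      have h5 := hδx _ _ (hΦ (c (k / (N + 1)))) (hΦ (c ((k + 1 : ℕ) / (N + 1))))
        (by rwa [hΦ0, hΦ0]) t ht
      rw [hΦ0, hΦ0] at h5
      rw [← Manifold.pathELength_add h1 h2]
      refine (edist_triangle _ _ _).trans (add_le_add (ih (by omega)) ?_)
      refine le_trans ?_ (edist_le_pathELength hc h2)
      rw [edist_dist, edist_dist]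
      exact ENNReal.ofReal_le_ofReal h5
  have h1 := hstep (N + 1) le_rfl
  rw [Nat.cast_add, Nat.cast_one, div_self hN0.ne', hc0, hc1, huniq γ hγ, huniq η hη] at h1
  have h2 := h1.trans_lt hlen
  rwa [edist_dist, ENNReal.ofReal_lt_ofReal_iff (by positivity)] at h2

/-- The flow of a Killing field does not increase distances. -/
lemma dist_le {γ η : ℝ → M} (hγ : IsMIntegralCurve (I := 𝓡 d) γ v)
    (hη : IsMIntegralCurve (I := 𝓡 d) η v) (t : ℝ) : dist (γ t) (η t) ≤ dist (γ 0) (η 0) := by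
  rcases le_total 0 t with ht | ht
  · exact h.dist_le_of_nonneg hγ hη ht
  -- Negative times are positive times for the Killing field `-v`.
  · have hγ' := hγ.comp_mul (-1)
    have hη' := hη.comp_mul (-1)
    rw [neg_one_smul] at hγ' hη'
    simpa using h.neg.dist_le_of_nonneg hγ' hη' (neg_nonneg.2 ht)

end HasKillingReps

end KillingFlow

/-! ### Transverse distance and orbit closures -/

section ReebFlow

open Filter Topology

variable {n : ℕ} {S : Type*} [MetricSpace S]
    [ChartedSpace (EuclideanSpace ℝ (Fin (2 * n + 1))) S]
    [IsManifold (𝓡 (2 * n + 1)) ∞ S]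
    [RiemannianBundle (fun x : S ↦ TangentSpace (𝓡 (2 * n + 1)) x)]
    [IsContMDiffRiemannianBundle (𝓡 (2 * n + 1)) ∞ (EuclideanSpace ℝ (Fin (2 * n + 1)))
      (fun x : S ↦ TangentSpace (𝓡 (2 * n + 1)) x)]
    [IsRiemannianManifold (𝓡 (2 * n + 1)) S]

namespace SasakiStructure

variable (σ : SasakiStructure n S)

lemma hasKillingReps : HasKillingReps σ.reeb (reebRep σ.J) where
  rep _ _ he := coneTangential_eq_reebRep he
  smooth _ _ he := contDiffAt_reebRep σ.isKahler he
  killing _ _ he w := fderiv_metricForm_reebRep σ.isKahler he w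

variable [CompactSpace S]

lemma mem_orbit_self (x : S) : x ∈ σ.orbit x := by
  obtain ⟨γ, h0, hγ⟩ := σ.hasKillingReps.exists_isMIntegralCurve x
  exact ⟨γ, 0, hγ, h0, h0⟩

/-- The distance between two orbits can be measured from any point of one of them. -/
lemma exists_mem_orbit_dist_le {x y a b : S} (ha : a ∈ σ.orbit x) (hb : b ∈ σ.orbit y) :
    ∃ a' ∈ σ.orbit x, dist y a' ≤ dist a b := by
  obtain ⟨γ, s, hγ, hγ0, rfl⟩ := ha
  obtain ⟨η, t, hη, hη0, rfl⟩ := hb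
  refine ⟨γ (s - t), ⟨γ, s - t, hγ, hγ0, rfl⟩, ?_⟩
  -- Flowing both points for time `-t` returns `b = η t` to `y` and takes `a = γ s` to `γ (s - t)`.
  have h := σ.hasKillingReps.dist_le (hγ.comp_add s) (hη.comp_add t) (-t)
  simp only [Function.comp_apply, zero_add, neg_add_cancel, hη0] at h
  rw [dist_comm, sub_eq_neg_add]
  exact h

lemma transverseDist_le_dist {x y a b : S} (ha : a ∈ σ.orbit x) (hb : b ∈ σ.orbit y) :
    σ.transverseDist x y ≤ dist a b :=
  csInf_le ⟨0, by rintro _ ⟨a, -, b, -, rfl⟩; exact dist_nonneg⟩ (mem_image2_of_mem ha hb)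

/-- The transverse distance to the orbit of `x` is the distance to the closure of the orbit. -/
lemma transverseDist_le_iff {x y : S} {r : ℝ} :
    σ.transverseDist x y ≤ r ↔
      ∃ q ∈ closure (σ.orbit x), (∀ q' ∈ closure (σ.orbit x), dist y q ≤ dist y q') ∧
        dist y q ≤ r := by
  have hne : (σ.orbit x).Nonempty := ⟨x, σ.mem_orbit_self x⟩
  constructor
  · intro h
    obtain ⟨q, hq, hmin⟩ := isClosed_closure.isCompact.exists_isMinOn hne.closure
      (f := fun q ↦ dist y q) (by fun_prop)
    refine ⟨q, hq, fun q' hq' ↦ hmin hq', le_trans ?_ h⟩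
    refine le_csInf (hne.image2 ⟨y, σ.mem_orbit_self y⟩) ?_
    rintro _ ⟨a, ha, b, hb, rfl⟩
    obtain ⟨a', ha', hle⟩ := σ.exists_mem_orbit_dist_le ha hb
    exact (hmin (subset_closure ha') : dist y q ≤ dist y a').trans hle
  · rintro ⟨q, hq, -, hle⟩
    refine le_of_forall_pos_le_add fun ε hε ↦ ?_
    obtain ⟨a, ha, haq⟩ := Metric.mem_closure_iff.1 hq ε hε
    have h1 := σ.transverseDist_le_dist ha (σ.mem_orbit_self y)
    have h2 := dist_triangle_left a y q
    rw [dist_comm q y] at h2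
    linarith

end SasakiStructure

end ReebFlow

/-! ### Geodesic tubes and the exponential map -/

section GeodesicTubes

variable {d : ℕ} {M : Type*} [MetricSpace M] [ChartedSpace (EuclideanSpace ℝ (Fin d)) M]
  [RiemannianBundle (fun x : M ↦ TangentSpace (𝓡 d) x)] [IsManifold (𝓡 d) ∞ M]
  [IsContMDiffRiemannianBundle (𝓡 d) ∞ (EuclideanSpace ℝ (Fin d))
      (fun x : M ↦ TangentSpace (𝓡 d) x)]

/-- The bound on `r` lives in `EReal` because `r` may be negative and the injectivity radius
infinite. A norm or distance below `r` brings it back to `ℝ≥0∞`. -/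
lemma ofReal_le_of_coe_le {a r : ℝ} {R : ℝ≥0∞} (ha : 0 ≤ a) (har : a ≤ r)
    (hr : (r : EReal) ≤ (R : EReal)) : ENNReal.ofReal a ≤ R := by
  rw [← EReal.coe_ennreal_le_coe_ennreal_iff, EReal.coe_ennreal_ofReal, max_eq_left ha]
  exact (EReal.coe_le_coe_iff.2 har).trans hr

lemma IsGeodesic.pathELength_le_iff {γ : ℝ → M} (hγ : IsGeodesic (d := d) γ) {r : ℝ} :
    ((Manifold.pathELength (𝓡 d) γ 0 1 : ℝ≥0∞) : EReal) ≤ (r : EReal) ↔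
      ‖velocity (d := d) γ 0‖ ≤ r := by
  rw [hγ.pathELength_eq, sub_zero, ENNReal.ofReal_one, one_mul, ← ofReal_norm,
    EReal.coe_ennreal_ofReal, max_eq_left (norm_nonneg _), EReal.coe_le_coe_iff]

/-- For `v ≠ 0` the bound makes the injectivity radius positive. For `v = 0` it says nothing, and
the constant geodesic serves. -/
lemma exists_isGeodesic_of_norm_le_injRadius {y : M} {v : TangentSpace (𝓡 d) y}
    (hv : ENNReal.ofReal ‖v‖ ≤ injRadius d M) :
    ∃ γ : ℝ → M, IsGeodesic (d := d) γ ∧ HasInitialVelocity γ y v := by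
  rcases eq_or_ne v 0 with rfl | hv0
  · exact ⟨_, isGeodesic_const y, hasInitialVelocity_const y⟩
  · exact exists_isGeodesic_of_injRadiusAt_pos
      ((ENNReal.ofReal_pos.2 (norm_pos_iff.2 hv0)).trans_le (hv.trans (iInf_le _ y))) v

/-- A geodesic on `[0, 1]` has length equal to its initial speed and ends at the exponential of its
initial velocity. The bound on `r` ensures that `expMap` is not at its default value. -/
lemma geodesicTube_eq_iUnion_expMap (P : Set M) {r : ℝ}
    (hr : (r : EReal) ≤ ((injRadius d M : ℝ≥0∞) : EReal)) :
    geodesicTube d P r = ⋃ y ∈ P, {m | ∃ v ∈ normalSpaceOf (d := d) P y,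
      ‖v‖ ≤ r ∧ expMap (d := d) y v = m} := by
  ext m
  simp only [mem_iUnion₂, exists_prop]
  constructor
  · rintro ⟨γ, hγ, rfl, h0, hn, hl⟩
    exact ⟨γ 0, h0, velocity γ 0, hn, hγ.pathELength_le_iff.1 hl, expMap_eq hγ rfl⟩
  · rintro ⟨y, hy, v, hv, hvr, rfl⟩
    obtain ⟨γ, hγ, hγv⟩ := exists_isGeodesic_of_norm_le_injRadius (v := v)
      (ofReal_le_of_coe_le (norm_nonneg v) hvr hr)
    have h2 : γ 0 = y := congrArg TotalSpace.proj hγv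
    subst h2
    have h3 : velocity (d := d) γ 0 = v := eq_of_heq (TotalSpace.mk.inj hγv).2
    exact ⟨γ, hγ, (expMap_eq hγ hγv).symm, hy, h3 ▸ hv, hγ.pathELength_le_iff.2 (h3 ▸ hvr)⟩

end GeodesicTubes

end

end

/-! ### Equality of the three tubes -/

theorem proposition2p1 {n : ℕ} {S : Type*} [MetricSpace S] [CompactSpace S]
    [ChartedSpace (EuclideanSpace ℝ (Fin (2 * n + 1))) S]
    [IsManifold (𝓡 (2 * n + 1)) ∞ S]
    [RiemannianBundle (fun x : S ↦ TangentSpace (𝓡 (2 * n + 1)) x)]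
    [IsContMDiffRiemannianBundle (𝓡 (2 * n + 1)) ∞ (EuclideanSpace ℝ (Fin (2 * n + 1)))
      (fun x : S ↦ TangentSpace (𝓡 (2 * n + 1)) x)]
    [IsRiemannianManifold (𝓡 (2 * n + 1)) S]
    (σ : SasakiStructure n S) (p : S) (r : ℝ)
    (hr : (r : EReal) ≤ ((injRadius (2 * n + 1) S : ℝ≥0∞) : EReal)) :
    σ.transverseTube p r = geodesicTube (2 * n + 1) (closure (σ.orbit p)) r ∧
    geodesicTube (2 * n + 1) (closure (σ.orbit p)) r =
      ⋃ y ∈ closure (σ.orbit p),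
        {m | ∃ v ∈ normalSpaceOf (d := 2 * n + 1) (closure (σ.orbit p)) y,
          ‖v‖ ≤ r ∧ expMap (d := 2 * n + 1) y v = m} := by
  refine ⟨Set.ext fun m ↦ ?_, geodesicTube_eq_iUnion_expMap _ hr⟩
  refine σ.transverseDist_le_iff.trans ⟨?_, ?_⟩
  · rintro ⟨q, hq, hmin, hle⟩
    obtain ⟨γ, hγ, h1, h0, hn, hl⟩ := exists_geodesic_normal_of_isMin hmin
      (ofReal_le_of_coe_le dist_nonneg hle hr)
    exact ⟨γ, hγ, h1, h0 ▸ hq, hn, hγ.pathELength_le_iff.2 (hl.trans_le hle)⟩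
  -- The length of the geodesic bounds the distance from its end to `γ 0 ∈ P`, and a nearest point
  -- of `P` is at most as far away.
  · rintro ⟨γ, hγ, rfl, h0, hn, hl⟩
    obtain ⟨q, hq, hmin⟩ := isClosed_closure.isCompact.exists_isMinOn ⟨γ 0, h0⟩
      (f := fun q ↦ dist (γ 1) q) (by fun_prop)
    refine ⟨q, hq, fun q' hq' ↦ hmin hq', ?_⟩
    have h1 := hγ.dist_le (a := 0) (b := 1) zero_le_one
    rw [sub_zero, one_mul, dist_comm] at h1
    exact ((hmin h0 : dist (γ 1) q ≤ dist (γ 1) (γ 0)).trans h1).trans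
      (hγ.pathELength_le_iff.1 hl)
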